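/- Let $\Omega\subset\mathbb{R}^n$ be open, let $p\in\partial\Omega$, let $r>0$, write $B=B_r(p)$ for the open ball, and suppose that $\partial\Omega\cap B$ is $C^1$ (near each of its points, $\Omega$ is $\{\rho<0\}$ for a $C^1$ function $\rho$ that vanishes with nonzero differential at that point). For a $C^2$ function $w$ put $$g^{ij}=\delta_{ij}-\frac{w_iw_j}{1+|Dw|^2},\quad A_{ij}=\frac{w_{ij}}{\sqrt{1+|Dw|^2}},\quad A^i_j=\sum_k g^{ik}A_{kj},\quad H=\sum_{i,j}g^{ij}A_{ij},\quad R=H^2-\sum_{i,j}A^i_jA^j_i ,$$ the inverse metric, second fundamental form and shape operator (for the upward unit normal), mean curvature and scalar curvature of the graph of $w$. Let $$u\in C^2\big(B\setminus\overline{\Omega\cap B}\big)\cap C^0\big(B\setminus(\Omega\cap B)\big),\qquad v\in C^2(\Omega\cap B)\cap C^0\big(\overline{\Omega\cap B}\big)$$ satisfy $u\ge 0$, $v\le 0$, and $u=v=0$ on $\partial\Omega\cap B$. Suppose that the graphs of $u$ over $B\setminus\Omega$ and of $v$ over $\overline{\Omega}\cap B$ are $C^2$ hypersurfaces with boundary in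 $\mathbb{R}^{n+1}$ ($C^2$ up to the boundary), the boundary of each being its part over $\partial\Omega\cap B$. Suppose that $R=0$ and $H\ge 0$ for $u$ in $B\setminus\overline{\Omega\cap B}$ and for $v$ in $\Omega\cap B$, and that the matrix $\big(Hg^{ij}-\sum_kA^i_kg^{kj}\big)_{i,j}$ of $u$ is positive definite at every point of $B\setminus\overline{\Omega\cap B}$. Then it is not possible that both $|Du(x)|\to\infty$ as $x\to p$ in $B\setminus\overline{\Omega\cap B}$ and $|Dv(x)|\to\infty$ as $x\to p$ in $\Omega\cap B$. -/

import Mathlib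

namespace GraphCurvature

/-- The partial derivative `∂u/∂xⁱ` on `ℝⁿ`. -/
noncomputable def partialDeriv {n : ℕ} (i : Fin n) (u : EuclideanSpace ℝ (Fin n) → ℝ)
    (x : EuclideanSpace ℝ (Fin n)) : ℝ :=
  fderiv ℝ u x (EuclideanSpace.single i 1)

/-- `Du = (u₁, …, uₙ)`, a vector of `ℝⁿ` with the Euclidean norm. -/
noncomputable def Du {n : ℕ} (u : EuclideanSpace ℝ (Fin n) → ℝ)
    (x : EuclideanSpace ℝ (Fin n)) : EuclideanSpace ℝ (Fin n) :=
  WithLp.toLp 2 fun i => partialDeriv i u x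

/-- `D²u = (u_{ij})`. -/
noncomputable def D2u {n : ℕ} (u : EuclideanSpace ℝ (Fin n) → ℝ)
    (x : EuclideanSpace ℝ (Fin n)) : Matrix (Fin n) (Fin n) ℝ :=
  Matrix.of fun i j => partialDeriv j (partialDeriv i u) x

/-- The inverse `g^{ij} = δ_{ij} - qᵢ qⱼ / (1 + |q|²)` of the induced metric of a graph
with gradient `q`. -/
noncomputable def invMetric {n : ℕ} (q : EuclideanSpace ℝ (Fin n)) :
    Matrix (Fin n) (Fin n) ℝ :=
  Matrix.of fun i j => (if i = j then 1 else 0) - q i * q j / (1 + ‖q‖ ^ 2)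

/-- The second fundamental form `A_{ij} = ξ_{ij} / √(1 + |q|²)`, with respect to the upward
unit normal, of a graph with gradient `q` and Hessian `ξ`. -/
noncomputable def secondFundForm {n : ℕ} (q : EuclideanSpace ℝ (Fin n))
    (ξ : Matrix (Fin n) (Fin n) ℝ) : Matrix (Fin n) (Fin n) ℝ :=
  Matrix.of fun i j => ξ i j / Real.sqrt (1 + ‖q‖ ^ 2)

/-- The shape operator `A^i_j = ∑ₖ g^{ik} A_{kj}`. -/
noncomputable def shapeOp {n : ℕ} (q : EuclideanSpace ℝ (Fin n))
    (ξ : Matrix (Fin n) (Fin n) ℝ) : Matrix (Fin n) (Fin n) ℝ :=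
  Matrix.of fun i j => ∑ k, invMetric q i k * secondFundForm q ξ k j

/-- The mean curvature `H = ∑_{i,j} g^{ij} A_{ij}`. -/
noncomputable def meanCurv {n : ℕ} (q : EuclideanSpace ℝ (Fin n))
    (ξ : Matrix (Fin n) (Fin n) ℝ) : ℝ :=
  ∑ i, ∑ j, invMetric q i j * secondFundForm q ξ i j

/-- The scalar curvature `R = H² - ∑_{i,j} A^i_j A^j_i`. -/
noncomputable def scalarCurv {n : ℕ} (q : EuclideanSpace ℝ (Fin n))
    (ξ : Matrix (Fin n) (Fin n) ℝ) : ℝ :=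
  meanCurv q ξ ^ 2 - ∑ i, ∑ j, shapeOp q ξ i j * shapeOp q ξ j i

/-- The matrix `H g^{ij} - ∑ₖ A^i_k g^{kj}`. -/
noncomputable def ellipticityMatrix {n : ℕ} (q : EuclideanSpace ℝ (Fin n))
    (ξ : Matrix (Fin n) (Fin n) ℝ) : Matrix (Fin n) (Fin n) ℝ :=
  Matrix.of fun i j =>
    meanCurv q ξ * invMetric q i j - ∑ k, shapeOp q ξ i k * invMetric q k j

/-- The set `Ω` has a `C¹` boundary near its boundary point `q`: in a neighbourhood of `q` it
is a strict sublevel set of a `C¹` function whose differential does not vanish at `q`. -/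
def HasC1BoundaryAt {n : ℕ} (Ω : Set (EuclideanSpace ℝ (Fin n)))
    (q : EuclideanSpace ℝ (Fin n)) : Prop :=
  ∃ (N : Set (EuclideanSpace ℝ (Fin n))) (ρ : EuclideanSpace ℝ (Fin n) → ℝ),
    IsOpen N ∧ q ∈ N ∧ ContDiffOn ℝ 1 ρ N ∧ ρ q = 0 ∧ fderiv ℝ ρ q ≠ 0 ∧
      Ω ∩ N = {x ∈ N | ρ x < 0}

/-- The graph of `u` over the set `S`, as a subset of `ℝⁿ × ℝ`. -/
def graphOver {n : ℕ} (u : EuclideanSpace ℝ (Fin n) → ℝ)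
    (S : Set (EuclideanSpace ℝ (Fin n))) : Set (EuclideanSpace ℝ (Fin n) × ℝ) :=
  (fun x => (x, u x)) '' S

/-- `M ⊆ ℝⁿ⁺¹` is a `C²` hypersurface with boundary `Γ`, `C²` up to the boundary: near a
point of `M \ Γ` it is a regular level set `{F = 0}` of a `C²` function, and near a point
of `Γ` it is `{F = 0, G ≥ 0}`, with `Γ = {F = 0, G = 0}`, for two `C²` functions with
linearly independent differentials at that point. -/
def IsC2HypersurfaceWithBoundary {n : ℕ} (M Γ : Set (EuclideanSpace ℝ (Fin n) × ℝ)) : Prop :=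
  Γ ⊆ M ∧
  (∀ P ∈ M \ Γ, ∃ (N : Set (EuclideanSpace ℝ (Fin n) × ℝ))
      (F : EuclideanSpace ℝ (Fin n) × ℝ → ℝ),
    IsOpen N ∧ P ∈ N ∧ ContDiffOn ℝ 2 F N ∧ fderiv ℝ F P ≠ 0 ∧
      M ∩ N = {X ∈ N | F X = 0}) ∧
  (∀ P ∈ Γ, ∃ (N : Set (EuclideanSpace ℝ (Fin n) × ℝ))
      (F G : EuclideanSpace ℝ (Fin n) × ℝ → ℝ),
    IsOpen N ∧ P ∈ N ∧ ContDiffOn ℝ 2 F N ∧ ContDiffOn ℝ 2 G N ∧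
      LinearIndependent ℝ ![fderiv ℝ F P, fderiv ℝ G P] ∧
      M ∩ N = {X ∈ N | F X = 0 ∧ 0 ≤ G X} ∧
      Γ ∩ N = {X ∈ N | F X = 0 ∧ G X = 0})

end GraphCurvature

/-! Suppose both gradients blow up at `p`. Reflect `v` to `-v ≥ 0`. At `(p, 0)` the graphs of `u`
and `-v` then share a vertical tangent plane, spanned by the vertical axis and the tangent space of
`∂Ω`. Let `e` be the unit normal of `∂Ω` at `p` pointing out of `Ω`. Near `(p, 0)` both surfaces are
graphs in the direction `e` of `C²` functions `f` (from `u`) and `g` (from `-v`), by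
`exists_normalGraph`. Their variable is a point `y` of `ℝⁿ` whose component `t = ⟨e, y - p⟩` is read
as the height, and the half ball `t ≥ 0` parametrizes the surfaces. Both gradients vanish at `p`. On
`t = 0` both functions describe `∂Ω`, so `f = g`. For `t > 0` the first surface lies over the
outside of `Ω` and the second over the inside, so `f > g`. Both satisfy the geometric equation `R =
0`, which becomes `curvForm (Df) (-D²f) = 0` by `exists_congr_of_normalGraph`. Hopf's boundary lemma
would make the `e`-derivative of `f - g` at `p` positive, a contradiction (`not_touching`).

The difficulty is that ellipticity is known only for `t > 0` and may degenerate at `p`. The barrier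
`t + L t² - |y - p|²` needs only a positive coefficient in the direction `e`, because `L` can then
absorb all other terms. With `A = -D²f` and `Df = 0`, that coefficient is `tr A - ⟨e, A e⟩ = H +
f_ee`. As `H ≥ 0` it suffices that `f_ee > 0` at `p`, and this follows from Hopf's lemma applied to
`f_e`, which is positive for `t > 0` and zero at `p` (`fderiv_fderiv_apply_self_pos`). No uniform
ellipticity is needed there. Where a multiple of the barrier touches `f_e` from below, `f_ee > 0`,
and `R = 0`, `H ≥ 0` then force the coefficient to be at least `|A| / 4`
(`frob_le_dotProduct_newton`), while every error term is at most a multiple of `|A|`. Since `f` is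
only `C²`, the equation for `f_e` is replaced by a comparison of `f` with its translate along `e`
(`trace_newton_le_of_strict_min`). -/

namespace GraphCurvature

open Matrix

/-! ### Algebra of the scalar curvature form and of its linearization. -/

/-- `σ(A) = (tr g⁻¹A)² - tr (g⁻¹A)²`, with `g⁻¹` the inverse metric of a graph with gradient `q`;
up to a positive factor it is the scalar curvature of a graph with Hessian `A`. -/
noncomputable def curvForm {n : ℕ} (q : EuclideanSpace ℝ (Fin n))
    (A : Matrix (Fin n) (Fin n) ℝ) : ℝ :=
  (invMetric q * A).trace ^ 2 - (invMetric q * A * (invMetric q * A)).trace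

/-- `tr(g⁻¹A) g⁻¹ - g⁻¹ A g⁻¹`, half the derivative of `curvForm q` at `A`. -/
noncomputable def newton {n : ℕ} (q : EuclideanSpace ℝ (Fin n))
    (A : Matrix (Fin n) (Fin n) ℝ) : Matrix (Fin n) (Fin n) ℝ :=
  (invMetric q * A).trace • invMetric q - invMetric q * A * invMetric q

/-- The Frobenius norm. -/
noncomputable def frob {n : ℕ} (A : Matrix (Fin n) (Fin n) ℝ) : ℝ :=
  Real.sqrt (∑ i, ∑ j, A i j ^ 2)

variable {n : ℕ}

lemma one_add_normSq_pos (q : EuclideanSpace ℝ (Fin n)) : 0 < 1 + ‖q‖ ^ 2 := by positivity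

lemma invMetric_eq (q : EuclideanSpace ℝ (Fin n)) :
    invMetric q = 1 - (1 + ‖q‖ ^ 2)⁻¹ • vecMulVec q.ofLp q.ofLp := by
  ext i j
  simp [invMetric, Matrix.one_apply, vecMulVec_apply, div_eq_inv_mul]

lemma invMetric_transpose (q : EuclideanSpace ℝ (Fin n)) : (invMetric q)ᵀ = invMetric q := by
  ext i j
  simp [invMetric, eq_comm, mul_comm]

lemma invMetric_neg (q : EuclideanSpace ℝ (Fin n)) : invMetric (-q) = invMetric q := by
  ext i j
  simp [invMetric]

lemma invMetric_zero : invMetric (0 : EuclideanSpace ℝ (Fin n)) = 1 := by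
  ext i j
  simp [invMetric, Matrix.one_apply]

lemma dotProduct_self_eq_normSq (q : EuclideanSpace ℝ (Fin n)) :
    q.ofLp ⬝ᵥ q.ofLp = ‖q‖ ^ 2 := by
  rw [EuclideanSpace.norm_sq_eq, dotProduct]
  simp [sq]

/-- Sherman–Morrison for the rank-one perturbation `1 + q qᵀ`. -/
lemma invMetric_mul_metric (q : EuclideanSpace ℝ (Fin n)) :
    invMetric q * (1 + vecMulVec q.ofLp q.ofLp) = 1 := by
  have h := (one_add_normSq_pos q).ne'
  rw [invMetric_eq, Matrix.sub_mul, Matrix.one_mul, Matrix.smul_mul, Matrix.mul_add, Matrix.mul_one,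
    vecMulVec_mul_vecMulVec, dotProduct_self_eq_normSq]
  ext i j
  simp only [Matrix.sub_apply, Matrix.add_apply, Matrix.smul_apply, vecMulVec_apply, smul_eq_mul,
    Pi.smul_apply]
  field_simp
  ring

lemma abs_apply_le_norm (q : EuclideanSpace ℝ (Fin n)) (i : Fin n) : |q i| ≤ ‖q‖ := by
  simpa using PiLp.norm_apply_le q i

lemma abs_invMetric_le (q : EuclideanSpace ℝ (Fin n)) (i j : Fin n) : |invMetric q i j| ≤ 1 := by
  have hp := one_add_normSq_pos q
  have hi := abs_apply_le_norm q i
  have hj := abs_apply_le_norm q j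
  have hb : |q i * q j| ≤ ‖q‖ ^ 2 := by
    rw [abs_mul, sq]
    exact mul_le_mul hi hj (abs_nonneg _) (norm_nonneg _)
  have hb' : |q i * q j / (1 + ‖q‖ ^ 2)| ≤ 1 := by
    rw [abs_div, abs_of_pos hp, div_le_one hp]
    linarith
  rcases eq_or_ne i j with rfl | hij
  · have h0 : 0 ≤ q i * q i / (1 + ‖q‖ ^ 2) := div_nonneg (mul_self_nonneg _) hp.le
    simp only [invMetric, of_apply, if_true]
    rw [abs_le] at hb' ⊢
    constructor <;> linarith
  · simpa [invMetric, hij] using hb'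

lemma abs_invMetric_sub_le {q r : EuclideanSpace ℝ (Fin n)} (hq : ‖q‖ ≤ 1) (hr : ‖r‖ ≤ 1)
    (i j : Fin n) : |invMetric q i j - invMetric r i j| ≤ 4 * ‖q - r‖ := by
  have hp := one_add_normSq_pos q
  have hp' := one_add_normSq_pos r
  have e : invMetric q i j - invMetric r i j =
      ((r i * (r j - q j) + (r i - q i) * q j) +
        (q i * q j / (1 + ‖q‖ ^ 2)) * ((‖q‖ - ‖r‖) * (‖q‖ + ‖r‖))) / (1 + ‖r‖ ^ 2) := by
    simp only [invMetric, of_apply]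
    field_simp
    ring
  have hd : ∀ k, |r k - q k| ≤ ‖q - r‖ := fun k => by
    rw [abs_sub_comm]; exact abs_apply_le_norm (q - r) k
  have hqk : ∀ k, |q k| ≤ 1 := fun k => (abs_apply_le_norm q k).trans hq
  have hrk : ∀ k, |r k| ≤ 1 := fun k => (abs_apply_le_norm r k).trans hr
  have hd0 := norm_nonneg (q - r)
  have hn : |‖q‖ - ‖r‖| ≤ ‖q - r‖ := abs_norm_sub_norm_le q r
  have h1 : |r i * (r j - q j)| ≤ ‖q - r‖ := by
    rw [abs_mul]
    calc _ ≤ 1 * ‖q - r‖ := mul_le_mul (hrk i) (hd j) (abs_nonneg _) zero_le_one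
      _ = _ := one_mul _
  have h2 : |(r i - q i) * q j| ≤ ‖q - r‖ := by
    rw [abs_mul]
    calc _ ≤ ‖q - r‖ * 1 := mul_le_mul (hd i) (hqk j) (abs_nonneg _) hd0
      _ = _ := mul_one _
  have h3 : |q i * q j / (1 + ‖q‖ ^ 2)| ≤ 1 := by
    rw [abs_div, abs_of_pos hp, div_le_one hp, abs_mul]
    have := mul_le_mul (abs_apply_le_norm q i) (abs_apply_le_norm q j) (abs_nonneg _)
      (norm_nonneg _)
    nlinarith
  have h4 : |(q i * q j / (1 + ‖q‖ ^ 2)) * ((‖q‖ - ‖r‖) * (‖q‖ + ‖r‖))| ≤ 2 * ‖q - r‖ := by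
    rw [abs_mul, abs_mul]
    have h5 : |‖q‖ + ‖r‖| ≤ 2 := by
      rw [abs_of_nonneg (by positivity)]; linarith
    calc _ ≤ 1 * (‖q - r‖ * 2) := mul_le_mul h3 (mul_le_mul hn h5 (abs_nonneg _) hd0)
          (by positivity) zero_le_one
      _ = _ := by ring
  rw [e, abs_div, abs_of_pos hp', div_le_iff₀ hp']
  have h6 := abs_add_le (r i * (r j - q j) + (r i - q i) * q j)
    ((q i * q j / (1 + ‖q‖ ^ 2)) * ((‖q‖ - ‖r‖) * (‖q‖ + ‖r‖)))
  have h7 := abs_add_le (r i * (r j - q j)) ((r i - q i) * q j)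
  have h8 : 0 ≤ ‖q - r‖ * ‖r‖ ^ 2 := by positivity
  nlinarith

section EntryBounds

variable {X Y A : Matrix (Fin n) (Fin n) ℝ} {x y : ℝ}

lemma abs_mul_apply_le (hX : ∀ i j, |X i j| ≤ x) (hY : ∀ i j, |Y i j| ≤ y) (i j : Fin n) :
    |(X * Y) i j| ≤ n * (x * y) := by
  rw [Matrix.mul_apply]
  calc _ ≤ ∑ k, |X i k * Y k j| := Finset.abs_sum_le_sum_abs _ _
    _ ≤ ∑ _k : Fin n, x * y := Finset.sum_le_sum fun k _ => by
        rw [abs_mul]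
        exact mul_le_mul (hX i k) (hY k j) (abs_nonneg _) ((abs_nonneg _).trans (hX i k))
    _ = n * (x * y) := by simp

lemma abs_trace_le (hX : ∀ i j, |X i j| ≤ x) : |X.trace| ≤ n * x := by
  rw [Matrix.trace]
  calc _ ≤ ∑ k, |X.diag k| := Finset.abs_sum_le_sum_abs _ _
    _ ≤ ∑ _k : Fin n, x := Finset.sum_le_sum fun k _ => hX k k
    _ = n * x := by simp

lemma abs_dotProduct_mulVec_le {e : EuclideanSpace ℝ (Fin n)} (he : ‖e‖ = 1)
    (hX : ∀ i j, |X i j| ≤ x) : |e.ofLp ⬝ᵥ X *ᵥ e.ofLp| ≤ n ^ 2 * x := by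
  have h1 : ∀ i, |e i| ≤ 1 := fun i => he ▸ abs_apply_le_norm e i
  rw [dotProduct]
  calc _ ≤ ∑ i, |e i * (X *ᵥ e.ofLp) i| := Finset.abs_sum_le_sum_abs _ _
    _ ≤ ∑ _i : Fin n, (n * x) := Finset.sum_le_sum fun i _ => by
        rw [abs_mul]
        have : |(X *ᵥ e.ofLp) i| ≤ n * x := by
          rw [mulVec, dotProduct]
          calc _ ≤ ∑ j, |X i j * e j| := Finset.abs_sum_le_sum_abs _ _
            _ ≤ ∑ _j : Fin n, x := Finset.sum_le_sum fun j _ => by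
                rw [abs_mul]
                calc _ ≤ x * 1 := mul_le_mul (hX i j) (h1 j) (abs_nonneg _)
                      ((abs_nonneg _).trans (hX i j))
                  _ = x := mul_one x
            _ = n * x := by simp
        calc _ ≤ 1 * (n * x) := mul_le_mul (h1 i) this (abs_nonneg _) zero_le_one
          _ = _ := one_mul _
    _ = n ^ 2 * x := by simp; ring

end EntryBounds

lemma frob_nonneg (A : Matrix (Fin n) (Fin n) ℝ) : 0 ≤ frob A := Real.sqrt_nonneg _

lemma frob_sq (A : Matrix (Fin n) (Fin n) ℝ) : frob A ^ 2 = ∑ i, ∑ j, A i j ^ 2 :=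
  Real.sq_sqrt (by positivity)

lemma abs_apply_le_frob (A : Matrix (Fin n) (Fin n) ℝ) (i j : Fin n) : |A i j| ≤ frob A := by
  rw [← Real.sqrt_sq_eq_abs]
  apply Real.sqrt_le_sqrt
  calc A i j ^ 2 ≤ ∑ j, A i j ^ 2 :=
        Finset.single_le_sum (f := fun j => A i j ^ 2) (fun _ _ => sq_nonneg _) (Finset.mem_univ j)
    _ ≤ _ := Finset.single_le_sum (f := fun i => ∑ j, A i j ^ 2)
        (fun _ _ => by positivity) (Finset.mem_univ i)

lemma shapeOp_eq (q : EuclideanSpace ℝ (Fin n)) (ξ : Matrix (Fin n) (Fin n) ℝ) :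
    shapeOp q ξ = (Real.sqrt (1 + ‖q‖ ^ 2))⁻¹ • (invMetric q * ξ) := by
  ext i j
  simp only [shapeOp, secondFundForm, of_apply, Matrix.smul_apply, Matrix.mul_apply, smul_eq_mul,
    Finset.mul_sum]
  exact Finset.sum_congr rfl fun k _ => by ring

lemma meanCurv_eq (q : EuclideanSpace ℝ (Fin n)) (ξ : Matrix (Fin n) (Fin n) ℝ) :
    meanCurv q ξ = (Real.sqrt (1 + ‖q‖ ^ 2))⁻¹ * (invMetric q * ξ).trace := by
  have h : ∀ i j, invMetric q i j = invMetric q j i := fun i j =>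
    congrFun (congrFun (invMetric_transpose q) j) i
  simp only [meanCurv, secondFundForm, of_apply, Matrix.trace, Matrix.diag, Matrix.mul_apply,
    Finset.mul_sum]
  rw [Finset.sum_comm]
  refine Finset.sum_congr rfl fun i _ => Finset.sum_congr rfl fun j _ => ?_
  rw [h j i]
  ring

lemma scalarCurv_eq (q : EuclideanSpace ℝ (Fin n)) (ξ : Matrix (Fin n) (Fin n) ℝ) :
    scalarCurv q ξ = (1 + ‖q‖ ^ 2)⁻¹ * curvForm q ξ := by
  have hp := one_add_normSq_pos q
  have hs : (Real.sqrt (1 + ‖q‖ ^ 2))⁻¹ ^ 2 = (1 + ‖q‖ ^ 2)⁻¹ := by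
    rw [inv_pow, Real.sq_sqrt hp.le]
  have h : ∑ i, ∑ j, shapeOp q ξ i j * shapeOp q ξ j i = (shapeOp q ξ * shapeOp q ξ).trace := by
    simp [Matrix.trace, Matrix.mul_apply]
  rw [scalarCurv, h, meanCurv_eq, shapeOp_eq, curvForm, Matrix.smul_mul, Matrix.mul_smul,
    trace_smul, trace_smul, smul_eq_mul, smul_eq_mul, ← hs]
  ring

lemma ellipticityMatrix_eq (q : EuclideanSpace ℝ (Fin n)) (ξ : Matrix (Fin n) (Fin n) ℝ) :
    ellipticityMatrix q ξ = (Real.sqrt (1 + ‖q‖ ^ 2))⁻¹ • newton q ξ := by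
  have h : ellipticityMatrix q ξ = meanCurv q ξ • invMetric q - shapeOp q ξ * invMetric q := by
    ext i j
    simp [ellipticityMatrix, Matrix.mul_apply]
  rw [h, meanCurv_eq, shapeOp_eq, newton, smul_sub, smul_smul, Matrix.smul_mul]

lemma posDef_invMetric (q : EuclideanSpace ℝ (Fin n)) : (invMetric q).PosDef := by
  have h : invMetric q = (1 + vecMulVec q.ofLp q.ofLp)⁻¹ :=
    (Matrix.inv_eq_left_inv (invMetric_mul_metric q)).symm
  rw [h]
  refine (Matrix.PosDef.one.add_posSemidef ?_).inv
  simpa using posSemidef_vecMulVec_self_star q.ofLp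

lemma exists_eq_sum_vecMulVec {P : Matrix (Fin n) (Fin n) ℝ} (hP : P.PosSemidef) :
    ∃ (m : ℕ) (v : Fin m → Fin n → ℝ), P = ∑ k, vecMulVec (v k) (v k) := by
  obtain ⟨m, v, hv⟩ := Matrix.posSemidef_iff_eq_sum_vecMulVec.1 hP
  exact ⟨m, v, by simpa using hv⟩

lemma trace_mul_vecMulVec_eq (A : Matrix (Fin n) (Fin n) ℝ) (v w : Fin n → ℝ) :
    (A * vecMulVec v w).trace = w ⬝ᵥ A *ᵥ v := by
  rw [mul_vecMulVec, trace_vecMulVec, dotProduct_comm]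

lemma trace_mul_nonneg_of_posSemidef {A P : Matrix (Fin n) (Fin n) ℝ} (hA : A.PosSemidef)
    (hP : P.PosSemidef) : 0 ≤ (A * P).trace := by
  obtain ⟨m, v, rfl⟩ := exists_eq_sum_vecMulVec hP
  rw [Finset.mul_sum, trace_sum]
  refine Finset.sum_nonneg fun k _ => ?_
  rw [trace_mul_vecMulVec_eq]
  simpa using hA.dotProduct_mulVec_nonneg (v k)

lemma dotProduct_mulVec_sq_le {G : Matrix (Fin n) (Fin n) ℝ} (hG : G.PosSemidef)
    (v w : Fin n → ℝ) : (v ⬝ᵥ G *ᵥ w) ^ 2 ≤ (v ⬝ᵥ G *ᵥ v) * (w ⬝ᵥ G *ᵥ w) := by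
  obtain ⟨m, u, rfl⟩ := exists_eq_sum_vecMulVec hG
  have h : ∀ a b : Fin n → ℝ, a ⬝ᵥ (∑ k, vecMulVec (u k) (u k)) *ᵥ b =
      ∑ k, (u k ⬝ᵥ a) * (u k ⬝ᵥ b) := fun a b => by
    rw [Matrix.sum_mulVec, dotProduct_sum]
    refine Finset.sum_congr rfl fun k _ => ?_
    rw [vecMulVec_mulVec]
    simp [dotProduct_smul, dotProduct_comm, mul_comm]
  simp only [h]
  have := Finset.sum_mul_sq_le_sq_mul_sq Finset.univ (fun k => u k ⬝ᵥ v) (fun k => u k ⬝ᵥ w)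
  simpa [sq] using this

/-- For `P = ∑ vₖ vₖᵀ` the form is `∑ₖₗ (G(vₖ,vₖ) G(vₗ,vₗ) - G(vₖ,vₗ)²)` with `G = g⁻¹`, and each
term is nonnegative by Cauchy–Schwarz. -/
lemma curvForm_nonneg_of_posSemidef (q : EuclideanSpace ℝ (Fin n))
    {P : Matrix (Fin n) (Fin n) ℝ} (hP : P.PosSemidef) : 0 ≤ curvForm q P := by
  have hG := (posDef_invMetric q).posSemidef
  obtain ⟨m, v, rfl⟩ := exists_eq_sum_vecMulVec hP
  have h1 : (invMetric q * ∑ k, vecMulVec (v k) (v k)).trace =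
      ∑ k, v k ⬝ᵥ invMetric q *ᵥ v k := by
    rw [Finset.mul_sum, trace_sum]
    exact Finset.sum_congr rfl fun k _ => trace_mul_vecMulVec_eq _ _ _
  have h2 : (invMetric q * (∑ k, vecMulVec (v k) (v k)) *
      (invMetric q * ∑ k, vecMulVec (v k) (v k))).trace =
      ∑ k, ∑ l, (v k ⬝ᵥ invMetric q *ᵥ v l) ^ 2 := by
    simp only [Finset.mul_sum, Finset.sum_mul, trace_sum]
    rw [Finset.sum_comm]
    refine Finset.sum_congr rfl fun k _ => Finset.sum_congr rfl fun l _ => ?_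
    rw [mul_vecMulVec, mul_vecMulVec, vecMulVec_mul_vecMulVec, trace_vecMulVec, dotProduct_smul,
      smul_eq_mul, sq]
    have : v l ⬝ᵥ invMetric q *ᵥ v k = v k ⬝ᵥ invMetric q *ᵥ v l := by
      rw [dotProduct_mulVec, ← mulVec_transpose, invMetric_transpose, dotProduct_comm]
    rw [dotProduct_comm (invMetric q *ᵥ v k) (v l), this]
  rw [curvForm, h1, h2, sq, Finset.sum_mul_sum, ← Finset.sum_sub_distrib]
  refine Finset.sum_nonneg fun k _ => ?_
  rw [← Finset.sum_sub_distrib]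
  exact Finset.sum_nonneg fun l _ => sub_nonneg.2 (dotProduct_mulVec_sq_le hG _ _)

lemma curvForm_add (q : EuclideanSpace ℝ (Fin n)) (A B : Matrix (Fin n) (Fin n) ℝ) :
    curvForm q (A + B) = curvForm q A + 2 * (newton q A * B).trace + curvForm q B := by
  have h1 : (newton q A * B).trace = (invMetric q * A).trace * (invMetric q * B).trace
      - (invMetric q * A * (invMetric q * B)).trace := by
    rw [newton, Matrix.sub_mul, trace_sub, Matrix.smul_mul, trace_smul, smul_eq_mul]
    simp only [Matrix.mul_assoc]
  have h2 : (invMetric q * B * (invMetric q * A)).trace =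
      (invMetric q * A * (invMetric q * B)).trace := trace_mul_comm _ _
  rw [h1]
  simp only [curvForm, Matrix.mul_add, Matrix.add_mul, trace_add]
  rw [h2]
  ring

lemma curvForm_smul (q : EuclideanSpace ℝ (Fin n)) (c : ℝ) (A : Matrix (Fin n) (Fin n) ℝ) :
    curvForm q (c • A) = c ^ 2 * curvForm q A := by
  simp only [curvForm, Matrix.mul_smul, Matrix.smul_mul, trace_smul, smul_eq_mul]
  ring

lemma curvForm_sub_smul (q : EuclideanSpace ℝ (Fin n)) (A B : Matrix (Fin n) (Fin n) ℝ) (c : ℝ) :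
    curvForm q (A - c • B) =
      curvForm q A - 2 * c * (newton q A * B).trace + c ^ 2 * curvForm q B := by
  rw [sub_eq_add_neg, ← neg_smul, curvForm_add, curvForm_smul, Matrix.mul_smul, trace_smul,
    smul_eq_mul]
  ring

/-- The comparison inequality behind both Hopf arguments. The form is quadratic, so its expansion at
`A` is exact, and ellipticity is required only at the one solution `A`, not along a segment of
matrices. -/
lemma curvForm_add_nonneg {q : EuclideanSpace ℝ (Fin n)} {A P : Matrix (Fin n) (Fin n) ℝ}
    (hA : curvForm q A = 0) (hE : (newton q A).PosSemidef) (hP : P.PosSemidef) :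
    0 ≤ curvForm q (A + P) := by
  rw [curvForm_add, hA]
  have h1 := trace_mul_nonneg_of_posSemidef hE hP
  have h2 := curvForm_nonneg_of_posSemidef q hP
  linarith

/-- Factor the difference of the two quadratic expressions as (difference of metrics) times (sum of
metrics). The bound is needed because the two solutions compared have different gradients at a
touching point. -/
lemma abs_curvForm_sub_le {q r : EuclideanSpace ℝ (Fin n)} (hq : ‖q‖ ≤ 1) (hr : ‖r‖ ≤ 1)
    (A : Matrix (Fin n) (Fin n) ℝ) :
    |curvForm q A - curvForm r A| ≤ 16 * n ^ 4 * ‖q - r‖ * frob A ^ 2 := by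
  have hD : ∀ i j, |(invMetric q - invMetric r) i j| ≤ 4 * ‖q - r‖ := abs_invMetric_sub_le hq hr
  have hS : ∀ i j, |(invMetric q + invMetric r) i j| ≤ 2 := fun i j => by
    have := abs_add_le (invMetric q i j) (invMetric r i j)
    have := abs_invMetric_le q i j
    have := abs_invMetric_le r i j
    rw [Matrix.add_apply]
    linarith
  have hA := abs_apply_le_frob A
  have hDA := abs_mul_apply_le hD hA
  have hSA := abs_mul_apply_le hS hA
  have h1 := abs_trace_le hDA
  have h2 := abs_trace_le hSA
  have h3 := abs_trace_le (abs_mul_apply_le hDA hSA)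
  have e : curvForm q A - curvForm r A =
      ((invMetric q - invMetric r) * A).trace * ((invMetric q + invMetric r) * A).trace -
      ((invMetric q - invMetric r) * A * ((invMetric q + invMetric r) * A)).trace := by
    have hc : (invMetric q * A * (invMetric r * A)).trace =
      (invMetric r * A * (invMetric q * A)).trace := trace_mul_comm _ _
    simp only [curvForm, Matrix.sub_mul, Matrix.add_mul, Matrix.mul_add, trace_sub, trace_add]
    rw [hc]
    ring
  rw [e]
  refine (abs_sub _ _).trans ?_
  rw [abs_mul]
  calc _ ≤ (n * (n * (4 * ‖q - r‖ * frob A))) * (n * (n * (2 * frob A))) +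
        n * (n * (n * (4 * ‖q - r‖ * frob A) * (n * (2 * frob A)))) :=
        add_le_add (mul_le_mul h1 h2 (abs_nonneg _) ((abs_nonneg _).trans h1)) h3
    _ = _ := by ring

lemma abs_newton_sub_apply_le {q r : EuclideanSpace ℝ (Fin n)} (hq : ‖q‖ ≤ 1) (hr : ‖r‖ ≤ 1)
    (A : Matrix (Fin n) (Fin n) ℝ) (i j : Fin n) :
    |(newton q A - newton r A) i j| ≤ 16 * n ^ 2 * ‖q - r‖ * frob A := by
  have hD : ∀ i j, |(invMetric q - invMetric r) i j| ≤ 4 * ‖q - r‖ := abs_invMetric_sub_le hq hr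
  have hA := abs_apply_le_frob A
  have hDA := abs_mul_apply_le hD hA
  have hRA := abs_mul_apply_le (abs_invMetric_le r) hA
  have h1 := abs_trace_le hDA
  have h2 := abs_trace_le hRA
  have h3 := abs_mul_apply_le hDA (abs_invMetric_le q) i j
  have h4 := abs_mul_apply_le hRA hD i j
  have e : (newton q A - newton r A) i j =
      ((invMetric q - invMetric r) * A).trace * invMetric q i j +
      (invMetric r * A).trace * (invMetric q - invMetric r) i j -
      (((invMetric q - invMetric r) * A * invMetric q) i j +
        (invMetric r * A * (invMetric q - invMetric r)) i j) := by
    simp only [newton, Matrix.sub_mul, Matrix.mul_sub, trace_sub, Matrix.sub_apply,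
      Matrix.smul_apply, smul_eq_mul]
    ring
  rw [e]
  refine (abs_sub _ _).trans ?_
  refine (add_le_add (abs_add_le _ _) (abs_add_le _ _)).trans ?_
  rw [abs_mul, abs_mul]
  calc _ ≤ ((n * (n * (4 * ‖q - r‖ * frob A))) * 1 +
        (n * (n * (1 * frob A))) * (4 * ‖q - r‖)) +
        (n * (n * (4 * ‖q - r‖ * frob A) * 1) + n * (n * (1 * frob A) * (4 * ‖q - r‖))) := by
        refine add_le_add (add_le_add ?_ ?_) (add_le_add h3 h4)
        · exact mul_le_mul h1 (abs_invMetric_le q i j) (abs_nonneg _) ((abs_nonneg _).trans h1)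
        · exact mul_le_mul h2 (hD i j) (abs_nonneg _) ((abs_nonneg _).trans h2)
    _ = _ := by ring

lemma abs_newton_apply_le (q : EuclideanSpace ℝ (Fin n)) (A : Matrix (Fin n) (Fin n) ℝ)
    (i j : Fin n) : |newton q A i j| ≤ 2 * n ^ 2 * frob A := by
  have hGA := abs_mul_apply_le (abs_invMetric_le q) (abs_apply_le_frob A)
  have h1 := abs_trace_le hGA
  have h2 := abs_mul_apply_le hGA (abs_invMetric_le q) i j
  rw [newton, Matrix.sub_apply, Matrix.smul_apply, smul_eq_mul]
  refine (abs_sub _ _).trans ?_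
  rw [abs_mul]
  calc _ ≤ n * (n * (1 * frob A)) * 1 + n * (n * (1 * frob A) * 1) :=
        add_le_add (mul_le_mul h1 (abs_invMetric_le q i j) (abs_nonneg _)
          ((abs_nonneg _).trans h1)) h2
    _ = _ := by ring

lemma curvForm_zero_eq {A : Matrix (Fin n) (Fin n) ℝ} (hA : A.IsSymm) :
    curvForm 0 A = A.trace ^ 2 - frob A ^ 2 := by
  rw [curvForm, invMetric_zero, Matrix.one_mul, frob_sq]
  congr 1
  rw [Matrix.trace]
  refine Finset.sum_congr rfl fun i _ => ?_
  rw [diag_apply, Matrix.mul_apply]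
  exact Finset.sum_congr rfl fun j _ => by rw [hA.apply, sq]

/-- At zero gradient the coefficient in the direction `e` is the trace of `A` over the orthogonal
complement of `e`. It therefore depends only on tangential second derivatives when `e` is the
normal. -/
lemma dotProduct_newton_zero {e : EuclideanSpace ℝ (Fin n)} (he : ‖e‖ = 1)
    (A : Matrix (Fin n) (Fin n) ℝ) :
    e.ofLp ⬝ᵥ newton 0 A *ᵥ e.ofLp = A.trace - e.ofLp ⬝ᵥ A *ᵥ e.ofLp := by
  rw [newton, invMetric_zero, Matrix.one_mul, Matrix.mul_one, Matrix.sub_mulVec, dotProduct_sub,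
    Matrix.smul_mulVec, Matrix.one_mulVec, dotProduct_smul, dotProduct_self_eq_normSq, he]
  simp

/-- If the scalar and mean curvatures allow it and `A` is nonpositive in the direction `e`, then
the direction `e` is not degenerate for the linearized scalar curvature operator. -/
lemma frob_le_dotProduct_newton {e q : EuclideanSpace ℝ (Fin n)} (he : ‖e‖ = 1)
    (hq : ‖q‖ ≤ 1 / (64 * (n ^ 4 + 1))) {A : Matrix (Fin n) (Fin n) ℝ} (hA : A.IsSymm)
    (hQ : curvForm q A = 0) (hH : 0 ≤ (invMetric q * A).trace)
    (hAe : e.ofLp ⬝ᵥ A *ᵥ e.ofLp ≤ 0) :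
    frob A / 4 ≤ e.ofLp ⬝ᵥ newton q A *ᵥ e.ofLp := by
  have hn : (0:ℝ) ≤ n := Nat.cast_nonneg n
  have hn4 : (0:ℝ) ≤ (n:ℝ) ^ 4 := by positivity
  have hn2 : (n:ℝ) ^ 2 ≤ n ^ 4 + 1 := by nlinarith [sq_nonneg ((n:ℝ) ^ 2 - 1)]
  have hk : ‖q‖ * (64 * (n ^ 4 + 1)) ≤ 1 := by
    rwa [le_div_iff₀ (by positivity)] at hq
  have hq0 := norm_nonneg q
  -- The smallness of `q` makes the errors of replacing `q` by `0` at most `|A|² / 4` in the form,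
  -- `|A| / 8` in the trace and `|A| / 4` in the coefficient.
  have hq4 : ‖q‖ * n ^ 4 ≤ 1 / 64 := by nlinarith
  have hq2 : ‖q‖ * n ^ 2 ≤ 1 / 64 := by nlinarith
  have hq1 : ‖q‖ ≤ 1 := by nlinarith
  have hz : ‖(0 : EuclideanSpace ℝ (Fin n))‖ ≤ 1 := by simp
  have ha := frob_nonneg A
  have h1 := abs_curvForm_sub_le hq1 hz A
  rw [hQ, curvForm_zero_eq hA, sub_zero] at h1
  have h1' : 16 * n ^ 4 * ‖q‖ * frob A ^ 2 ≤ 1 / 4 * frob A ^ 2 := by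
    have : 0 ≤ frob A ^ 2 := by positivity
    nlinarith
  have h2 : |(invMetric q * A).trace - A.trace| ≤ frob A / 8 := by
    have hD : ∀ i j, |(invMetric q - invMetric (0 : EuclideanSpace ℝ (Fin n))) i j| ≤ 4 * ‖q - 0‖ :=
      abs_invMetric_sub_le hq1 hz
    have h := abs_trace_le (abs_mul_apply_le hD (abs_apply_le_frob A))
    rw [Matrix.sub_mul, invMetric_zero, Matrix.one_mul, trace_sub, sub_zero] at h
    nlinarith
  have h3 : |e.ofLp ⬝ᵥ (newton q A - newton 0 A) *ᵥ e.ofLp| ≤ frob A / 4 := by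
    have h := abs_dotProduct_mulVec_le he (abs_newton_sub_apply_le hq1 hz A)
    rw [sub_zero] at h
    nlinarith
  rw [Matrix.sub_mulVec, dotProduct_sub, dotProduct_newton_zero he] at h3
  rw [abs_le] at h1 h2 h3
  -- Since `(tr A)² ≥ 3/4 |A|²` and `tr A ≥ -|A| / 8`, the negative root is excluded.
  have h4 : frob A / 2 ≤ A.trace := by
    by_contra! hc
    nlinarith
  linarith

lemma trace_newton_mul_le {e q : EuclideanSpace ℝ (Fin n)}
    {A : Matrix (Fin n) (Fin n) ℝ} (L : ℝ) :
    2 * L * (e.ofLp ⬝ᵥ newton q A *ᵥ e.ofLp) - 4 * n ^ 3 * frob A ≤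
      (newton q A * ((2 * L) • vecMulVec e.ofLp e.ofLp - (2 : ℝ) • 1)).trace := by
  have h := (abs_le.1 (abs_trace_le (abs_newton_apply_le q A))).2
  rw [Matrix.mul_sub, trace_sub, Matrix.mul_smul, Matrix.mul_smul, trace_smul, trace_smul,
    trace_mul_vecMulVec_eq, Matrix.mul_one, smul_eq_mul, smul_eq_mul]
  nlinarith

end GraphCurvature

/-! ### Gradients and Hessians as matrices, conditions at a minimum, the barrier. -/

namespace GraphCurvature

open Matrix Filter Topology

variable {n : ℕ}

lemma inner_eq_dotProduct (a b : EuclideanSpace ℝ (Fin n)) :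
    inner ℝ a b = a.ofLp ⬝ᵥ b.ofLp := by
  rw [EuclideanSpace.inner_eq_star_dotProduct, dotProduct_comm]
  simp

lemma sum_smul_single (a : EuclideanSpace ℝ (Fin n)) :
    ∑ i, a i • EuclideanSpace.single i (1 : ℝ) = a := by
  ext j
  simp [Finset.sum_apply, Pi.single_apply]

lemma map_eq_sum_single {F : Type*} [AddCommGroup F] [Module ℝ F] [TopologicalSpace F]
    (T : EuclideanSpace ℝ (Fin n) →L[ℝ] F) (a : EuclideanSpace ℝ (Fin n)) :
    T a = ∑ i, a i • T (EuclideanSpace.single i 1) := by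
  conv_lhs => rw [← sum_smul_single a]
  simp [map_sum]

lemma fderiv_apply_eq_inner (f : EuclideanSpace ℝ (Fin n) → ℝ) (x a : EuclideanSpace ℝ (Fin n)) :
    fderiv ℝ f x a = inner ℝ (Du f x) a := by
  rw [map_eq_sum_single, inner_eq_dotProduct, dotProduct]
  exact Finset.sum_congr rfl fun i _ => by rw [smul_eq_mul, mul_comm]; rfl

lemma fderiv_eq_innerSL (f : EuclideanSpace ℝ (Fin n) → ℝ) (x : EuclideanSpace ℝ (Fin n)) :
    fderiv ℝ f x = innerSL ℝ (Du f x) := by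
  ext a
  rw [fderiv_apply_eq_inner]
  rfl

lemma Du_eq_of_hasFDerivAt {f : EuclideanSpace ℝ (Fin n) → ℝ} {x a : EuclideanSpace ℝ (Fin n)}
    (h : HasFDerivAt f (innerSL ℝ a) x) : Du f x = a := by
  have := h.fderiv
  rw [fderiv_eq_innerSL] at this
  exact (innerSL_inj (𝕜 := ℝ)).1 this

lemma norm_fderiv_eq (f : EuclideanSpace ℝ (Fin n) → ℝ) (x : EuclideanSpace ℝ (Fin n)) :
    ‖fderiv ℝ f x‖ = ‖Du f x‖ := by
  rw [fderiv_eq_innerSL, innerSL_apply_norm]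

lemma differentiableAt_fderiv {E F : Type*} [NormedAddCommGroup E] [NormedSpace ℝ E]
    [NormedAddCommGroup F] [NormedSpace ℝ F] {f : E → F} {x : E}
    (hf : ContDiffAt ℝ 2 f x) : DifferentiableAt ℝ (fderiv ℝ f) x :=
  (hf.fderiv_right (m := 1) (by norm_num)).differentiableAt (by norm_num)

lemma D2u_apply {f : EuclideanSpace ℝ (Fin n) → ℝ} {x : EuclideanSpace ℝ (Fin n)}
    (hf : ContDiffAt ℝ 2 f x) (i j : Fin n) :
    D2u f x i j = fderiv ℝ (fderiv ℝ f) x (EuclideanSpace.single j 1)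
      (EuclideanSpace.single i 1) := by
  have h := (differentiableAt_fderiv hf).hasFDerivAt
  have h2 := h.clm_apply (hasFDerivAt_const (EuclideanSpace.single i (1:ℝ)) x)
  simp only [D2u, of_apply]
  unfold partialDeriv
  rw [h2.fderiv]
  simp

lemma dotProduct_D2u_mulVec {f : EuclideanSpace ℝ (Fin n) → ℝ} {x : EuclideanSpace ℝ (Fin n)}
    (hf : ContDiffAt ℝ 2 f x) (a b : EuclideanSpace ℝ (Fin n)) :
    a.ofLp ⬝ᵥ D2u f x *ᵥ b.ofLp = fderiv ℝ (fderiv ℝ f) x b a := by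
  rw [map_eq_sum_single _ a, dotProduct]
  refine Finset.sum_congr rfl fun i _ => ?_
  rw [map_eq_sum_single _ b, mulVec, dotProduct, smul_eq_mul]
  congr 1
  rw [_root_.sum_apply]
  refine Finset.sum_congr rfl fun j _ => ?_
  rw [D2u_apply hf]
  simp [mul_comm]

lemma D2u_isSymm {f : EuclideanSpace ℝ (Fin n) → ℝ} {x : EuclideanSpace ℝ (Fin n)}
    (hf : ContDiffAt ℝ 2 f x) : (D2u f x).IsSymm := by
  ext i j
  rw [transpose_apply, D2u_apply hf, D2u_apply hf]
  exact (hf.isSymmSndFDerivAt (by simp)).eq _ _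

section Algebra

variable {f g : EuclideanSpace ℝ (Fin n) → ℝ} {x : EuclideanSpace ℝ (Fin n)}

lemma Du_sub (hf : DifferentiableAt ℝ f x) (hg : DifferentiableAt ℝ g x) :
    Du (fun y => f y - g y) x = Du f x - Du g x := by
  apply Du_eq_of_hasFDerivAt
  rw [map_sub, ← fderiv_eq_innerSL, ← fderiv_eq_innerSL]
  exact hf.hasFDerivAt.sub hg.hasFDerivAt

lemma Du_const_mul (c : ℝ) (hf : DifferentiableAt ℝ f x) :
    Du (fun y => c * f y) x = c • Du f x := by
  apply Du_eq_of_hasFDerivAt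
  rw [map_smul, ← fderiv_eq_innerSL]
  exact hf.hasFDerivAt.const_mul c

lemma D2u_sub (hf : ContDiffAt ℝ 2 f x) (hg : ContDiffAt ℝ 2 g x) :
    D2u (fun y => f y - g y) x = D2u f x - D2u g x := by
  have h : fderiv ℝ (fun y => f y - g y) =ᶠ[𝓝 x] fun y => fderiv ℝ f y - fderiv ℝ g y := by
    filter_upwards [hf.eventually (by simp), hg.eventually (by simp)] with y h1 h2
    exact fderiv_fun_sub (h1.differentiableAt (by simp)) (h2.differentiableAt (by simp))
  ext i j
  rw [D2u_apply (hf.sub hg), h.fderiv_eq, fderiv_fun_sub (differentiableAt_fderiv hf)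
    (differentiableAt_fderiv hg), Matrix.sub_apply, D2u_apply hf, D2u_apply hg]
  rfl

lemma D2u_const_mul (c : ℝ) (hf : ContDiffAt ℝ 2 f x) :
    D2u (fun y => c * f y) x = c • D2u f x := by
  have h : fderiv ℝ (fun y => c * f y) =ᶠ[𝓝 x] fun y => c • fderiv ℝ f y := by
    filter_upwards [hf.eventually (by simp)] with y h1
    exact fderiv_const_mul (h1.differentiableAt (by simp)) c
  ext i j
  rw [D2u_apply (contDiffAt_const.mul hf), h.fderiv_eq,
    fderiv_fun_const_smul (differentiableAt_fderiv hf), Matrix.smul_apply, D2u_apply hf]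
  rfl

lemma Du_comp_add (a : EuclideanSpace ℝ (Fin n)) : Du (fun y => f (y + a)) x = Du f (x + a) := by
  unfold Du partialDeriv
  simp only [fderiv_comp_add_right]

lemma D2u_comp_add (a : EuclideanSpace ℝ (Fin n)) :
    D2u (fun y => f (y + a)) x = D2u f (x + a) := by
  unfold D2u partialDeriv
  ext i j
  simp only [fderiv_comp_add_right, of_apply]
  rw [fderiv_comp_add_right (f := fun y => fderiv ℝ f y (EuclideanSpace.single i 1))]

lemma Du_neg : Du (fun y => -f y) x = -Du f x := by
  ext i
  simp [Du, partialDeriv]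

lemma D2u_neg : D2u (fun y => -f y) x = -D2u f x := by
  have h : ∀ i, partialDeriv i (fun y => -f y) = fun y => -partialDeriv i f y := fun i => by
    ext y
    simp [partialDeriv]
  ext i j
  simp only [D2u, of_apply, h, Matrix.neg_apply]
  exact congrFun (congrArg DFunLike.coe fderiv_fun_neg) _

end Algebra

lemma continuousOn_Du {f : EuclideanSpace ℝ (Fin n) → ℝ} {U : Set (EuclideanSpace ℝ (Fin n))}
    (hU : IsOpen U) (hf : ContDiffOn ℝ 2 f U) : ContinuousOn (Du f) U := by
  have h := hf.continuousOn_fderiv_of_isOpen hU (by norm_num)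
  unfold Du partialDeriv
  refine (PiLp.continuous_toLp 2 _).comp_continuousOn (continuousOn_pi.2 fun i => ?_)
  exact h.clm_apply continuousOn_const

lemma continuousAt_D2u {f : EuclideanSpace ℝ (Fin n) → ℝ} {x : EuclideanSpace ℝ (Fin n)}
    (hf : ContDiffAt ℝ 2 f x) : ContinuousAt (D2u f) x := by
  have h1 : ContDiffAt ℝ 1 (fderiv ℝ f) x := hf.fderiv_right (by norm_num)
  have h2 : ContinuousAt (fderiv ℝ (fderiv ℝ f)) x :=
    (h1.fderiv_right (m := 0) (by norm_num)).continuousAt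
  have h3 : D2u f =ᶠ[𝓝 x] fun y => Matrix.of fun i j =>
      fderiv ℝ (fderiv ℝ f) y (EuclideanSpace.single j 1) (EuclideanSpace.single i 1) := by
    filter_upwards [hf.eventually (by simp)] with y hy
    ext i j
    rw [D2u_apply hy]
    rfl
  refine ContinuousAt.congr ?_ h3.symm
  refine continuousAt_pi.2 fun i => continuousAt_pi.2 fun j => ?_
  exact (h2.clm_apply continuousAt_const).clm_apply continuousAt_const

lemma tendsto_add_smul (p a : EuclideanSpace ℝ (Fin n)) :
    Tendsto (fun s : ℝ => p + s • a) (𝓝 0) (𝓝 p) := by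
  have : Continuous fun s : ℝ => p + s • a := by fun_prop
  simpa using this.tendsto 0

lemma hasDerivAt_line {F : Type*} [NormedAddCommGroup F] [NormedSpace ℝ F]
    {f : EuclideanSpace ℝ (Fin n) → F} {x a : EuclideanSpace ℝ (Fin n)} {s : ℝ}
    (hf : DifferentiableAt ℝ f (x + s • a)) :
    HasDerivAt (fun s : ℝ => f (x + s • a)) (fderiv ℝ f (x + s • a) a) s := by
  have h1 : HasDerivAt (fun s : ℝ => x + s • a) a s := by
    simpa using ((hasDerivAt_id s).smul_const a).const_add x
  exact hf.hasFDerivAt.comp_hasDerivAt s h1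

lemma deriv_deriv_line {f : EuclideanSpace ℝ (Fin n) → ℝ} {x a : EuclideanSpace ℝ (Fin n)}
    (hf : ContDiffAt ℝ 2 f x) :
    deriv (deriv fun s : ℝ => f (x + s • a)) 0 = fderiv ℝ (fderiv ℝ f) x a a := by
  have hc := tendsto_add_smul x a
  have h1 : deriv (fun s : ℝ => f (x + s • a)) =ᶠ[𝓝 0] fun s => fderiv ℝ f (x + s • a) a := by
    filter_upwards [hc.eventually (hf.eventually (by simp))] with s hs
    exact (hasDerivAt_line (hs.differentiableAt (by simp))).deriv
  have h2 := hasDerivAt_line (x := x) (a := a) (s := 0) (f := fderiv ℝ f)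
    (by simpa using differentiableAt_fderiv hf)
  rw [h1.deriv_eq, (h2.clm_apply (hasDerivAt_const 0 a)).deriv]
  simp

/-- First and second order necessary conditions at a local minimum. -/
lemma IsLocalMin.Du_eq_zero_and_posSemidef {f : EuclideanSpace ℝ (Fin n) → ℝ}
    {x : EuclideanSpace ℝ (Fin n)} (hm : IsLocalMin f x) (hf : ContDiffAt ℝ 2 f x) :
    Du f x = 0 ∧ (D2u f x).PosSemidef := by
  have h0 := hm.fderiv_eq_zero
  refine ⟨?_, ?_⟩
  · ext i
    simp [Du, partialDeriv, h0]
  · refine PosSemidef.of_dotProduct_mulVec_nonneg ?_ fun v => ?_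
    · rw [IsHermitian, conjTranspose_eq_transpose_of_trivial]
      exact D2u_isSymm hf
    · set a : EuclideanSpace ℝ (Fin n) := WithLp.toLp 2 v
      have : star v ⬝ᵥ D2u f x *ᵥ v = fderiv ℝ (fderiv ℝ f) x a a := by
        rw [← dotProduct_D2u_mulVec hf]
        simp [a]
      rw [this, ← deriv_deriv_line hf]
      -- A negative second derivative would make the point also a local maximum along the line. The
      -- function would then be constant there, with zero second derivative.
      by_contra! hneg
      have hc := tendsto_add_smul x a
      have hd : deriv (fun s : ℝ => f (x + s • a)) 0 = 0 := by
        have := hasDerivAt_line (x := x) (a := a) (s := 0) (f := f)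
          (by simpa using hf.differentiableAt (by simp))
        rw [this.deriv]
        simp [h0]
      have hfc : ContinuousAt (fun s : ℝ => f (x + s • a)) 0 := by
        refine ContinuousAt.comp (g := f) ?_ (by fun_prop)
        simpa using hf.continuousAt
      have hmax := isLocalMax_of_deriv_deriv_neg hneg hd hfc
      have heq : (fun s : ℝ => f (x + s • a)) =ᶠ[𝓝 0] fun _ => f x := by
        filter_upwards [hmax, hc.eventually hm] with s h1 h2
        simp only [zero_smul, add_zero] at h1
        exact le_antisymm h1 h2
      have hdd : deriv (fun s : ℝ => f (x + s • a)) =ᶠ[𝓝 0] fun _ => 0 := by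
        simpa using heq.deriv
      rw [hdd.deriv_eq] at hneg
      simp at hneg

lemma hasFDerivAt_inner_sub (e p y : EuclideanSpace ℝ (Fin n)) :
    HasFDerivAt (fun y => inner ℝ e (y - p)) (innerSL ℝ e) y := by
  have := (innerSL ℝ e).hasFDerivAt (x := y - p)
  exact this.comp y ((hasFDerivAt_id y).sub_const p)

/-- The barrier `t + L t² - |y - p|² - σ |y - z|²`, where `t = ⟨e, y - p⟩`. -/
noncomputable def barrier (e p z : EuclideanSpace ℝ (Fin n)) (L σ : ℝ)
    (y : EuclideanSpace ℝ (Fin n)) : ℝ :=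
  inner ℝ e (y - p) + L * inner ℝ e (y - p) ^ 2 - ‖y - p‖ ^ 2 - σ * ‖y - z‖ ^ 2

lemma contDiff_barrier (e p z : EuclideanSpace ℝ (Fin n)) (L σ : ℝ) :
    ContDiff ℝ 2 (barrier e p z L σ) := by
  have hs : ∀ w : EuclideanSpace ℝ (Fin n), ContDiff ℝ 2 fun y => y - w := fun w =>
    contDiff_id.sub contDiff_const
  have hi : ContDiff ℝ 2 fun y => (inner ℝ e (y - p) : ℝ) := contDiff_const.inner ℝ (hs p)
  exact ((hi.add (contDiff_const.mul (hi.pow 2))).sub ((hs p).norm_sq ℝ)).sub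
    (contDiff_const.mul ((hs z).norm_sq ℝ))

lemma hasFDerivAt_barrier (e p z : EuclideanSpace ℝ (Fin n)) (L σ : ℝ)
    (y : EuclideanSpace ℝ (Fin n)) :
    HasFDerivAt (barrier e p z L σ) (innerSL ℝ ((1 + 2 * L * inner ℝ e (y - p)) • e -
      (2 : ℝ) • (y - p) - (2 * σ) • (y - z))) y := by
  have hi := hasFDerivAt_inner_sub e p y
  have hn : ∀ w, HasFDerivAt (fun y => ‖y - w‖ ^ 2) ((2 : ℝ) • innerSL ℝ (y - w)) y := fun w => by
    refine (((hasFDerivAt_id y).sub_const w).norm_sq).congr_fderiv ?_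
    ext a
    simp [two_mul]
  have := ((hi.add ((hi.pow 2).const_mul L)).sub (hn p)).sub ((hn z).const_mul σ)
  refine this.congr_fderiv ?_
  ext a
  simp
  ring

lemma Du_barrier (e p z : EuclideanSpace ℝ (Fin n)) (L σ : ℝ) (y : EuclideanSpace ℝ (Fin n)) :
    Du (barrier e p z L σ) y = (1 + 2 * L * inner ℝ e (y - p)) • e -
      (2 : ℝ) • (y - p) - (2 * σ) • (y - z) :=
  Du_eq_of_hasFDerivAt (hasFDerivAt_barrier e p z L σ y)

lemma D2u_barrier (e p z : EuclideanSpace ℝ (Fin n)) (L σ : ℝ) (y : EuclideanSpace ℝ (Fin n)) :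
    D2u (barrier e p z L σ) y =
      (2 * L) • vecMulVec e.ofLp e.ofLp - (2 : ℝ) • (1 : Matrix (Fin n) (Fin n) ℝ) -
        (2 * σ) • (1 : Matrix (Fin n) (Fin n) ℝ) := by
  have hd : ∀ i : Fin n, partialDeriv i (barrier e p z L σ) = fun y =>
      (1 + 2 * L * inner ℝ e (y - p)) * e i - 2 * (y i - p i) - 2 * σ * (y i - z i) := fun i => by
    ext y
    have := congrFun (congrArg WithLp.ofLp (Du_barrier e p z L σ y)) i
    simpa [Du] using this
  ext i j
  simp only [D2u, of_apply, hd]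
  have hi := hasFDerivAt_inner_sub e p y
  have hc : HasFDerivAt (fun y : EuclideanSpace ℝ (Fin n) => y i)
      (EuclideanSpace.proj i : EuclideanSpace ℝ (Fin n) →L[ℝ] ℝ) y :=
    (EuclideanSpace.proj i : EuclideanSpace ℝ (Fin n) →L[ℝ] ℝ).hasFDerivAt
  have := ((((hi.const_mul (2 * L)).const_add 1).mul_const (e i)).sub
    ((hc.sub_const (p i)).const_mul 2)).sub ((hc.sub_const (z i)).const_mul (2 * σ))
  have h : partialDeriv j (fun y => (1 + 2 * L * inner ℝ e (y - p)) * e i - 2 * (y i - p i) -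
      2 * σ * (y i - z i)) y = _ :=
    congrFun (congrArg DFunLike.coe this.fderiv) (EuclideanSpace.single j 1)
  rw [h]
  simp only [Matrix.sub_apply, Matrix.smul_apply, Matrix.one_apply, vecMulVec_apply]
  by_cases hij : i = j
  · subst hij
    simp [EuclideanSpace.inner_single_right]
    ring
  · simp [EuclideanSpace.inner_single_right, hij]
    ring

end GraphCurvature

/-! ### Continuity, and the second order inequality for a directional derivative of a `C²` solution.
-/

namespace GraphCurvature

open Matrix Filter Topology Metric

variable {n : ℕ}

lemma continuous_invMetric : Continuous (invMetric (n := n)) := by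
  unfold invMetric
  refine continuous_matrix fun i j => ?_
  refine Continuous.sub continuous_const (Continuous.div ?_ ?_ fun q => (one_add_normSq_pos q).ne')
  · exact ((EuclideanSpace.proj i : EuclideanSpace ℝ (Fin n) →L[ℝ] ℝ).continuous).mul
      ((EuclideanSpace.proj j : EuclideanSpace ℝ (Fin n) →L[ℝ] ℝ).continuous)
  · fun_prop

lemma continuous_newton : Continuous fun z : EuclideanSpace ℝ (Fin n) × Matrix (Fin n) (Fin n) ℝ =>
    newton z.1 z.2 := by
  have hG := continuous_invMetric.comp (continuous_fst
    (X := EuclideanSpace ℝ (Fin n)) (Y := Matrix (Fin n) (Fin n) ℝ))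
  have hGA := hG.matrix_mul continuous_snd
  unfold newton
  exact (hGA.matrix_trace.smul hG).sub (hGA.matrix_mul hG)

lemma continuous_curvForm : Continuous fun z :
    EuclideanSpace ℝ (Fin n) × Matrix (Fin n) (Fin n) ℝ =>
    curvForm z.1 z.2 := by
  have hG := continuous_invMetric.comp (continuous_fst
    (X := EuclideanSpace ℝ (Fin n)) (Y := Matrix (Fin n) (Fin n) ℝ))
  have hGA := hG.matrix_mul continuous_snd
  unfold curvForm
  exact (hGA.matrix_trace.pow 2).sub (hGA.matrix_mul hGA).matrix_trace

lemma continuous_frob : Continuous (frob (n := n)) := by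
  unfold frob
  refine Real.continuous_sqrt.comp (continuous_finsetSum _ fun i _ =>
    continuous_finsetSum _ fun j _ => Continuous.pow ?_ 2)
  exact continuous_apply_apply i j

section ContinuousAt

variable {X : Type*} [TopologicalSpace X] {x : X} {q : X → EuclideanSpace ℝ (Fin n)}
  {A B : X → Matrix (Fin n) (Fin n) ℝ}

lemma continuousAt_newton (hq : ContinuousAt q x) (hA : ContinuousAt A x) :
    ContinuousAt (fun y => newton (q y) (A y)) x :=
  ContinuousAt.comp (f := fun y => (q y, A y)) continuous_newton.continuousAt (hq.prodMk hA)

lemma continuousAt_curvForm (hq : ContinuousAt q x) (hA : ContinuousAt A x) :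
    ContinuousAt (fun y => curvForm (q y) (A y)) x :=
  ContinuousAt.comp (f := fun y => (q y, A y)) continuous_curvForm.continuousAt (hq.prodMk hA)

lemma continuousAt_frob (hA : ContinuousAt A x) : ContinuousAt (fun y => frob (A y)) x :=
  ContinuousAt.comp (f := A) continuous_frob.continuousAt hA

lemma continuousAt_trace_mul (hA : ContinuousAt A x) (hB : ContinuousAt B x) :
    ContinuousAt (fun y => (A y * B y).trace) x := by
  have h : Continuous fun w : Matrix (Fin n) (Fin n) ℝ × Matrix (Fin n) (Fin n) ℝ =>
    (w.1 * w.2).trace := (continuous_fst.matrix_mul continuous_snd).matrix_trace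
  exact ContinuousAt.comp (f := fun y => (A y, B y)) h.continuousAt (hA.prodMk hB)

lemma continuousAt_dotProduct_mulVec (hA : ContinuousAt A x) (a b : Fin n → ℝ) :
    ContinuousAt (fun y => a ⬝ᵥ A y *ᵥ b) x := by
  have h : Continuous fun w : Matrix (Fin n) (Fin n) ℝ => a ⬝ᵥ w *ᵥ b :=
    continuous_const.dotProduct (continuous_id.matrix_mulVec continuous_const)
  exact ContinuousAt.comp (f := A) h.continuousAt hA

end ContinuousAt

lemma abs_curvForm_le (q : EuclideanSpace ℝ (Fin n)) {B : Matrix (Fin n) (Fin n) ℝ} {b : ℝ}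
    (hB : ∀ i j, |B i j| ≤ b) : |curvForm q B| ≤ 2 * n ^ 4 * b ^ 2 := by
  have h1 := abs_mul_apply_le (abs_invMetric_le q) hB
  have h2 := abs_trace_le h1
  have h3 := abs_trace_le (abs_mul_apply_le h1 h1)
  have h4 : |(invMetric q * B).trace ^ 2| ≤ (n * (n * (1 * b))) ^ 2 := by
    rw [abs_pow]
    exact pow_le_pow_left₀ (abs_nonneg _) h2 2
  unfold curvForm
  refine (abs_sub _ _).trans ?_
  calc _ ≤ _ := add_le_add h4 h3
    _ = _ := by ring

lemma exists_pos_add_le_on_sphere {φ : EuclideanSpace ℝ (Fin n) → ℝ} {z : EuclideanSpace ℝ (Fin n)}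
    {ε : ℝ} (hφ : ContinuousOn φ (sphere z ε)) (h : ∀ y ∈ sphere z ε, φ z < φ y) :
    ∃ m > 0, ∀ y ∈ sphere z ε, φ z + m ≤ φ y := by
  rcases (sphere z ε).eq_empty_or_nonempty with h0 | h0
  · exact ⟨1, one_pos, by simp [h0]⟩
  · obtain ⟨y, hy, hm⟩ := (isCompact_sphere z ε).exists_isMinOn h0 hφ
    exact ⟨φ y - φ z, sub_pos.2 (h y hy), fun w hw => by have := hm hw; simp at this; linarith⟩

lemma abs_slope_sub_le {f : EuclideanSpace ℝ (Fin n) → ℝ} {e y : EuclideanSpace ℝ (Fin n)}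
    {τ m : ℝ} (hτ : 0 < τ) (hf : ∀ s ∈ Set.Icc 0 τ, DifferentiableAt ℝ f (y + s • e))
    (hm : ∀ s ∈ Set.Icc 0 τ, |fderiv ℝ f (y + s • e) e - fderiv ℝ f y e| ≤ m) :
    |f (y + τ • e) - f y - τ * fderiv ℝ f y e| ≤ τ * m := by
  have hd : ∀ s ∈ Set.Icc 0 τ, HasDerivAt (fun s : ℝ => f (y + s • e)) 
      (fderiv ℝ f (y + s • e) e) s := fun s hs => hasDerivAt_line (hf s hs)
  obtain ⟨c, hc, hcs⟩ := exists_hasDerivAt_eq_slope _ _ hτ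
    (fun s hs => (hd s hs).continuousAt.continuousWithinAt)
    (fun s hs => hd s (Set.Ioo_subset_Icc_self hs))
  have h1 : f (y + τ • e) - f y = τ * fderiv ℝ f (y + c • e) e := by
    rw [hcs]
    simp
    field_simp
  rw [h1, ← mul_sub, abs_mul, abs_of_pos hτ]
  exact mul_le_mul_of_nonneg_left (hm c (Set.Ioo_subset_Icc_self hc)) hτ.le

/-- If the derivative of `f` in the direction `e`, minus `η h`, has a strict minimum on a ball
around `z`, then for small `τ` the function `f (· + τ e) - f - τ η h` has a local minimum
near `z`. -/
lemma exists_isLocalMin_translate_sub {f h : EuclideanSpace ℝ (Fin n) → ℝ}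
    {U : Set (EuclideanSpace ℝ (Fin n))} (hU : IsOpen U) (hf : ContDiffOn ℝ 2 f U)
    (hh : Continuous h) {e z : EuclideanSpace ℝ (Fin n)} (he : ‖e‖ = 1) {η ε : ℝ} (hε : 0 < ε)
    (hεU : closedBall z (2 * ε) ⊆ U)
    (hmin : ∀ y ∈ closedBall z ε, y ≠ z →
      fderiv ℝ f z e - η * h z < fderiv ℝ f y e - η * h y) :
    ∃ τ₀ > 0, ∀ τ, 0 < τ → τ < τ₀ → ∃ X ∈ ball z ε,
      IsLocalMin (fun y => f (y + τ • e) - f y - τ * η * h y) X := by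
  have hs : ContinuousOn (fun y => fderiv ℝ f y e) U :=
    (hf.continuousOn_fderiv_of_isOpen hU (by norm_num)).clm_apply continuousOn_const
  have hd : ∀ y ∈ U, DifferentiableAt ℝ f y := fun y hy =>
    (hf.contDiffAt (hU.mem_nhds hy)).differentiableAt (by norm_num)
  have hεU' : closedBall z ε ⊆ U := (closedBall_subset_closedBall (by linarith)).trans hεU
  obtain ⟨m, hm, hms⟩ := exists_pos_add_le_on_sphere
    (φ := fun y => fderiv ℝ f y e - η * h y) (z := z) (ε := ε)
    ((hs.mono (sphere_subset_closedBall.trans hεU')).sub (by fun_prop))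
    (fun y hy => hmin y (sphere_subset_closedBall hy) (by rintro rfl; simp at hy; linarith))
  have huc : UniformContinuousOn (fun y => fderiv ℝ f y e) (closedBall z (2 * ε)) :=
    (isCompact_closedBall z _).uniformContinuousOn_of_continuous (hs.mono hεU)
  -- Replacing the difference by `τ` times the derivative costs `τ m / 3` at the centre and again on
  -- the sphere, which together stay below the gap `τ m`.
  obtain ⟨δ, hδ, huc⟩ := Metric.uniformContinuousOn_iff.1 huc (m / 3) (by positivity)
  refine ⟨min δ ε, lt_min hδ hε, fun τ hτ hτ2 => ?_⟩
  have hτδ := hτ2.trans_le (min_le_left _ _)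
  have hτε := hτ2.trans_le (min_le_right _ _)
  have hmem : ∀ y ∈ closedBall z ε, ∀ s ∈ Set.Icc 0 τ, y + s • e ∈ closedBall z (2 * ε) := by
    intro y hy s hs
    rw [mem_closedBall, dist_eq_norm] at hy ⊢
    have : y + s • e - z = (y - z) + s • e := by abel
    rw [this]
    refine (norm_add_le _ _).trans ?_
    rw [norm_smul, he, Real.norm_of_nonneg hs.1]
    linarith [hs.2]
  have hsl : ∀ y ∈ closedBall z ε, |f (y + τ • e) - f y - τ * fderiv ℝ f y e| ≤ τ * (m / 3) := by
    intro y hy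
    refine abs_slope_sub_le hτ (fun s hs => hd _ (hεU (hmem y hy s hs))) fun s hs => ?_
    have := huc (y + s • e) (hmem y hy s hs) y (closedBall_subset_closedBall (by linarith) hy) (by
      rw [dist_eq_norm, add_sub_cancel_left, norm_smul, he, Real.norm_of_nonneg hs.1]
      linarith [hs.2])
    rw [Real.dist_eq] at this
    exact this.le
  have hcont : ContinuousOn (fun y => f (y + τ • e) - f y - τ * η * h y) (closedBall z ε) := by
    have hfc : ContinuousOn f U := hf.continuousOn
    refine ((hfc.comp (by fun_prop) fun y hy => hεU (hmem y hy τ ⟨hτ.le, le_rfl⟩)).sub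
      (hfc.mono hεU')).sub (by fun_prop)
  obtain ⟨X, hX, hXm⟩ := (isCompact_closedBall z ε).exists_isMinOn
    ⟨z, mem_closedBall_self hε.le⟩ hcont
  have hXz : f (X + τ • e) - f X - τ * η * h X ≤ f (z + τ • e) - f z - τ * η * h z :=
    hXm (mem_closedBall_self hε.le)
  have hXb : X ∈ ball z ε := by
    by_contra hXb
    have hXs : X ∈ sphere z ε := by
      rw [mem_closedBall] at hX
      rw [mem_ball] at hXb
      exact le_antisymm hX (not_lt.1 hXb)
    have h1 := abs_le.1 (hsl X hX)
    have h2 := abs_le.1 (hsl z (mem_closedBall_self hε.le))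
    have h3 := mul_le_mul_of_nonneg_left (hms X hXs) hτ.le
    have h4 : 0 < τ * m := mul_pos hτ hm
    linarith
  exact ⟨X, hXb, hXm.isLocalMin (mem_of_superset (isOpen_ball.mem_nhds hXb) ball_subset_closedBall)⟩

/-- The second order inequality at a strict minimum of `⟨e, Df⟩ - η h`. -/
lemma trace_newton_le_of_strict_min {f h : EuclideanSpace ℝ (Fin n) → ℝ}
    {U : Set (EuclideanSpace ℝ (Fin n))} (hU : IsOpen U) (hf : ContDiffOn ℝ 2 f U)
    (hh : ContDiff ℝ 2 h) (hf1 : ∀ y ∈ U, ‖Du f y‖ ≤ 1)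
    (hQ : ∀ y ∈ U, curvForm (Du f y) (-D2u f y) = 0)
    (hE : ∀ y ∈ U, (newton (Du f y) (-D2u f y)).PosSemidef)
    {e z : EuclideanSpace ℝ (Fin n)} (he : ‖e‖ = 1) (hz : z ∈ U) {η : ℝ} (hη : 0 < η)
    (hmin : ∀ᶠ y in 𝓝 z, y ≠ z → fderiv ℝ f z e - η * h z < fderiv ℝ f y e - η * h y) :
    2 * (newton (Du f z) (-D2u f z) * D2u h z).trace ≤
      16 * n ^ 4 * ‖Du h z‖ * frob (-D2u f z) ^ 2 := by
  by_contra! hcon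
  -- At the minimum `X` of the translated difference, the expanded curvature inequality divided by
  -- `τ η` reads `Φ (X, τ) ≤ 0`. At `(z, 0)` the negated claim says `Φ > 0`, and continuity carries
  -- this to nearby `(X, τ)`. No third derivative of `f` is involved.
  let Φ : EuclideanSpace ℝ (Fin n) × ℝ → ℝ := fun w =>
    2 * (newton (Du f (w.1 + w.2 • e)) (-D2u f w.1) * D2u h w.1).trace -
      16 * n ^ 4 * ‖Du h w.1‖ * frob (-D2u f w.1) ^ 2 -
      w.2 * η * curvForm (Du f (w.1 + w.2 • e)) (D2u h w.1)
  have hfz : ContDiffAt ℝ 2 f z := hf.contDiffAt (hU.mem_nhds hz)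
  have hc1 : ContinuousAt
      (fun w : EuclideanSpace ℝ (Fin n) × ℝ => Du f (w.1 + w.2 • e)) (z, 0) := by
    refine ContinuousAt.comp (g := Du f)
      (f := fun w : EuclideanSpace ℝ (Fin n) × ℝ => w.1 + w.2 • e) ?_ (by fun_prop)
    simpa using (continuousOn_Du hU hf).continuousAt (hU.mem_nhds hz)
  have hc2 : ContinuousAt (fun w : EuclideanSpace ℝ (Fin n) × ℝ => -D2u f w.1) (z, 0) :=
    (ContinuousAt.comp (g := D2u f) (f := Prod.fst) (continuousAt_D2u hfz) continuousAt_fst).neg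
  have hc3 : ContinuousAt (fun w : EuclideanSpace ℝ (Fin n) × ℝ => D2u h w.1) (z, 0) :=
    ContinuousAt.comp (g := D2u h) (f := Prod.fst) (continuousAt_D2u hh.contDiffAt) continuousAt_fst
  have hc4 : ContinuousAt (fun w : EuclideanSpace ℝ (Fin n) × ℝ => Du h w.1) (z, 0) :=
    ContinuousAt.comp (g := Du h) (f := Prod.fst)
      ((continuousOn_Du isOpen_univ hh.contDiffOn).continuousAt univ_mem) continuousAt_fst
  have hc6 := continuousAt_trace_mul (continuousAt_newton hc1 hc2) hc3
  have hc7 := continuousAt_curvForm hc1 hc3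
  have hΦ : ContinuousAt Φ (z, 0) := by
    have h2 : ContinuousAt (fun w : EuclideanSpace ℝ (Fin n) × ℝ =>
        16 * n ^ 4 * ‖Du h w.1‖ * frob (-D2u f w.1) ^ 2) (z, 0) :=
      (hc4.norm.const_mul _).mul ((continuousAt_frob hc2).pow 2)
    have h3 : ContinuousAt (fun w : EuclideanSpace ℝ (Fin n) × ℝ =>
        w.2 * η * curvForm (Du f (w.1 + w.2 • e)) (D2u h w.1)) (z, 0) :=
      (continuousAt_snd.mul continuousAt_const).mul hc7
    exact ((hc6.const_mul 2).sub h2).sub h3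
  have hpos : 0 < Φ (z, 0) := by
    simp only [Φ, zero_smul, add_zero, zero_mul, sub_zero]
    linarith
  obtain ⟨ε₁, hε₁, hb1⟩ := Metric.eventually_nhds_iff_ball.1 (hΦ.eventually (lt_mem_nhds hpos))
  obtain ⟨ε₂, hε₂, hb2⟩ := Metric.eventually_nhds_iff_ball.1
    ((hU.eventually_mem hz).and hmin)
  set ε := min ε₁ ε₂ / 3 with hεdef
  have hmn : 0 < min ε₁ ε₂ := lt_min hε₁ hε₂
  have hε : 0 < ε := by positivity
  have hεa : 2 * ε < ε₁ := by linarith [min_le_left ε₁ ε₂]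
  have hεb : 2 * ε < ε₂ := by linarith [min_le_right ε₁ ε₂]
  have hball : closedBall z (2 * ε) ⊆ U := fun y hy =>
    (hb2 y (closedBall_subset_ball hεb hy)).1
  obtain ⟨τ₀, hτ₀, hτ⟩ := exists_isLocalMin_translate_sub hU hf hh.continuous he hε hball
    (fun y hy => (hb2 y (closedBall_subset_ball (by linarith) hy)).2)
  set τ := min τ₀ ε / 2 with hτdef
  have hmn2 : 0 < min τ₀ ε := lt_min hτ₀ hε
  have hτpos : 0 < τ := by positivity
  have hτε : τ < ε := by linarith [min_le_right τ₀ ε]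
  obtain ⟨X, hX, hXm⟩ := hτ τ hτpos (by linarith [min_le_left τ₀ ε])
  rw [mem_ball, dist_eq_norm] at hX
  have hXU : X ∈ U := hball (by rw [mem_closedBall, dist_eq_norm]; linarith)
  have hXU2 : X + τ • e ∈ U := hball (by
    have : X + τ • e - z = (X - z) + τ • e := by abel
    rw [mem_closedBall, dist_eq_norm, this]
    refine (norm_add_le _ _).trans ?_
    rw [norm_smul, he, Real.norm_of_nonneg hτpos.le]
    linarith)
  have hfX : ContDiffAt ℝ 2 f X := hf.contDiffAt (hU.mem_nhds hXU)
  have hfX2 : ContDiffAt ℝ 2 (fun y => f (y + τ • e)) X := by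
    have h1 : ContDiffAt ℝ 2 f (X + τ • e) := hf.contDiffAt (hU.mem_nhds hXU2)
    exact ContDiffAt.comp X (g := f) (f := fun y => y + τ • e) h1 (by fun_prop)
  have hhX : ContDiffAt ℝ 2 (fun y => τ * η * h y) X := contDiffAt_const.mul hh.contDiffAt
  have hk := IsLocalMin.Du_eq_zero_and_posSemidef hXm ((hfX2.sub hfX).sub hhX)
  have two0 : (2 : WithTop ℕ∞) ≠ 0 := by norm_num
  rw [Du_sub ((hfX2.sub hfX).differentiableAt two0) (hhX.differentiableAt two0),
    Du_sub (hfX2.differentiableAt two0) (hfX.differentiableAt two0), Du_comp_add,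
    Du_const_mul _ (hh.differentiable two0 X), D2u_sub (hfX2.sub hfX) hhX, D2u_sub hfX2 hfX,
    D2u_comp_add, D2u_const_mul _ hh.contDiffAt] at hk
  obtain ⟨hk1, hk2⟩ := hk
  have hs' : 0 < τ * η := mul_pos hτpos hη
  -- The solution is taken at `X + τ e`. Adding the semidefinite Hessian of the minimum cancels its
  -- second derivatives and leaves `-D²f(X) - τ η D²h(X)`, with the gradient still taken at `X + τ
  -- e`.
  have hge := curvForm_add_nonneg (hQ _ hXU2) (hE _ hXU2) hk2
  have heq : -D2u f (X + τ • e) + (D2u f (X + τ • e) - D2u f X - (τ * η) • D2u h X) =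
      -D2u f X - (τ * η) • D2u h X := by abel
  rw [heq, curvForm_sub_smul] at hge
  have hdiff := abs_curvForm_sub_le (hf1 _ hXU2) (hf1 _ hXU) (-D2u f X)
  have hqq : Du f (X + τ • e) - Du f X = (τ * η) • Du h X := sub_eq_zero.1 hk1
  rw [hQ _ hXU, sub_zero, hqq, norm_smul, Real.norm_of_nonneg hs'.le] at hdiff
  have hdiff' := (abs_le.1 hdiff).2
  have hΦX : 0 < Φ (X, τ) := hb1 (X, τ) (by
    rw [mem_ball, Prod.dist_eq, max_lt_iff, dist_eq_norm, Real.dist_eq, sub_zero,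
      abs_of_pos hτpos]
    exact ⟨by linarith, by linarith⟩)
  have := mul_pos hs' hΦX
  simp only [Φ] at this
  linarith

end GraphCurvature

/-! ### The barrier argument of Hopf's lemma, independent of any equation. -/

namespace GraphCurvature

open Matrix Filter Topology Metric

variable {n : ℕ}

section Hopf

variable {e p : EuclideanSpace ℝ (Fin n)} {φ : EuclideanSpace ℝ (Fin n) → ℝ} {r L δ : ℝ}

lemma barrier_self (e p y : EuclideanSpace ℝ (Fin n)) (L : ℝ) :
    barrier e p p L 0 y = inner ℝ e (y - p) + L * inner ℝ e (y - p) ^ 2 - ‖y - p‖ ^ 2 := by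
  simp [barrier]

/-- Either `φ` lies above a small multiple of the barrier, or the difference has an interior
local minimum. -/
lemma barrier_dichotomy (he : ‖e‖ = 1) (hr : 0 < r) (hφ : ContinuousOn φ (closedBall p r))
    (hφp : φ p = 0) (hpos : ∀ y ∈ closedBall p r, 0 < inner ℝ e (y - p) → 0 < φ y)
    (hδ : 0 < δ) (hδ1 : δ ≤ 1) (hL : 1 ≤ L) (hLδ : L * δ ≤ 1) (hδr : 2 * δ < r ^ 2)
    {η₀ : ℝ} (hη₀ : 0 < η₀)
    (hno : ∀ η, 0 < η → η ≤ η₀ → ∀ z, 0 < inner ℝ e (z - p) → inner ℝ e (z - p) < δ →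
      ‖z - p‖ ^ 2 ≤ 2 * δ → ¬ IsLocalMin (fun y => φ y - η * barrier e p p L 0 y) z) :
    ∃ η > 0, ∀ t ∈ Set.Icc 0 δ, η * t ≤ φ (p + t • e) := by
  have hbc : Continuous (barrier e p p L 0) := (contDiff_barrier e p p L 0).continuous
  have hic : Continuous fun y => (inner ℝ e (y - p) : ℝ) := by fun_prop
  -- In `K` one has `|y - p|² ≤ t + L t² ≤ 2 δ < r²`, so the sphere is avoided and `t = 0` occurs
  -- only at `p`. The rest of the boundary of `K` is the top `t = δ` and the set where the barrier
  -- vanishes.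
  set K : Set (EuclideanSpace ℝ (Fin n)) := closedBall p r ∩
    {y | 0 ≤ inner ℝ e (y - p) ∧ inner ℝ e (y - p) ≤ δ ∧ 0 ≤ barrier e p p L 0 y} with hK
  have hKc : IsCompact K := by
    refine (isCompact_closedBall p r).inter_right ?_
    exact (isClosed_le continuous_const hic).inter ((isClosed_le hic continuous_const).inter
      (isClosed_le continuous_const hbc))
  have hKn : ∀ y ∈ K, ‖y - p‖ ^ 2 ≤ 2 * δ := by
    rintro y ⟨-, h0, h1, h2⟩
    rw [barrier_self] at h2
    nlinarith
  have hpK : p ∈ K := ⟨mem_closedBall_self hr.le, by simp [hδ.le, barrier_self]⟩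
  have htop : ∃ m > 0, ∀ y ∈ K, inner ℝ e (y - p) = δ → m ≤ φ y := by
    have hKc' : IsCompact (K ∩ {y | inner ℝ e (y - p) = δ}) :=
      hKc.inter_right (isClosed_eq hic continuous_const)
    rcases (K ∩ {y | inner ℝ e (y - p) = δ}).eq_empty_or_nonempty with h0 | h0
    · exact ⟨1, one_pos, fun y hy hyt => absurd (h0 ▸ ⟨hy, hyt⟩ :
        y ∈ (∅ : Set (EuclideanSpace ℝ (Fin n)))) (Set.notMem_empty y)⟩
    · obtain ⟨z, hz, hzm⟩ := hKc'.exists_isMinOn h0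
        (hφ.mono (Set.inter_subset_left.trans Set.inter_subset_left))
      refine ⟨φ z, hpos z hz.1.1 ?_, fun y hy hyt => hzm ⟨hy, hyt⟩⟩
      rw [show inner ℝ e (z - p) = δ from hz.2]
      exact hδ
  obtain ⟨m, hm, htop⟩ := htop
  -- The barrier is at most `2` on `K`, so `η` times it does not exceed `m` on the top face.
  set η := min η₀ (m / 2) with hη
  have hηpos : 0 < η := lt_min hη₀ (by positivity)
  have hmain : ∀ y ∈ K, 0 ≤ φ y - η * barrier e p p L 0 y := by
    obtain ⟨z, hz, hzm⟩ := hKc.exists_isMinOn ⟨p, hpK⟩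
      (f := fun y => φ y - η * barrier e p p L 0 y)
      ((hφ.mono Set.inter_subset_left).sub (by fun_prop))
    by_contra! hcon
    obtain ⟨y, hy, hyneg⟩ := hcon
    have hzneg : φ z - η * barrier e p p L 0 z < 0 := lt_of_le_of_lt (hzm hy) hyneg
    obtain ⟨hzr, hz0, hz1, hz2⟩ := hz
    have hzn : ‖z - p‖ ^ 2 ≤ 2 * δ := hKn z ⟨hzr, hz0, hz1, hz2⟩
    have hzt : 0 < inner ℝ e (z - p) := by
      refine lt_of_le_of_ne hz0 fun h => ?_
      rw [barrier_self, ← h] at hz2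
      have : ‖z - p‖ ^ 2 = 0 := le_antisymm (by linarith) (by positivity)
      have hzp : z = p := sub_eq_zero.1 (norm_eq_zero.1 (pow_eq_zero_iff (two_ne_zero)|>.1 this))
      rw [hzp, hφp, barrier_self] at hzneg
      simp at hzneg
    have hzφ := hpos z hzr hzt
    have hzb : 0 < barrier e p p L 0 z := by
      refine lt_of_le_of_ne hz2 fun h => ?_
      rw [← h] at hzneg
      linarith
    have hzb2 : barrier e p p L 0 z ≤ 2 := by
      rw [barrier_self]
      have : L * inner ℝ e (z - p) ^ 2 ≤ 1 * δ := by nlinarith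
      nlinarith [sq_nonneg ‖z - p‖]
    have hzδ : inner ℝ e (z - p) < δ := by
      refine lt_of_le_of_ne hz1 fun h => ?_
      have h1 := htop z ⟨hzr, hz0, hz1, hz2⟩ h
      have h2 : η * barrier e p p L 0 z ≤ m / 2 * 2 :=
        mul_le_mul (min_le_right _ _) hzb2 hz2 (by positivity)
      linarith
    refine hno η hηpos (min_le_left _ _) z hzt hzδ hzn ?_
    refine hzm.isLocalMin ?_
    have hzr' : ‖z - p‖ < r := by
      by_contra! h
      have : r ^ 2 ≤ ‖z - p‖ ^ 2 := pow_le_pow_left₀ hr.le h 2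
      linarith
    have e1 : ∀ᶠ y in 𝓝 z, y ∈ ball p r :=
      isOpen_ball.eventually_mem (by rwa [mem_ball, dist_eq_norm])
    filter_upwards [e1, hic.continuousAt.eventually (lt_mem_nhds hzt),
      hic.continuousAt.eventually (gt_mem_nhds hzδ),
      hbc.continuousAt.eventually (lt_mem_nhds hzb)] with y h1 h2 h3 h4
    exact ⟨ball_subset_closedBall h1, h2.le, h3.le, h4.le⟩
  refine ⟨η, hηpos, fun t ht => ?_⟩
  have hi : inner ℝ e (p + t • e - p) = t := by
    rw [add_sub_cancel_left, inner_smul_right, real_inner_self_eq_norm_sq, he]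
    ring
  have hnm : ‖p + t • e - p‖ = t := by
    rw [add_sub_cancel_left, norm_smul, he, Real.norm_of_nonneg ht.1, mul_one]
  have hb : t ≤ barrier e p p L 0 (p + t • e) := by
    rw [barrier_self, hi, hnm]
    nlinarith [sq_nonneg t]
  have hmem : p + t • e ∈ K := by
    refine ⟨?_, by rw [hi]; exact ht.1, by rw [hi]; exact ht.2, ht.1.trans hb⟩
    rw [mem_closedBall, dist_eq_norm, hnm]
    by_contra! h
    have : r ^ 2 < t ^ 2 := pow_lt_pow_left₀ h hr.le two_ne_zero
    nlinarith [ht.1, ht.2]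
  have := hmain _ hmem
  nlinarith [mul_le_mul_of_nonneg_left hb hηpos.le]

/-- The conclusion of Hopf's lemma: a linear lower bound along the normal bounds the normal
derivative from below by `η`. -/
lemma fderiv_pos_of_barrier_le {η : ℝ} (hη : 0 < η) (hδ : 0 < δ) (hφp : φ p = 0)
    (hd : DifferentiableAt ℝ φ p) (h : ∀ t ∈ Set.Icc 0 δ, η * t ≤ φ (p + t • e)) :
    0 < fderiv ℝ φ p e := by
  have hd' := hasDerivAt_line (x := p) (a := e) (s := 0) (f := φ) (by simpa using hd)
  simp only [zero_smul, add_zero] at hd'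
  have ht : Tendsto (fun t => slope (fun s : ℝ => φ (p + s • e)) 0 t) (𝓝[>] 0)
      (𝓝 (fderiv ℝ φ p e)) :=
    (hasDerivAt_iff_tendsto_slope.1 hd').mono_left (nhdsWithin_mono _ fun x hx => ne_of_gt hx)
  refine hη.trans_le (ge_of_tendsto ht ?_)
  filter_upwards [Ioc_mem_nhdsGT hδ] with t ht
  simp only [slope, zero_smul, add_zero, hφp, vsub_eq_sub, sub_zero, smul_eq_mul]
  rw [inv_mul_eq_div, le_div_iff₀ ht.1]
  exact h t ⟨ht.1.le, ht.2⟩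

end Hopf

section BarrierBounds

variable {e p z w : EuclideanSpace ℝ (Fin n)} {L δ σ : ℝ}

/-- The bound is `3 + 4`, from `2 L t ≤ 2` and `|z - p| ≤ 2`, and so is independent of `L`; this
lets `L` be chosen afterwards. The hypothesis `hσ` covers both `σ = 0` and `w = z`. -/
lemma norm_Du_barrier_le (he : ‖e‖ = 1) (hL : 1 ≤ L) (hδ1 : δ ≤ 1) (hLδ : L * δ ≤ 1)
    (h0 : 0 ≤ inner ℝ e (z - p)) (h1 : inner ℝ e (z - p) ≤ δ) (h2 : ‖z - p‖ ^ 2 ≤ 2 * δ)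
    (hσ : (2 * σ) • (z - w) = 0) :
    ‖Du (barrier e p w L σ) z‖ ≤ 7 := by
  rw [Du_barrier, hσ, sub_zero]
  refine (norm_sub_le _ _).trans ?_
  rw [norm_smul, norm_smul, he, Real.norm_of_nonneg (by positivity), Real.norm_of_nonneg (by simp)]
  have : L * inner ℝ e (z - p) ≤ L * δ := mul_le_mul_of_nonneg_left h1 (by linarith)
  have : ‖z - p‖ ≤ 2 := by nlinarith [norm_nonneg (z - p)]
  linarith

lemma fderiv_barrier_apply_pos (he : ‖e‖ = 1) (hL : 1 ≤ L) (h0 : 0 ≤ inner ℝ e (z - p)) :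
    0 < fderiv ℝ (barrier e p p L 0) z e := by
  rw [fderiv_apply_eq_inner, Du_barrier, mul_zero, zero_smul, sub_zero, inner_sub_left,
    inner_smul_left, inner_smul_left, real_inner_self_eq_norm_sq, he, real_inner_comm e]
  simp
  nlinarith

lemma abs_hessian_barrier_apply_le (he : ‖e‖ = 1) (hL : 0 ≤ L) (i j : Fin n) :
    |((2 * L) • vecMulVec e.ofLp e.ofLp - (2 : ℝ) • (1 : Matrix (Fin n) (Fin n) ℝ)) i j| ≤
      2 * L + 2 := by
  have h1 : ∀ i, |e i| ≤ 1 := fun i => he ▸ abs_apply_le_norm e i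
  have h2 : |e i * e j| ≤ 1 := by
    rw [abs_mul]
    exact mul_le_one₀ (h1 i) (abs_nonneg _) (h1 j)
  have h3 : |(2 : ℝ) * (1 : Matrix (Fin n) (Fin n) ℝ) i j| ≤ 2 := by
    rw [Matrix.one_apply]
    split_ifs <;> simp
  rw [Matrix.sub_apply, Matrix.smul_apply, Matrix.smul_apply, vecMulVec_apply, smul_eq_mul,
    smul_eq_mul]
  refine (abs_sub _ _).trans (add_le_add ?_ h3)
  rw [abs_mul, abs_of_nonneg (by positivity)]
  exact mul_le_of_le_one_right (by positivity) h2

end BarrierBounds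

end GraphCurvature

/-! ### Hopf's lemma for the normal derivative: nondegeneracy in the normal direction at `p`. -/

namespace GraphCurvature

open Matrix Filter Topology Metric

variable {n : ℕ}

lemma le_of_forall_pos_sub_mul_le {a b c : ℝ} (h : ∀ σ > 0, a - σ * b ≤ c) : a ≤ c := by
  have ht : Tendsto (fun σ : ℝ => a - σ * b) (𝓝[>] 0) (𝓝 a) := by
    have : Continuous fun σ : ℝ => a - σ * b := by fun_prop
    have := this.tendsto 0
    simp only [zero_mul, sub_zero] at this
    exact this.mono_left nhdsWithin_le_nhds
  exact le_of_tendsto ht (eventually_mem_nhdsWithin.mono fun σ hσ => h σ hσ)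

/-- The Newton matrix is linear in `A`, so it cannot be definite at `A = 0`. Positivity allows the
common factor `|A|` to be cancelled later. -/
lemma frob_pos_of_newton_posDef {e q : EuclideanSpace ℝ (Fin n)} (he : ‖e‖ = 1)
    {A : Matrix (Fin n) (Fin n) ℝ} (h : (newton q A).PosDef) : 0 < frob A := by
  refine lt_of_le_of_ne (frob_nonneg A) fun h0 => ?_
  have h1 := abs_dotProduct_mulVec_le he (abs_newton_apply_le q A)
  rw [← h0] at h1
  have he0 : e.ofLp ≠ 0 := fun h => by
    have : e = 0 := by ext i; simp [h]
    simp [this] at he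
  have h2 := h.dotProduct_mulVec_pos he0
  simp only [star_trivial, mul_zero, abs_nonpos_iff] at h1 h2
  linarith

variable {e p : EuclideanSpace ℝ (Fin n)} {f g : EuclideanSpace ℝ (Fin n) → ℝ} {r : ℝ}

lemma exists_barrier_parameters {ρ L : ℝ} (hρ : 0 < ρ) (hL : 1 ≤ L) :
    ∃ δ > 0, δ ≤ 1 ∧ L * δ ≤ 1 ∧ 2 * δ < ρ ^ 2 := by
  refine ⟨min (1 / L) (ρ ^ 2 / 4), by positivity, ?_, ?_, ?_⟩
  · exact (min_le_left _ _).trans (by rw [div_le_one (by linarith)]; exact hL)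
  · calc _ ≤ L * (1 / L) := mul_le_mul_of_nonneg_left (min_le_left _ _) (by linarith)
      _ = 1 := by field_simp
  · have := min_le_right (1 / L) (ρ ^ 2 / 4)
    have : 0 < ρ ^ 2 := by positivity
    linarith

/-- Hopf's lemma for `f_e`, which vanishes at `p` and is positive for `t > 0`. The Newton matrix may
degenerate at `p`, but at a point where the barrier touches, its coefficient in the direction `e` is
comparable to `|D²f|`, and so are the terms to be absorbed. -/
lemma fderiv_fderiv_apply_self_pos (hr : 0 < r) (he : ‖e‖ = 1) (hf : ContDiffOn ℝ 2 f (ball p r))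
    (hfp : Du f p = 0)
    (hQ : ∀ y ∈ ball p r, 0 < inner ℝ e (y - p) → curvForm (Du f y) (-D2u f y) = 0)
    (hE : ∀ y ∈ ball p r, 0 < inner ℝ e (y - p) → (newton (Du f y) (-D2u f y)).PosDef)
    (hH : ∀ y ∈ ball p r, 0 < inner ℝ e (y - p) → 0 ≤ (invMetric (Du f y) * -D2u f y).trace)
    (hs : ∀ y ∈ ball p r, 0 < inner ℝ e (y - p) → 0 < fderiv ℝ f y e) :
    0 < fderiv ℝ (fderiv ℝ f) p e e := by
  have hfat : ∀ y ∈ ball p r, ContDiffAt ℝ 2 f y := fun y hy =>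
    hf.contDiffAt (isOpen_ball.mem_nhds hy)
  have hp : p ∈ ball p r := mem_ball_self hr
  set c : ℝ := 1 / (64 * (n ^ 4 + 1)) with hc
  have hcpos : 0 < c := by positivity
  have hc1 : c ≤ 1 := by
    rw [hc, div_le_one (by positivity)]
    have : (0 : ℝ) ≤ n ^ 4 := by positivity
    linarith
  set M := frob (-D2u f p) + 1 with hM
  have hMpos : 0 < M := by have := frob_nonneg (-D2u f p); linarith
  have hDc : ContinuousAt (Du f) p := (continuousOn_Du isOpen_ball hf).continuousAt
    (isOpen_ball.mem_nhds hp)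
  have hd1 : ∀ᶠ y in 𝓝 p, ‖Du f y‖ < c :=
    hDc.norm.eventually (gt_mem_nhds (by simpa [hfp] using hcpos))
  have hd2 : ∀ᶠ y in 𝓝 p, frob (-D2u f y) < M :=
    (continuousAt_frob (continuousAt_D2u (hfat p hp)).neg).eventually
      (gt_mem_nhds (by rw [hM]; exact lt_add_one _))
  obtain ⟨r₁, hr₁, hb⟩ := Metric.eventually_nhds_iff_ball.1
    ((hd1.and hd2).and (isOpen_ball.eventually_mem hp))
  -- `8 n³` absorbs the trace term of the barrier's `-2 · 1`. `112 = 16 · 7` comes from the gradient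
  -- error times the bound on the barrier's gradient, with one factor of `|D²f|` bounded by `M`.
  set L : ℝ := 1 + 8 * n ^ 3 + 112 * n ^ 4 * M with hL
  have hL1 : 1 ≤ L := by
    have : 0 ≤ 8 * (n : ℝ) ^ 3 + 112 * n ^ 4 * M := by positivity
    linarith
  obtain ⟨δ, hδ, hδ1, hLδ, hδr⟩ := exists_barrier_parameters (half_pos hr₁) hL1
  have hcl : closedBall p (r₁ / 2) ⊆ ball p r₁ := closedBall_subset_ball (by linarith)
  have hφd : ∀ y ∈ ball p r, DifferentiableAt ℝ (fun y => fderiv ℝ f y e) y := fun y hy =>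
    (differentiableAt_fderiv (hfat y hy)).clm_apply (differentiableAt_const e)
  have hφe : ∀ y ∈ ball p r, fderiv ℝ (fun y => fderiv ℝ f y e) y e =
      fderiv ℝ (fderiv ℝ f) y e e := fun y hy => by
    rw [((differentiableAt_fderiv (hfat y hy)).hasFDerivAt.clm_apply
      (hasFDerivAt_const e y)).fderiv]
    simp
  have hφp : fderiv ℝ f p e = 0 := by rw [fderiv_apply_eq_inner, hfp, inner_zero_left]
  obtain ⟨η, hη, hle⟩ := barrier_dichotomy (φ := fun y => fderiv ℝ f y e) he (half_pos hr₁)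
    (fun y hy => (hφd y (hb y (hcl hy)).2).continuousAt.continuousWithinAt) hφp
    (fun y hy => hs y (hb y (hcl hy)).2) hδ hδ1 hL1 hLδ hδr one_pos (by
      intro η hη _ z hz0 hzδ hzn hmin
      have hzr₁ : z ∈ ball p r₁ := by
        rw [mem_ball, dist_eq_norm]
        by_contra! h
        have := pow_le_pow_left₀ hr₁.le h 2
        nlinarith
      obtain ⟨⟨hz1, hz2⟩, hzr⟩ := hb z hzr₁
      have hzc := hfat z hzr
      have hbd := (contDiff_barrier e p p L 0).differentiable (by norm_num) z
      -- The first order condition in the direction `e` gives `f_ee = η b_e > 0`, with `b` the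
      -- barrier. This is the sign that makes the direction `e` nondegenerate.
      have hcrit := hmin.fderiv_eq_zero
      rw [fderiv_fun_sub (hφd z hzr) (hbd.const_mul η), fderiv_const_mul hbd] at hcrit
      have hcrit' := congrArg (fun T => T e) hcrit
      simp only [_root_.sub_apply, _root_.smul_apply, _root_.zero_apply, smul_eq_mul,
        hφe z hzr] at hcrit'
      have hbp := mul_pos hη (fderiv_barrier_apply_pos he hL1 hz0.le (L := L))
      have hneg : e.ofLp ⬝ᵥ (-D2u f z) *ᵥ e.ofLp ≤ 0 := by
        rw [neg_mulVec, dotProduct_neg, dotProduct_D2u_mulVec hzc]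
        linarith
      have hfrob := frob_le_dotProduct_newton he hz1.le (D2u_isSymm hzc).neg (hQ z hzr hz0)
        (hH z hzr hz0) hneg
      have hfpos := frob_pos_of_newton_posDef he (hE z hzr hz0)
      set N := newton (Du f z) (-D2u f z) with hN
      set F := frob (-D2u f z) with hF
      have hopen : IsOpen (ball p r₁ ∩ {y | 0 < inner ℝ e (y - p)}) :=
        isOpen_ball.inter (isOpen_lt continuous_const (by fun_prop))
      have hkey : 2 * (N * ((2 * L) • vecMulVec e.ofLp e.ofLp - (2 : ℝ) • 1)).trace ≤
          16 * n ^ 4 * 7 * F ^ 2 := by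
        -- The term `σ |y - z|²` makes the minimum strict without changing the gradient at `z`; then
        -- `σ → 0`.
        refine le_of_forall_pos_sub_mul_le (b := 4 * N.trace) fun σ hσ => ?_
        have h1 := trace_newton_le_of_strict_min (h := barrier e p z L σ) hopen
          (hf.mono fun y hy => (hb y hy.1).2) (contDiff_barrier e p z L σ)
          (fun y hy => (hb y hy.1).1.1.le.trans hc1)
          (fun y hy => hQ y (hb y hy.1).2 hy.2)
          (fun y hy => (hE y (hb y hy.1).2 hy.2).posSemidef) he ⟨hzr₁, hz0⟩ hη (by
            filter_upwards [hmin] with y hy hyz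
            have h2 : 0 < η * (σ * ‖y - z‖ ^ 2) := by
              have : 0 < ‖y - z‖ := norm_pos_iff.2 (sub_ne_zero.2 hyz)
              positivity
            have h3 : ∀ y, barrier e p z L σ y = barrier e p p L 0 y - σ * ‖y - z‖ ^ 2 := by
              intro y
              simp [barrier]
            rw [h3, h3]
            simp only [sub_self, norm_zero, mul_sub]
            simp
            linarith)
        have h4 := norm_Du_barrier_le (w := z) (σ := σ) he hL1 hδ1 hLδ hz0.le hzδ.le hzn (by simp)
        rw [D2u_barrier, Matrix.mul_sub, trace_sub, Matrix.mul_smul, Matrix.mul_one,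
          trace_smul, smul_eq_mul, ← hN, ← hF] at h1
        have h5 : 16 * n ^ 4 * ‖Du (barrier e p z L σ) z‖ * F ^ 2 ≤ 16 * n ^ 4 * 7 * F ^ 2 := by
          gcongr
        linarith
      have hlow := trace_newton_mul_le (e := e) (q := Du f z) (A := -D2u f z) L
      rw [← hN, ← hF] at hlow
      have h6 : L * (F / 4) ≤ L * (e.ofLp ⬝ᵥ N *ᵥ e.ofLp) :=
        mul_le_mul_of_nonneg_left hfrob (by linarith)
      -- Every term carries a factor `F`, so no positive lower bound on `F` is needed.
      have h7 : F * (L - 8 * n ^ 3 - 112 * n ^ 4 * F) ≤ 0 := by nlinarith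
      have h8 : 0 < L - 8 * n ^ 3 - 112 * n ^ 4 * F := by
        have : 112 * (n : ℝ) ^ 4 * F ≤ 112 * n ^ 4 * M := by gcongr
        linarith
      nlinarith [mul_pos hfpos h8])
  have := fderiv_pos_of_barrier_le (φ := fun y => fderiv ℝ f y e) hη hδ hφp (hφd p hp) hle
  rwa [hφe p hp] at this

/-- Nondegeneracy of the Newton matrix in the normal direction at `p`. -/
lemma dotProduct_newton_pos (hr : 0 < r) (he : ‖e‖ = 1) (hf : ContDiffOn ℝ 2 f (ball p r))
    (hfp : Du f p = 0)
    (hQ : ∀ y ∈ ball p r, 0 < inner ℝ e (y - p) → curvForm (Du f y) (-D2u f y) = 0)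
    (hE : ∀ y ∈ ball p r, 0 < inner ℝ e (y - p) → (newton (Du f y) (-D2u f y)).PosDef)
    (hH : ∀ y ∈ ball p r, 0 < inner ℝ e (y - p) → 0 ≤ (invMetric (Du f y) * -D2u f y).trace)
    (hs : ∀ y ∈ ball p r, 0 < inner ℝ e (y - p) → 0 < fderiv ℝ f y e) :
    0 < e.ofLp ⬝ᵥ newton 0 (-D2u f p) *ᵥ e.ofLp := by
  have h1 := fderiv_fderiv_apply_self_pos hr he hf hfp hQ hE hH hs
  have hp : p ∈ ball p r := mem_ball_self hr
  have hfat : ContDiffAt ℝ 2 f p := hf.contDiffAt (isOpen_ball.mem_nhds hp)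
  have hDc : ContinuousAt (Du f) p := (continuousOn_Du isOpen_ball hf).continuousAt
    (isOpen_ball.mem_nhds hp)
  have hcont : ContinuousAt (fun y => (invMetric (Du f y) * -D2u f y).trace) p :=
    continuousAt_trace_mul (ContinuousAt.comp (g := invMetric)
      continuous_invMetric.continuousAt hDc)
      (continuousAt_D2u hfat).neg
  have hline : Tendsto (fun t : ℝ => p + t • e) (𝓝[>] 0) (𝓝 p) :=
    (tendsto_add_smul p e).mono_left nhdsWithin_le_nhds
  -- The sign of the mean curvature, known for `t > 0`, passes to the limit at `p` along the normal.
  have h2 : 0 ≤ (invMetric (Du f p) * -D2u f p).trace := by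
    refine ge_of_tendsto (hcont.tendsto.comp hline) ?_
    filter_upwards [hline.eventually (isOpen_ball.eventually_mem hp), self_mem_nhdsWithin]
      with t ht ht0
    refine hH _ ht ?_
    rw [add_sub_cancel_left, inner_smul_right, real_inner_self_eq_norm_sq, he]
    simpa using ht0
  rw [hfp, invMetric_zero, Matrix.one_mul] at h2
  rw [dotProduct_newton_zero he, neg_mulVec, dotProduct_neg, dotProduct_D2u_mulVec hfat]
  linarith

end GraphCurvature

/-! ### The boundary touching principle for two solutions. -/

namespace GraphCurvature

open Matrix Filter Topology Metric

variable {n : ℕ}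

/-- The part of the trace orthogonal to a unit vector `e` vanishes if the quadratic form
vanishes on the orthogonal complement of `e`. -/
lemma trace_eq_dotProduct_of_forall_orthogonal {e : EuclideanSpace ℝ (Fin n)} (he : ‖e‖ = 1)
    {M : Matrix (Fin n) (Fin n) ℝ}
    (h : ∀ a : EuclideanSpace ℝ (Fin n), inner ℝ e a = 0 → a.ofLp ⬝ᵥ M *ᵥ a.ofLp = 0) :
    M.trace = e.ofLp ⬝ᵥ M *ᵥ e.ofLp := by
  set Q : Matrix (Fin n) (Fin n) ℝ := 1 - vecMulVec e.ofLp e.ofLp with hQ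
  have hee : e.ofLp ⬝ᵥ e.ofLp = 1 := by rw [dotProduct_self_eq_normSq, he, one_pow]
  have hQT : Qᵀ = Q := by rw [hQ, transpose_sub, transpose_one, transpose_vecMulVec]
  have hQQ : Q * Q = Q := by
    rw [hQ, Matrix.sub_mul, Matrix.one_mul, Matrix.mul_sub, Matrix.mul_one, vecMulVec_mul_vecMulVec,
      hee, one_smul, sub_self, sub_zero]
  -- Each diagonal entry is the quadratic form at the projection of a basis vector to the complement
  -- of `e`.
  have h1 : (Qᵀ * M * Q).trace = 0 := by
    rw [Matrix.trace]
    refine Finset.sum_eq_zero fun i _ => ?_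
    have h2 := h (WithLp.toLp 2 (Q *ᵥ Pi.single i 1)) (by
      rw [inner_eq_dotProduct, hQ, sub_mulVec, dotProduct_sub, one_mulVec, vecMulVec_mulVec]
      simp [hee])
    simp only at h2
    rw [← vecMul_transpose, ← dotProduct_mulVec, vecMul_transpose, mulVec_mulVec, mulVec_mulVec,
     
      mulVec_single_one, single_one_dotProduct] at h2
    exact h2
  rw [hQT, Matrix.mul_assoc, trace_mul_comm, Matrix.mul_assoc, hQQ, hQ, Matrix.mul_sub,
    Matrix.mul_one, trace_sub, trace_mul_vecMulVec_eq] at h1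
  linarith

variable {e p : EuclideanSpace ℝ (Fin n)} {f g : EuclideanSpace ℝ (Fin n) → ℝ} {r : ℝ}

lemma fderiv_fderiv_eq_zero_of_eq_zero {k : EuclideanSpace ℝ (Fin n) → ℝ} (hr : 0 < r)
    (hk : ContDiffAt ℝ 2 k p) (h0 : ∀ y ∈ ball p r, inner ℝ e (y - p) = 0 → k y = 0)
    {a : EuclideanSpace ℝ (Fin n)} (ha : inner ℝ e a = 0) :
    fderiv ℝ (fderiv ℝ k) p a a = 0 := by
  rw [← deriv_deriv_line hk]
  have hline := tendsto_add_smul p a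
  have heq : (fun s : ℝ => k (p + s • a)) =ᶠ[𝓝 0] fun _ => 0 := by
    filter_upwards [hline.eventually (isOpen_ball.eventually_mem (mem_ball_self hr))] with s hs
    refine h0 _ hs ?_
    rw [add_sub_cancel_left, inner_smul_right, ha, mul_zero]
  have hdd : deriv (fun s : ℝ => k (p + s • a)) =ᶠ[𝓝 0] fun _ => 0 := by simpa using heq.deriv
  rw [hdd.deriv_eq]
  simp

/-- A touching principle at the boundary: two solutions agreeing to first order on the boundary
point cannot be ordered strictly in the half ball. -/
lemma not_touching (hr : 0 < r) (he : ‖e‖ = 1) (hf : ContDiffOn ℝ 2 f (ball p r))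
    (hg : ContDiffOn ℝ 2 g (ball p r)) (hfp : Du f p = 0) (hgp : Du g p = 0)
    (hQf : ∀ y ∈ ball p r, 0 < inner ℝ e (y - p) → curvForm (Du f y) (-D2u f y) = 0)
    (hQg : ∀ y ∈ ball p r, 0 < inner ℝ e (y - p) → curvForm (Du g y) (-D2u g y) = 0)
    (hE : ∀ y ∈ ball p r, 0 < inner ℝ e (y - p) → (newton (Du f y) (-D2u f y)).PosDef)
    (hH : ∀ y ∈ ball p r, 0 < inner ℝ e (y - p) → 0 ≤ (invMetric (Du f y) * -D2u f y).trace)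
    (hs : ∀ y ∈ ball p r, 0 < inner ℝ e (y - p) → 0 < fderiv ℝ f y e)
    (hfg0 : ∀ y ∈ ball p r, inner ℝ e (y - p) = 0 → f y = g y)
    (hfg : ∀ y ∈ ball p r, 0 < inner ℝ e (y - p) → g y < f y) : False := by
  have hfat : ∀ y ∈ ball p r, ContDiffAt ℝ 2 f y := fun y hy =>
    hf.contDiffAt (isOpen_ball.mem_nhds hy)
  have hgat : ∀ y ∈ ball p r, ContDiffAt ℝ 2 g y := fun y hy =>
    hg.contDiffAt (isOpen_ball.mem_nhds hy)
  have two0 : (2 : WithTop ℕ∞) ≠ 0 := by norm_num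
  have hp : p ∈ ball p r := mem_ball_self hr
  set c₀ := e.ofLp ⬝ᵥ newton 0 (-D2u f p) *ᵥ e.ofLp with hc₀
  have hc₀pos : 0 < c₀ := dotProduct_newton_pos hr he hf hfp hQf hE hH hs
  -- The coefficient is a tangential trace, and `f - g` vanishes on the hyperplane, so `g` inherits
  -- the nondegeneracy of `f` at `p`.
  have hc₀g : e.ofLp ⬝ᵥ newton 0 (-D2u g p) *ᵥ e.ofLp = c₀ := by
    have h1 := trace_eq_dotProduct_of_forall_orthogonal he (M := D2u (fun y => f y - g y) p)
      fun a ha => by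
        rw [dotProduct_D2u_mulVec ((hfat p hp).sub (hgat p hp))]
        exact fderiv_fderiv_eq_zero_of_eq_zero hr ((hfat p hp).sub (hgat p hp))
          (fun y hy h => sub_eq_zero.2 (hfg0 y hy h)) ha
    rw [D2u_sub (hfat p hp) (hgat p hp), trace_sub, sub_mulVec, dotProduct_sub] at h1
    rw [hc₀, dotProduct_newton_zero he, dotProduct_newton_zero he, neg_mulVec, neg_mulVec,
      dotProduct_neg, dotProduct_neg, trace_neg, trace_neg]
    linarith
  have hDf : ContinuousAt (Du f) p := (continuousOn_Du isOpen_ball hf).continuousAt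
    (isOpen_ball.mem_nhds hp)
  have hDg : ContinuousAt (Du g) p := (continuousOn_Du isOpen_ball hg).continuousAt
    (isOpen_ball.mem_nhds hp)
  have hAg : ContinuousAt (fun y => -D2u g y) p := (continuousAt_D2u (hgat p hp)).neg
  set M := frob (-D2u g p) + 1 with hM
  have hMpos : 0 < M := by have := frob_nonneg (-D2u g p); linarith
  have hd1 : ∀ᶠ y in 𝓝 p, ‖Du f y‖ < 1 := hDf.norm.eventually (gt_mem_nhds (by simp [hfp]))
  have hd2 : ∀ᶠ y in 𝓝 p, ‖Du g y‖ < 1 := hDg.norm.eventually (gt_mem_nhds (by simp [hgp]))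
  have hd3 : ∀ᶠ y in 𝓝 p, frob (-D2u g y) < M :=
    (continuousAt_frob hAg).eventually (gt_mem_nhds (by rw [hM]; exact lt_add_one _))
  have hd4 : ∀ᶠ y in 𝓝 p, c₀ / 2 < e.ofLp ⬝ᵥ newton (Du f y) (-D2u g y) *ᵥ e.ofLp :=
    (continuousAt_dotProduct_mulVec (continuousAt_newton hDf hAg) _ _).eventually
      (lt_mem_nhds (by simp only [hfp]; rw [hc₀g]; linarith))
  obtain ⟨r₁, hr₁, hb⟩ := Metric.eventually_nhds_iff_ball.1
    ((((hd1.and hd2).and hd3).and hd4).and (isOpen_ball.eventually_mem hp))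
  -- `L c₀` must dominate the trace error `4 n³ M` and half of the gradient error `112 n⁴ M²`. The
  -- extra `1` pays for the quadratic term in `η`.
  set L : ℝ := 1 + (4 * n ^ 3 * M + 56 * n ^ 4 * M ^ 2 + 1) / c₀ with hL
  have hL1 : 1 ≤ L := by
    have : 0 ≤ (4 * (n : ℝ) ^ 3 * M + 56 * n ^ 4 * M ^ 2 + 1) / c₀ := by positivity
    linarith
  have hLc : 4 * (n : ℝ) ^ 3 * M + 56 * n ^ 4 * M ^ 2 + 1 ≤ L * c₀ := by
    rw [hL, add_mul, div_mul_cancel₀ _ hc₀pos.ne']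
    linarith
  obtain ⟨δ, hδ, hδ1, hLδ, hδr⟩ := exists_barrier_parameters (half_pos hr₁) hL1
  have hcl : closedBall p (r₁ / 2) ⊆ ball p r₁ := closedBall_subset_ball (by linarith)
  have hφc : ∀ y ∈ ball p r, ContDiffAt ℝ 2 (fun y => f y - g y) y := fun y hy =>
    (hfat y hy).sub (hgat y hy)
  -- `C` bounds the curvature form of the barrier's Hessian, and `η ≤ 1 / (C + 1)` keeps the
  -- quadratic term below `η`.
  set C : ℝ := 2 * n ^ 4 * (2 * L + 2) ^ 2 with hC
  have hCnn : 0 ≤ C := by positivity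
  have hη₀ : 0 < 1 / (C + 1) := by positivity
  have hφp : f p - g p = 0 := sub_eq_zero.2 (hfg0 p hp (by simp))
  obtain ⟨η, hη, hle⟩ := barrier_dichotomy (φ := fun y => f y - g y) he (half_pos hr₁)
    (fun y hy => (hφc y (hb y (hcl hy)).2).continuousAt.continuousWithinAt) hφp
    (fun y hy h => sub_pos.2 (hfg y (hb y (hcl hy)).2 h)) hδ hδ1 hL1 hLδ hδr hη₀ (by
      intro η hη hη1 z hz0 hzδ hzn hmin
      have hzr₁ : z ∈ ball p r₁ := by
        rw [mem_ball, dist_eq_norm]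
        by_contra! h
        have := pow_le_pow_left₀ hr₁.le h 2
        nlinarith
      obtain ⟨⟨⟨⟨hz1, hz2⟩, hz3⟩, hz4⟩, hzr⟩ := hb z hzr₁
      have hbc : ContDiffAt ℝ 2 (barrier e p p L 0) z := (contDiff_barrier e p p L 0).contDiffAt
      obtain ⟨hk1, hk2⟩ := IsLocalMin.Du_eq_zero_and_posSemidef hmin
        ((hφc z hzr).sub (contDiffAt_const.mul hbc))
      rw [Du_sub ((hφc z hzr).differentiableAt two0)
        ((contDiffAt_const.mul hbc).differentiableAt two0),
        Du_sub ((hfat z hzr).differentiableAt two0) ((hgat z hzr).differentiableAt two0),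
        Du_const_mul _ (hbc.differentiableAt two0)] at hk1
      rw [D2u_sub (hφc z hzr) (contDiffAt_const.mul hbc), D2u_sub (hfat z hzr) (hgat z hzr),
        D2u_const_mul _ hbc, D2u_barrier, mul_zero, zero_smul, sub_zero] at hk2
      -- Ellipticity of `f` alone is used: adding the semidefinite Hessian to `-D²f` leaves `-D²g -
      -- η B`, evaluated with the gradient of `f`.
      have hge := curvForm_add_nonneg (hQf z hzr hz0) (hE z hzr hz0).posSemidef hk2
      set B : Matrix (Fin n) (Fin n) ℝ :=
        (2 * L) • vecMulVec e.ofLp e.ofLp - (2 : ℝ) • 1 with hB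
      have heq : -D2u f z + (D2u f z - D2u g z - η • B) = -D2u g z - η • B := by abel
      rw [heq, curvForm_sub_smul] at hge
      have hdiff := abs_curvForm_sub_le hz1.le hz2.le (-D2u g z)
      have hqq : Du f z - Du g z = η • Du (barrier e p p L 0) z := sub_eq_zero.1 hk1
      rw [hQg z hzr hz0, sub_zero, hqq, norm_smul, Real.norm_of_nonneg hη.le] at hdiff
      have hdiff' := (abs_le.1 hdiff).2
      have h7 := norm_Du_barrier_le (w := p) (σ := 0) he hL1 hδ1 hLδ hz0.le hzδ.le hzn (by simp)
      have hlow := trace_newton_mul_le (e := e) (q := Du f z) (A := -D2u g z) L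
      rw [← hB] at hlow
      have hCB := (abs_le.1 (abs_curvForm_le (Du f z)
        (abs_hessian_barrier_apply_le he (by linarith : 0 ≤ L)))).2
      rw [← hB, ← hC] at hCB
      have hηC : η * C ≤ 1 := by
        calc η * C ≤ 1 / (C + 1) * C := mul_le_mul_of_nonneg_right hη1 hCnn
          _ ≤ 1 := by rw [one_div, inv_mul_le_iff₀ (by positivity)]; linarith
      set F := frob (-D2u g z) with hF
      have hFnn : 0 ≤ F := frob_nonneg _
      have hFM : F ^ 2 ≤ M ^ 2 := pow_le_pow_left₀ hFnn hz3.le 2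
      have h8 : curvForm (Du f z) (-D2u g z) ≤ η * (112 * n ^ 4 * M ^ 2) := by
        refine hdiff'.trans ?_
        calc 16 * (n : ℝ) ^ 4 * (η * ‖Du (barrier e p p L 0) z‖) * F ^ 2
            ≤ 16 * n ^ 4 * (η * 7) * M ^ 2 := by gcongr
          _ = _ := by ring
      have h9 : η ^ 2 * curvForm (Du f z) B ≤ η * 1 := by
        calc η ^ 2 * curvForm (Du f z) B ≤ η ^ 2 * C := by gcongr
          _ = η * (η * C) := by ring
          _ ≤ _ := by gcongr
      have h10 : 4 * (n : ℝ) ^ 3 * F ≤ 4 * n ^ 3 * M := by gcongr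
      have h11 : L * c₀ ≤ 2 * L * (e.ofLp ⬝ᵥ newton (Du f z) (-D2u g z) *ᵥ e.ofLp) := by
        have : L * (c₀ / 2) ≤ L * (e.ofLp ⬝ᵥ newton (Du f z) (-D2u g z) *ᵥ e.ofLp) := by gcongr
        linarith
      have h12 : η * (56 * n ^ 4 * M ^ 2 + 1) ≤ η * (newton (Du f z) (-D2u g z) * B).trace := by
        refine mul_le_mul_of_nonneg_left ?_ hη.le
        linarith
      linarith)
  have h1 := fderiv_pos_of_barrier_le (φ := fun y => f y - g y) hη hδ hφp
    ((hφc p hp).differentiableAt two0) hle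
  rw [fderiv_apply_eq_inner, Du_sub ((hfat p hp).differentiableAt two0)
    ((hgat p hp).differentiableAt two0), hfp, hgp, sub_zero, inner_zero_left] at h1
  exact lt_irrefl _ h1

end GraphCurvature

/-! ### One-sided level sets, and vertical tangency from gradient blow-up. -/

namespace GraphCurvature

open Matrix Filter Topology Metric

variable {n : ℕ}

lemma eventually_pos_of_fderiv_pos {k : EuclideanSpace ℝ (Fin n) → ℝ}
    {p a : EuclideanSpace ℝ (Fin n)} (hk : DifferentiableAt ℝ k p) (hkp : k p = 0)
    (ha : 0 < fderiv ℝ k p a) : ∀ᶠ s in 𝓝[>] (0 : ℝ), 0 < k (p + s • a) := by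
  have hd := hasDerivAt_line (x := p) (a := a) (s := 0) (f := k) (by simpa using hk)
  simp only [zero_smul, add_zero] at hd
  have ht : Tendsto (fun t => slope (fun s : ℝ => k (p + s • a)) 0 t) (𝓝[>] 0)
      (𝓝 (fderiv ℝ k p a)) :=
    (hasDerivAt_iff_tendsto_slope.1 hd).mono_left (nhdsWithin_mono _ fun x hx => ne_of_gt hx)
  filter_upwards [ht.eventually (lt_mem_nhds ha), self_mem_nhdsWithin] with s hs hs0
  simp only [slope, zero_smul, add_zero, hkp, vsub_eq_sub, sub_zero, smul_eq_mul] at hs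
  exact (pos_iff_pos_of_mul_pos hs).1 (inv_pos.2 hs0)

section HalfSpace

variable {e p : EuclideanSpace ℝ (Fin n)} {k : EuclideanSpace ℝ (Fin n) → ℝ}

/-- A function positive only in a half space increases in the inner normal direction. -/
lemma fderiv_pos_of_nonneg_half_space (he : ‖e‖ = 1) (hk : DifferentiableAt ℝ k p) (hkp : k p = 0)
    (hk0 : fderiv ℝ k p ≠ 0) (h : ∀ᶠ y in 𝓝 p, 0 ≤ k y → 0 ≤ inner ℝ e (y - p)) :
    0 < fderiv ℝ k p e := by
  have key : ∀ a, 0 < fderiv ℝ k p a → 0 ≤ inner ℝ e a := by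
    intro a ha
    have h1 := (tendsto_add_smul p a).mono_left (nhdsWithin_le_nhds (s := Set.Ioi 0))
    obtain ⟨s, ⟨hs1, hs2⟩, hs3⟩ := ((eventually_pos_of_fderiv_pos hk hkp ha).and
      (h1.eventually h)|>.and self_mem_nhdsWithin).exists
    have h2 := hs2 hs1.le
    rw [add_sub_cancel_left, inner_smul_right] at h2
    exact nonneg_of_mul_nonneg_right h2 hs3
  have hee : inner ℝ e e = (1 : ℝ) := by rw [real_inner_self_eq_norm_sq, he, one_pow]
  have horth : ∀ a, inner ℝ e a = 0 → fderiv ℝ k p a ≤ 0 := by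
    intro a ha
    by_contra! hpos
    -- With this `c` the derivative along `c a - e` is positive, although that vector has inner
    -- product `-1` with `e`.
    set c := (|fderiv ℝ k p e| + 1) / fderiv ℝ k p a with hc
    have h1 := key (c • a - e) (by
      rw [map_sub, map_smul, smul_eq_mul, hc, div_mul_cancel₀ _ hpos.ne']
      linarith [le_abs_self (fderiv ℝ k p e)])
    rw [inner_sub_right, inner_smul_right, ha, hee] at h1
    linarith
  have hdec : ∀ a, fderiv ℝ k p a = inner ℝ e a * fderiv ℝ k p e := by
    intro a
    have h0 : inner ℝ e (a - (inner ℝ e a : ℝ) • e) = (0 : ℝ) := by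
      rw [inner_sub_right, inner_smul_right, hee]
      ring
    have h1 := horth _ h0
    have h2 := horth (-(a - (inner ℝ e a : ℝ) • e)) (by rw [inner_neg_right, h0, neg_zero])
    rw [map_neg] at h2
    rw [map_sub, map_smul, smul_eq_mul] at h1 h2
    linarith
  rcases lt_trichotomy (fderiv ℝ k p e) 0 with hneg | hz | hpos
  · have := key (-e) (by rw [map_neg]; linarith)
    rw [inner_neg_right, hee] at this
    linarith
  · exact absurd (ContinuousLinearMap.ext fun a => by rw [hdec, hz, mul_zero]; rfl) hk0
  · exact hpos

lemma inner_add_smul_sub (he : ‖e‖ = 1) (y : EuclideanSpace ℝ (Fin n)) (s : ℝ) :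
    inner ℝ e (y + s • e - p) = inner ℝ e (y - p) + s := by
  rw [add_sub_right_comm, inner_add_right, inner_smul_right, real_inner_self_eq_norm_sq, he]
  ring

lemma add_smul_mem_ball {r s : ℝ} (he : ‖e‖ = 1) {y : EuclideanSpace ℝ (Fin n)}
    (hy : y ∈ ball p r) (hs : |s| ≤ r) : y + s • e ∈ ball p (2 * r) := by
  rw [mem_ball, dist_eq_norm] at hy ⊢
  rw [add_sub_right_comm]
  refine (norm_add_le _ _).trans_lt ?_
  rw [norm_smul, he, Real.norm_eq_abs]
  linarith

/-- A `C¹` function whose positivity set is on one side of a hyperplane, and whose zero set is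
contained in it, vanishes on the hyperplane and is nonnegative on the half space. -/
lemma eventually_half_space (he : ‖e‖ = 1) (hk : ContDiffAt ℝ 1 k p) (hkp : k p = 0)
    (hk0 : fderiv ℝ k p ≠ 0) (h : ∀ᶠ y in 𝓝 p, 0 ≤ k y → 0 ≤ inner ℝ e (y - p))
    (h' : ∀ᶠ y in 𝓝 p, k y = 0 → inner ℝ e (y - p) = 0) :
    ∀ᶠ y in 𝓝 p, (inner ℝ e (y - p) = 0 → k y = 0) ∧ (0 ≤ inner ℝ e (y - p) → 0 ≤ k y) := by
  have hpos := fderiv_pos_of_nonneg_half_space he (hk.differentiableAt one_ne_zero) hkp hk0 h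
  have hcont : ∀ᶠ y in 𝓝 p, ContinuousAt k y :=
    (hk.eventually (by simp)).mono fun y hy => hy.continuousAt
  obtain ⟨r, hr, hb⟩ := Metric.eventually_nhds_iff_ball.1 ((h.and h').and hcont)
  obtain ⟨s, hs1, hs2⟩ := ((eventually_pos_of_fderiv_pos (hk.differentiableAt one_ne_zero) hkp
    hpos).and (Ioo_mem_nhdsGT (half_pos hr))).exists
  have hks : ∀ᶠ y in 𝓝 p, 0 < k (y + s • e) := by
    have hc : ContinuousAt (fun y => k (y + s • e)) p := by
      refine ContinuousAt.comp (g := k) (f := fun y => y + s • e) ?_ (by fun_prop)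
      refine (hb _ ?_).2
      rw [mem_ball, dist_eq_norm, add_sub_cancel_left, norm_smul, he, Real.norm_of_nonneg hs2.1.le]
      linarith [hs2.2]
    exact hc.eventually (lt_mem_nhds hs1)
  have hball : ∀ y ∈ ball p (r / 2), ∀ τ : ℝ, |τ| ≤ r / 2 → y + τ • e ∈ ball p r := by
    intro y hy τ hτ
    have := add_smul_mem_ball he hy hτ
    rwa [mul_div_cancel₀ _ (two_ne_zero)] at this
  have hline : ∀ y ∈ ball p (r / 2), ContinuousOn (fun τ : ℝ => k (y + τ • e))
      (Set.Icc (-(r / 2)) (r / 2)) := by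
    intro y hy τ hτ
    refine ContinuousAt.continuousWithinAt ?_
    refine ContinuousAt.comp (g := k) (f := fun τ : ℝ => y + τ • e) ?_ (by fun_prop)
    exact (hb _ (hball y hy τ (abs_le.2 hτ))).2
  -- Otherwise `k` would vanish between `y` and `y + s e`, where `t > 0`, off the hyperplane that
  -- contains its zeros.
  have hhalf : ∀ y ∈ ball p (r / 2), 0 < inner ℝ e (y - p) → 0 < k (y + s • e) → 0 < k y := by
    intro y hy hty hky
    by_contra! hneg
    obtain ⟨τ, hτ, hkτ⟩ := intermediate_value_Icc hs2.1.le
      ((hline y hy).mono (Set.Icc_subset_Icc (by linarith) hs2.2.le))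
      (show (0 : ℝ) ∈ Set.Icc (k (y + (0 : ℝ) • e)) (k (y + s • e)) from
        ⟨by simpa using hneg, hky.le⟩)
    have h1 := (hb _ (hball y hy τ (abs_le.2 ⟨by linarith [hτ.1], hτ.2.trans hs2.2.le⟩))).1.2 hkτ
    rw [inner_add_smul_sub he] at h1
    linarith [hτ.1]
  have hzero : ∀ y ∈ ball p (r / 2), inner ℝ e (y - p) = 0 → 0 < k (y + s • e) → k y = 0 := by
    intro y hy hty hky
    rcases lt_trichotomy (k y) 0 with hneg | hz | hpos'
    · obtain ⟨τ, hτ, hkτ⟩ := intermediate_value_Icc hs2.1.le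
        ((hline y hy).mono (Set.Icc_subset_Icc (by linarith) hs2.2.le))
        (show (0 : ℝ) ∈ Set.Icc (k (y + (0 : ℝ) • e)) (k (y + s • e)) from
        ⟨by simpa using hneg.le, hky.le⟩)
      have h1 := (hb _ (hball y hy τ (abs_le.2 ⟨by linarith [hτ.1], hτ.2.trans hs2.2.le⟩))).1.2 hkτ
      rw [inner_add_smul_sub he, hty, zero_add] at h1
      simp only [h1, zero_smul, add_zero] at hkτ
      exact hkτ
    · exact hz
    -- Positivity at a point of the hyperplane would persist slightly below it, where `k` must be
    -- negative.
    · exfalso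
      have hyr : y ∈ ball p r := by simpa using hball y hy 0 (by simp; linarith)
      have hev : ∀ᶠ τ in 𝓝 (0 : ℝ), 0 < k (y + τ • e) :=
        (tendsto_add_smul y e).eventually ((hb y hyr).2.eventually (lt_mem_nhds hpos'))
      obtain ⟨ε, hε, hε'⟩ := Metric.eventually_nhds_iff_ball.1 hev
      set τ := -(min ε (r / 2) / 2) with hτ
      have hm : 0 < min ε (r / 2) := lt_min hε (half_pos hr)
      have hτ1 : |τ| = min ε (r / 2) / 2 := by rw [hτ, abs_neg, abs_of_pos (by positivity)]
      have h1 := (hb _ (hball y hy τ (by rw [hτ1]; linarith [min_le_right ε (r / 2)]))).1.1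
        (hε' τ (by
          rw [mem_ball, Real.dist_eq, sub_zero, hτ1]; linarith [min_le_left ε (r / 2)])).le
      rw [inner_add_smul_sub he, hty] at h1
      linarith
  filter_upwards [hks, isOpen_ball.eventually_mem (mem_ball_self (x := p) (half_pos hr))]
    with y h1 h2
  refine ⟨fun h3 => hzero y h2 h3 h1, fun h3 => ?_⟩
  rcases h3.eq_or_lt with h4 | h4
  · exact (hzero y h2 h4.symm h1).ge
  · exact (hhalf y h2 h4 h1).le

end HalfSpace

/-- If `F` vanishes on the graph of `w`, whose gradient blows up at `p`, then the vertical
derivative of `F` vanishes at the limit point. -/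
lemma fderiv_vertical_eq_zero {w : EuclideanSpace ℝ (Fin n) → ℝ}
    {S₀ : Set (EuclideanSpace ℝ (Fin n))}
    {p : EuclideanSpace ℝ (Fin n)} {F : EuclideanSpace ℝ (Fin n) × ℝ → ℝ} {c : ℝ}
    (hS₀ : IsOpen S₀) (hw : DifferentiableOn ℝ w S₀) (hne : (𝓝[S₀] p).NeBot)
    (hwc : Tendsto w (𝓝[S₀] p) (𝓝 c))
    (hF : ContDiffAt ℝ 1 F (p, c)) (hFw : ∀ᶠ X in 𝓝 (p, c), X.1 ∈ S₀ → X.2 = w X.1 → F X = 0)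
    (hD : Tendsto (fun x => ‖Du w x‖) (𝓝[S₀] p) atTop) :
    fderiv ℝ F (p, c) (0, 1) = 0 := by
  have hlim : Tendsto (fun x => (x, w x)) (𝓝[S₀] p) (𝓝 (p, c)) :=
    (tendsto_id.mono_left nhdsWithin_le_nhds).prodMk_nhds hwc
  have hFc : ContinuousAt (fderiv ℝ F) (p, c) :=
    (hF.fderiv_right (m := 0) (by norm_num)).continuousAt
  have h1 : Tendsto (fun x => |fderiv ℝ F (x, w x) (0, 1)|) (𝓝[S₀] p)
      (𝓝 |fderiv ℝ F (p, c) (0, 1)|) :=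
    (((hFc.clm_apply continuousAt_const).tendsto.comp hlim)).abs
  have h2 : Tendsto (fun x => ‖fderiv ℝ F (x, w x)‖ / ‖Du w x‖) (𝓝[S₀] p) (𝓝 0) :=
    (hFc.norm.tendsto.comp hlim).div_atTop hD
  have h3 : |fderiv ℝ F (p, c) (0, 1)| ≤ 0 := by
    refine le_of_tendsto_of_tendsto h1 h2 ?_
    filter_upwards [hlim.eventually (hF.eventually (by simp)), self_mem_nhdsWithin,
      hlim.eventually hFw.eventually_nhds, hD.eventually_gt_atTop 0] with x hx1 hx2 hx3 hx4
    have hwx : HasFDerivAt w (fderiv ℝ w x) x :=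
      (hw.differentiableAt (hS₀.mem_nhds hx2)).hasFDerivAt
    have hcomp : HasFDerivAt (fun y => F (y, w y)) (fderiv ℝ F (x, w x) ∘L
        ((ContinuousLinearMap.id ℝ _).prod (fderiv ℝ w x))) x :=
      (hx1.differentiableAt one_ne_zero).hasFDerivAt.comp x
        (f := fun y => (y, w y)) ((hasFDerivAt_id x).prodMk hwx)
    have hz : (fun y => F (y, w y)) =ᶠ[𝓝 x] fun _ => 0 := by
      have hcx : ContinuousAt (fun y => (y, w y)) x := continuousAt_id.prodMk hwx.continuousAt
      filter_upwards [hcx.eventually hx3, hS₀.mem_nhds hx2] with y hy1 hy2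
      exact hy1 hy2 rfl
    have h4 := hcomp.fderiv
    rw [hz.fderiv_eq, fderiv_fun_const, Pi.zero_apply] at h4
    -- The tangent vector `(Dw, |Dw|²)` of the graph is annihilated by `dF`, so the vertical
    -- derivative is at most `|dF| / |Dw|`, which tends to `0`.
    have h5 := congrArg (fun T => T (Du w x)) h4
    have h6 : (Du w x, ‖Du w x‖ ^ 2) = (Du w x, (0 : ℝ)) +
        (‖Du w x‖ ^ 2) • ((0 : EuclideanSpace ℝ (Fin n)), (1 : ℝ)) := by
      simp
    simp only [ContinuousLinearMap.comp_apply, ContinuousLinearMap.prod_apply,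
      fderiv_apply_eq_inner, real_inner_self_eq_norm_sq, ContinuousLinearMap.id_apply,
      _root_.zero_apply] at h5
    rw [h6, map_add, map_smul, smul_eq_mul] at h5
    have h7 : |fderiv ℝ F (x, w x) (Du w x, 0)| ≤ ‖fderiv ℝ F (x, w x)‖ * ‖Du w x‖ := by
      have := (fderiv ℝ F (x, w x)).le_opNorm (Du w x, 0)
      simpa using this
    rw [le_div_iff₀ hx4]
    have h8 : |fderiv ℝ F (x, w x) (0, 1)| * ‖Du w x‖ * ‖Du w x‖ ≤
        ‖fderiv ℝ F (x, w x)‖ * ‖Du w x‖ := by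
      calc _ = |fderiv ℝ F (x, w x) (Du w x, 0)| := by
            rw [eq_neg_of_add_eq_zero_left h5.symm, abs_neg, abs_mul,
              abs_of_nonneg (sq_nonneg ‖Du w x‖)]
            ring
        _ ≤ _ := h7
    exact le_of_mul_le_mul_right h8 hx4
  exact abs_nonpos_iff.1 h3

end GraphCurvature

/-! ### Rewriting a vertically tangent graph as a graph in the normal direction. -/

namespace GraphCurvature

open Matrix Filter Topology Metric

variable {n : ℕ}

/-- If `F (·, c)` vanishes on the regular level set `{ρ = 0}`, its differential at `p` is
proportional to that of `ρ`. -/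
lemma exists_fderiv_eq_smul_of_eq_zero {φ ρ : EuclideanSpace ℝ (Fin n) → ℝ}
    {p : EuclideanSpace ℝ (Fin n)} (hφ : ContDiffAt ℝ 1 φ p) (hρ : ContDiffAt ℝ 1 ρ p)
    (hρ0 : fderiv ℝ ρ p ≠ 0) (hφp : φ p = 0) (h : ∀ᶠ x in 𝓝 p, ρ x = ρ p → φ x = 0) :
    ∃ m : ℝ, fderiv ℝ φ p = m • fderiv ℝ ρ p := by
  -- Being zero on the level set, `φ` has a constrained extremum at `p`, so Lagrange multipliers
  -- apply even though `ρ` is only `C¹`.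
  have hext : IsLocalExtrOn φ {x | ρ x = ρ p} p := by
    left
    rw [IsMinFilter, eventually_nhdsWithin_iff]
    filter_upwards [h] with x hx hxp
    rw [hφp, hx hxp]
  obtain ⟨a, b, hab, h0⟩ := hext.exists_multipliers_of_hasStrictFDerivAt_1d
    (hρ.hasStrictFDerivAt one_ne_zero) (hφ.hasStrictFDerivAt one_ne_zero)
  have hb : b ≠ 0 := by
    rintro rfl
    rw [zero_smul, add_zero] at h0
    rcases smul_eq_zero.1 h0 with ha | ha
    · exact hab (by simp [ha])
    · exact hρ0 ha
  refine ⟨-(b⁻¹ * a), ?_⟩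
  rw [neg_smul, mul_smul, eq_neg_of_add_eq_zero_left h0, smul_neg, neg_neg, inv_smul_smul₀ hb]

/-- The point over `y` of the graph of `f`, when the graph is taken in the direction `e`. -/
noncomputable def normalGraph (e p : EuclideanSpace ℝ (Fin n)) (f : EuclideanSpace ℝ (Fin n) → ℝ)
    (y : EuclideanSpace ℝ (Fin n)) : EuclideanSpace ℝ (Fin n) :=
  y + (f y - inner ℝ e (y - p)) • e

section

variable {e p : EuclideanSpace ℝ (Fin n)} {f : EuclideanSpace ℝ (Fin n) → ℝ}
  {y : EuclideanSpace ℝ (Fin n)}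

lemma hasFDerivAt_normalGraph (hf : DifferentiableAt ℝ f y) :
    HasFDerivAt (normalGraph e p f) (ContinuousLinearMap.id ℝ _ +
      (innerSL ℝ (Du f y) - innerSL ℝ e).smulRight e) y := by
  have h : HasFDerivAt f (innerSL ℝ (Du f y)) y := by
    rw [← fderiv_eq_innerSL]
    exact hf.hasFDerivAt
  exact (hasFDerivAt_id y).add ((h.sub (hasFDerivAt_inner_sub e p y)).smul_const e)

lemma normalGraph_self (hfp : f p = 0) : normalGraph e p f p = p := by
  simp [normalGraph, hfp]

end

/-- The implicit function theorem for `F (y + (s - ⟨e, y - p⟩) e, ⟨e, y - p⟩) = 0`. -/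
lemma exists_implicit_normalGraph {e p : EuclideanSpace ℝ (Fin n)} (he : ‖e‖ = 1)
    {F : EuclideanSpace ℝ (Fin n) × ℝ → ℝ} (hF : ContDiffAt ℝ 2 F (p, 0)) (hF0 : F (p, 0) = 0)
    {μ : ℝ} (hμ : μ ≠ 0) (hD : ∀ a s, fderiv ℝ F (p, 0) (a, s) = μ * inner ℝ e a) :
    ∃ f : EuclideanSpace ℝ (Fin n) → ℝ, ContDiffAt ℝ 2 f p ∧ f p = 0 ∧ Du f p = 0 ∧
      ∀ᶠ y in 𝓝 p, F (normalGraph e p f y, inner ℝ e (y - p)) = 0 := by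
  have hee : inner ℝ e e = (1 : ℝ) := by rw [real_inner_self_eq_norm_sq, he, one_pow]
  -- `χ` turns the `e`-component of `y` into the height and puts `s` in its place. The differential
  -- of `F ∘ χ` at `(p, 0)` is `(a, s) ↦ μ s`: invertible in `s`, and zero in `a`, whence `Df(p) =
  -- 0`.
  set χ : EuclideanSpace ℝ (Fin n) × ℝ → EuclideanSpace ℝ (Fin n) × ℝ := fun z =>
    (z.1 + (z.2 - inner ℝ e (z.1 - p)) • e, inner ℝ e (z.1 - p)) with hχ
  have hip : ContDiff ℝ 2 fun z : EuclideanSpace ℝ (Fin n) × ℝ => (inner ℝ e (z.1 - p) : ℝ) :=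
    contDiff_const.inner ℝ (contDiff_fst.sub contDiff_const)
  have hχc : ContDiff ℝ 2 χ :=
    (contDiff_fst.add ((contDiff_snd.sub hip).smul contDiff_const)).prodMk hip
  have hχp : χ (p, 0) = (p, 0) := by simp [hχ]
  have hΨ : ContDiffAt ℝ 2 (F ∘ χ) (p, 0) :=
    ContDiffAt.comp _ (by rwa [hχp]) hχc.contDiffAt
  have hfst : HasFDerivAt (Prod.fst : EuclideanSpace ℝ (Fin n) × ℝ → _)
    (ContinuousLinearMap.fst ℝ (EuclideanSpace ℝ (Fin n)) ℝ) (p, 0) := hasFDerivAt_fst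
  have hsnd : HasFDerivAt (Prod.snd : EuclideanSpace ℝ (Fin n) × ℝ → _)
    (ContinuousLinearMap.snd ℝ (EuclideanSpace ℝ (Fin n)) ℝ) (p, 0) := hasFDerivAt_snd
  have hi : HasFDerivAt (fun z : EuclideanSpace ℝ (Fin n) × ℝ => (inner ℝ e (z.1 - p) : ℝ))
    ((innerSL ℝ e).comp (ContinuousLinearMap.fst ℝ _ ℝ)) (p, 0) :=
    HasFDerivAt.comp (g := fun y => inner ℝ e (y - p)) (p, (0 : ℝ))
      (hasFDerivAt_inner_sub e p p) hfst
  have hχd : HasFDerivAt χ ((ContinuousLinearMap.fst ℝ _ ℝ + (ContinuousLinearMap.snd ℝ _ ℝ -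
      (innerSL ℝ e).comp (ContinuousLinearMap.fst ℝ _ ℝ)).smulRight e).prod
        ((innerSL ℝ e).comp (ContinuousLinearMap.fst ℝ _ ℝ))) (p, 0) :=
    (hfst.add ((hsnd.sub hi).smul_const e)).prodMk hi
  have hΨd : ∀ a s, fderiv ℝ (F ∘ χ) (p, 0) (a, s) = μ * s := by
    intro a s
    have hFd : HasFDerivAt F (fderiv ℝ F (p, 0)) (χ (p, 0)) := by
      rw [hχp]
      exact (hF.differentiableAt (by norm_num)).hasFDerivAt
    rw [(hFd.comp _ hχd).fderiv]
    simp only [ContinuousLinearMap.comp_apply, ContinuousLinearMap.prod_apply, hD]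
    simp only [_root_.add_apply, ContinuousLinearMap.smulRight_apply,
      ContinuousLinearMap.coe_fst', inner_add_right, inner_smul_right, hee]
    simp
  have two0 : (2 : WithTop ℕ∞) ≠ 0 := by norm_num
  have hinv : (fderiv ℝ (F ∘ χ) (p, 0) ∘L .inr ℝ (EuclideanSpace ℝ (Fin n)) ℝ).IsInvertible := by
    refine ⟨ContinuousLinearEquiv.smulLeft (Units.mk0 μ hμ), ?_⟩
    ext
    simp [hΨd, Units.smul_def]
  have hΨ0 : (F ∘ χ) (p, 0) = 0 := by rw [Function.comp_apply, hχp, hF0]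
  refine ⟨hΨ.implicitFunction two0 hinv, hΨ.contDiffAt_implicitFunction two0 hinv,
    hΨ.implicitFunction_apply_self two0 hinv, ?_, ?_⟩
  · have h1 := (hΨ.hasStrictFDerivAt_implicitFunction two0 hinv).hasFDerivAt
    have h2 : fderiv ℝ (F ∘ χ) (p, 0) ∘L .inl ℝ (EuclideanSpace ℝ (Fin n)) ℝ = 0 := by
      ext a
      simp [hΨd]
    rw [h2] at h1
    apply Du_eq_of_hasFDerivAt
    simpa using h1
  · filter_upwards [hΨ.eventually_apply_implicitFunction two0 hinv] with y hy
    rw [hΨ0] at hy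
    exact hy

/-- A hypersurface with boundary which is a graph with gradient blowing up at a boundary point is,
near this point, a graph in the direction normal to the boundary. -/
theorem exists_normalGraph {e p : EuclideanSpace ℝ (Fin n)} {w ρ : EuclideanSpace ℝ (Fin n) → ℝ}
    {S S₀ T : Set (EuclideanSpace ℝ (Fin n))} (he : ‖e‖ = 1)
    (hM : IsC2HypersurfaceWithBoundary (graphOver w S) (graphOver w T))
    (hS₀ : IsOpen S₀) (hS₀S : S₀ ⊆ S) (hw : DifferentiableOn ℝ w S₀) (hne : (𝓝[S₀] p).NeBot)
    (hpT : p ∈ T) (hw0 : ∀ x ∈ S, 0 ≤ w x) (hwT : ∀ x ∈ T, w x = 0)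
    (hwc : ContinuousWithinAt w S p) (hD : Tendsto (fun x => ‖Du w x‖) (𝓝[S₀] p) atTop)
    (hρ : ContDiffAt ℝ 1 ρ p) (hρp : ρ p = 0) {κ : ℝ} (hκ : κ ≠ 0) (hρe : Du ρ p = κ • e)
    (hρT : ∀ᶠ x in 𝓝 p, ρ x = 0 → x ∈ T) :
    ∃ f : EuclideanSpace ℝ (Fin n) → ℝ, ContDiffAt ℝ 2 f p ∧ f p = 0 ∧ Du f p = 0 ∧
      ∀ᶠ y in 𝓝 p, (0 ≤ inner ℝ e (y - p) → normalGraph e p f y ∈ S ∧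
        w (normalGraph e p f y) = inner ℝ e (y - p)) ∧
        (inner ℝ e (y - p) = 0 → normalGraph e p f y ∈ T) := by
  have hee : inner ℝ e e = (1 : ℝ) := by rw [real_inner_self_eq_norm_sq, he, one_pow]
  have he0 : e ≠ 0 := by rintro rfl; simp at he
  have hPΓ : (p, (0 : ℝ)) ∈ graphOver w T := ⟨p, hpT, by simp [hwT p hpT]⟩
  obtain ⟨N, F, G, hN, hPN, hF, hG, hlin, hMN, hΓN⟩ := hM.2.2 _ hPΓ
  have hFc : ContDiffAt ℝ 2 F (p, 0) := hF.contDiffAt (hN.mem_nhds hPN)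
  have hGc : ContDiffAt ℝ 2 G (p, 0) := hG.contDiffAt (hN.mem_nhds hPN)
  have two0 : (2 : WithTop ℕ∞) ≠ 0 := by norm_num
  have hP0 : F (p, 0) = 0 ∧ G (p, 0) = 0 := by
    have : (p, (0 : ℝ)) ∈ graphOver w T ∩ N := ⟨hPΓ, hPN⟩
    rw [hΓN] at this
    exact this.2
  have hvert : fderiv ℝ F (p, 0) (0, 1) = 0 := by
    refine fderiv_vertical_eq_zero hS₀ hw hne ?_ (hFc.of_le (by norm_num)) ?_ hD
    · have := hwc.mono hS₀S
      rwa [ContinuousWithinAt, hwT p hpT] at this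
    · filter_upwards [hN.mem_nhds hPN] with X hXN hX1 hX2
      have : X ∈ graphOver w S ∩ N := ⟨⟨X.1, hS₀S hX1, Prod.ext rfl hX2.symm⟩, hXN⟩
      rw [hMN] at this
      exact this.2.1
  have hslice : ContDiffAt ℝ 1 (fun x => F (x, 0)) p :=
    ContDiffAt.comp p (g := F) (f := fun x => (x, (0 : ℝ))) (hFc.of_le (by norm_num))
      (contDiff_id.prodMk contDiff_const).contDiffAt
  have hsliced : ∀ a, fderiv ℝ (fun x => F (x, 0)) p a = fderiv ℝ F (p, 0) (a, 0) := by
    intro a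
    have h1 : HasFDerivAt (fun x => F (x, 0)) _ p :=
      (hFc.differentiableAt two0).hasFDerivAt.comp p (f := fun x => (x, (0 : ℝ)))
        ((hasFDerivAt_id p).prodMk (hasFDerivAt_const 0 p))
    rw [h1.fderiv]
    rfl
  have hρ0 : fderiv ℝ ρ p ≠ 0 := by
    rw [← norm_ne_zero_iff, norm_fderiv_eq, hρe, norm_ne_zero_iff]
    exact smul_ne_zero hκ he0
  obtain ⟨m, hm⟩ := exists_fderiv_eq_smul_of_eq_zero hslice hρ hρ0 hP0.1 (by
    have hc : ContinuousAt (fun x => (x, (0 : ℝ))) p := by fun_prop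
    filter_upwards [hρT, hc.eventually (hN.eventually_mem hPN)] with x hx1 hx2 hx3
    have hxT := hx1 (hx3.trans hρp)
    have : (x, (0 : ℝ)) ∈ graphOver w T ∩ N := ⟨⟨x, hxT, by simp [hwT x hxT]⟩, hx2⟩
    rw [hΓN] at this
    exact this.2.1)
  set μ := m * κ with hμdef
  have hDF : ∀ a s, fderiv ℝ F (p, 0) (a, s) = μ * inner ℝ e a := by
    intro a s
    have h1 : (a, s) = (a, (0 : ℝ)) + s • ((0 : EuclideanSpace ℝ (Fin n)), (1 : ℝ)) := by simp
    rw [h1, map_add, map_smul, hvert, smul_zero, add_zero, ← hsliced, hm, _root_.smul_apply,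
      fderiv_apply_eq_inner, hρe, inner_smul_left, smul_eq_mul]
    simp [hμdef, mul_assoc]
  rw [LinearIndependent.pair_iff] at hlin
  have hμ : μ ≠ 0 := by
    intro h0
    have := hlin 1 0 (by
      ext x
      · simp [hDF, h0]
      · simp [hDF, h0])
    exact one_ne_zero this.1
  obtain ⟨f, hf, hfp, hDf, hFf⟩ := exists_implicit_normalGraph he hFc hP0.1 hμ hDF
  refine ⟨f, hf, hfp, hDf, ?_⟩
  set X : EuclideanSpace ℝ (Fin n) → EuclideanSpace ℝ (Fin n) × ℝ := fun y =>
    (normalGraph e p f y, inner ℝ e (y - p)) with hX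
  have hXp : X p = (p, 0) := by simp [hX, normalGraph_self hfp]
  have hip : ContDiff ℝ 2 fun y : EuclideanSpace ℝ (Fin n) => (inner ℝ e (y - p) : ℝ) :=
    contDiff_const.inner ℝ (contDiff_id.sub contDiff_const)
  have hXc : ContDiffAt ℝ 2 X p :=
    (contDiffAt_id.add ((hf.sub hip.contDiffAt).smul contDiffAt_const)).prodMk hip.contDiffAt
  have hGX : ContDiffAt ℝ 2 (fun y => G (X y)) p :=
    ContDiffAt.comp p (g := G) (f := X) (by rwa [hXp]) hXc
  have hXd := (hasFDerivAt_normalGraph (e := e) (p := p) (hf.differentiableAt two0)).prodMk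
    (hasFDerivAt_inner_sub e p p)
  have hGXd : ∀ a, fderiv ℝ (fun y => G (X y)) p a =
      fderiv ℝ G (p, 0) (a - (inner ℝ e a : ℝ) • e, inner ℝ e a) := by
    intro a
    have hGd : HasFDerivAt G (fderiv ℝ G (p, 0)) (X p) := by
      rw [hXp]
      exact (hGc.differentiableAt two0).hasFDerivAt
    have h1 : HasFDerivAt (fun y => G (X y)) _ p := hGd.comp p (f := X) hXd
    rw [h1.fderiv, hDf]
    simp [sub_eq_add_neg]
  -- If `G` were critical along the surface, `dG` would be a multiple of `dF = μ ⟨e, ·⟩`, against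
  -- linear independence.
  have hGX0 : fderiv ℝ (fun y => G (X y)) p ≠ 0 := by
    intro h0
    have key : ∀ b s, fderiv ℝ G (p, 0) (b, s) = inner ℝ e b * fderiv ℝ G (p, 0) (e, 0) := by
      intro b s
      have h1 := hGXd (b - (inner ℝ e b : ℝ) • e + s • e)
      have h2 : inner ℝ e (b - (inner ℝ e b : ℝ) • e + s • e) = s := by
        rw [inner_add_right, inner_sub_right, inner_smul_right, inner_smul_right, hee]
        ring
      rw [h0, h2, add_sub_cancel_right] at h1
      have h3 : (b, s) = (b - (inner ℝ e b : ℝ) • e, s) + (inner ℝ e b : ℝ) • (e, (0 : ℝ)) := by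
        simp
      rw [h3, map_add, map_smul, ← h1, smul_eq_mul]
      simp
    have := hlin (-(fderiv ℝ G (p, 0) (e, 0))) μ (by
      ext x
      · simp [hDF, key x 0]
        ring
      · simp [hDF, key 0 1])
    exact hμ this.2
  have hXN : ∀ᶠ y in 𝓝 p, X y ∈ N :=
    hXc.continuousAt.eventually (hN.eventually_mem (by rwa [hXp]))
  have hnonneg : ∀ᶠ y in 𝓝 p, 0 ≤ G (X y) → X y ∈ graphOver w S := by
    filter_upwards [hXN, hFf] with y h1 h2 h3
    have : X y ∈ {Y ∈ N | F Y = 0 ∧ 0 ≤ G Y} := ⟨h1, h2, h3⟩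
    rw [← hMN] at this
    exact this.1
  have hzero : ∀ᶠ y in 𝓝 p, G (X y) = 0 → X y ∈ graphOver w T := by
    filter_upwards [hXN, hFf] with y h1 h2 h3
    have : X y ∈ {Y ∈ N | F Y = 0 ∧ G Y = 0} := ⟨h1, h2, h3⟩
    rw [← hΓN] at this
    exact this.1
  -- The height of a surface point is `t`. As `w ≥ 0` on `S` and `w = 0` on `T`, the set `G ≥ 0`
  -- lies in `t ≥ 0` and its boundary in `t = 0`; hence the whole half ball parametrizes the
  -- surface.
  have hhalf := eventually_half_space (k := fun y => G (X y)) he (hGX.of_le (by norm_num))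
    (by rw [hXp]; exact hP0.2) hGX0
    (by
      filter_upwards [hnonneg] with y hy h0
      obtain ⟨x, hx, hxy⟩ := hy h0
      have : w x = inner ℝ e (y - p) := congrArg Prod.snd hxy
      rw [← this]
      exact hw0 x hx)
    (by
      filter_upwards [hzero] with y hy h0
      obtain ⟨x, hx, hxy⟩ := hy h0
      have : w x = inner ℝ e (y - p) := congrArg Prod.snd hxy
      rw [← this]
      exact hwT x hx)
  filter_upwards [hnonneg, hzero, hhalf] with y h1 h2 h3
  refine ⟨fun ht => ?_, fun ht => ?_⟩
  · obtain ⟨x, hx, hxy⟩ := h1 (h3.2 ht)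
    obtain ⟨hx1, hx2⟩ := Prod.mk.inj hxy
    subst hx1
    exact ⟨hx, hx2⟩
  · obtain ⟨x, hx, hxy⟩ := h2 (h3.1 ht)
    obtain ⟨hx1, hx2⟩ := Prod.mk.inj hxy
    subst hx1
    exact hx

end GraphCurvature

/-! ### Invariance of the curvature conditions under the change of graph direction. -/

namespace GraphCurvature

open Matrix Filter Topology Metric

variable {n : ℕ}

section Congruence

variable {a b : EuclideanSpace ℝ (Fin n)} {T S A Ξ : Matrix (Fin n) (Fin n) ℝ} {c : ℝ}

/-- Inverse metric and Hessian transform contragrediently, so cyclicity of the trace removes `T` and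
only the scalar `c` remains. -/
lemma trace_invMetric_mul_of_congr (hG : invMetric a = T * invMetric b * Tᵀ)
    (hA : Tᵀ * A * T = c • Ξ) : (invMetric a * A).trace = c * (invMetric b * Ξ).trace := by
  have : invMetric a * A = T * (invMetric b * (Tᵀ * A)) := by
    rw [hG]
    simp only [Matrix.mul_assoc]
  rw [this, trace_mul_comm, Matrix.mul_assoc, hA, Matrix.mul_smul, trace_smul, smul_eq_mul]

lemma curvForm_of_congr (hG : invMetric a = T * invMetric b * Tᵀ)
    (hA : Tᵀ * A * T = c • Ξ) : curvForm a A = c ^ 2 * curvForm b Ξ := by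
  have h : invMetric a * A * (invMetric a * A) =
      T * (invMetric b * (Tᵀ * A * T) * (invMetric b * (Tᵀ * A))) := by
    rw [hG]
    simp only [Matrix.mul_assoc]
  have h2 : (invMetric a * A * (invMetric a * A)).trace =
      c ^ 2 * (invMetric b * Ξ * (invMetric b * Ξ)).trace := by
    rw [h, trace_mul_comm, Matrix.mul_assoc, Matrix.mul_assoc (invMetric b) (Tᵀ * A), hA]
    simp only [Matrix.mul_smul, Matrix.smul_mul, trace_smul, smul_eq_mul]
    ring
  unfold curvForm
  rw [h2, trace_invMetric_mul_of_congr hG hA]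
  ring

lemma newton_of_congr (hG : invMetric a = T * invMetric b * Tᵀ)
    (hA : Tᵀ * A * T = c • Ξ) : newton a A = c • (T * newton b Ξ * Tᵀ) := by
  have h : invMetric a * A * invMetric a = T * (invMetric b * (Tᵀ * A * T) * invMetric b) * Tᵀ := by
    rw [hG]
    simp only [Matrix.mul_assoc]
  unfold newton
  rw [h, hA, trace_invMetric_mul_of_congr hG hA, hG]
  simp only [Matrix.mul_sub, Matrix.sub_mul, Matrix.mul_smul, Matrix.smul_mul, smul_sub, smul_smul]

lemma posDef_newton_of_congr (hG : invMetric a = T * invMetric b * Tᵀ)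
    (hA : Tᵀ * A * T = c • Ξ) (hc : 0 < c) (hST : S * T = 1) (h : (newton a A).PosDef) :
    (newton b Ξ).PosDef := by
  have h1 : newton b Ξ = c⁻¹ • (S * newton a A * Sᵀ) := by
    rw [newton_of_congr hG hA, Matrix.mul_smul, Matrix.smul_mul, smul_smul, inv_mul_cancel₀ hc.ne',
      one_smul]
    have : Tᵀ * Sᵀ = 1 := by rw [← transpose_mul, hST, transpose_one]
    calc newton b Ξ = S * T * newton b Ξ * (Tᵀ * Sᵀ) := by
          rw [hST, this, Matrix.one_mul, Matrix.mul_one]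
      _ = _ := by simp only [Matrix.mul_assoc]
  rw [h1]
  refine PosDef.smul ?_ (inv_pos.2 hc)
  have := h.mul_mul_conjTranspose_same (B := S) (vecMul_injective_of_isUnit
    (IsUnit.of_mul_eq_one T hST))
  rwa [conjTranspose_eq_transpose_of_trivial] at this

lemma ext_of_dotProduct_mulVec {M N : Matrix (Fin n) (Fin n) ℝ}
    (h : ∀ c d : EuclideanSpace ℝ (Fin n), c.ofLp ⬝ᵥ M *ᵥ d.ofLp = c.ofLp ⬝ᵥ N *ᵥ d.ofLp) :
    M = N := by
  ext i j
  have := h (EuclideanSpace.single i 1) (EuclideanSpace.single j 1)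
  simpa using this

/-- The Jacobian `1 + e (b - e)ᵀ` of the change of graph direction relates the metrics. -/
lemma invMetric_eq_of_jacobian {e : EuclideanSpace ℝ (Fin n)} (he : ‖e‖ = 1)
    (hT : T = 1 + vecMulVec e.ofLp (b - e).ofLp) (hTa : Tᵀ *ᵥ a.ofLp = e.ofLp) :
    invMetric a = T * invMetric b * Tᵀ ∧ ∃ S, S * T = 1 := by
  have hee : e.ofLp ⬝ᵥ e.ofLp = 1 := by rw [dotProduct_self_eq_normSq, he, one_pow]
  -- The two induced metrics correspond under `T`: `Tᵀ T` lacks exactly the term `e eᵀ`, which `Tᵀ a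
  -- = e` supplies.
  have h1 : Tᵀ * (1 + vecMulVec a.ofLp a.ofLp) * T = 1 + vecMulVec b.ofLp b.ofLp := by
    have h2 : Tᵀ * vecMulVec a.ofLp a.ofLp * T = vecMulVec e.ofLp e.ofLp := by
      rw [mul_vecMulVec, vecMulVec_mul, hTa, ← mulVec_transpose, hTa]
    have h3 : Tᵀ * T = 1 + vecMulVec b.ofLp b.ofLp - vecMulVec e.ofLp e.ofLp := by
      rw [hT, transpose_add, transpose_one, transpose_vecMulVec, Matrix.add_mul, Matrix.mul_add,
        Matrix.mul_add, Matrix.one_mul, Matrix.one_mul, Matrix.mul_one, vecMulVec_mul_vecMulVec, hee,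
        one_smul]
      ext i j
      simp [vecMulVec_apply]
      ring
    rw [Matrix.mul_add, Matrix.mul_one, Matrix.add_mul, h2, h3, sub_add_cancel]
  have h4 : invMetric b * Tᵀ * (1 + vecMulVec a.ofLp a.ofLp) * T = 1 := by
    rw [Matrix.mul_assoc (invMetric b), Matrix.mul_assoc (invMetric b), h1, invMetric_mul_metric]
  refine ⟨?_, _, h4⟩
  have h5 := mul_eq_one_comm.1 h4
  have h6 : (1 + vecMulVec a.ofLp a.ofLp) * (T * invMetric b * Tᵀ) = 1 := by
    rw [mul_eq_one_comm]
    simpa only [Matrix.mul_assoc] using h5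
  calc invMetric a = invMetric a * ((1 + vecMulVec a.ofLp a.ofLp) * (T * invMetric b * Tᵀ)) := by
        rw [h6, Matrix.mul_one]
    _ = _ := by rw [← Matrix.mul_assoc, invMetric_mul_metric, Matrix.one_mul]

end Congruence

section Transfer

variable {e p y : EuclideanSpace ℝ (Fin n)} {f w : EuclideanSpace ℝ (Fin n) → ℝ}

/-- The chain rule for the identity "`w` at the surface point equals its height". It is stated on a
neighbourhood so that it can be differentiated again. -/
lemma fderiv_normalGraph_relation (hf : ContDiffAt ℝ 2 f y)
    (hw : ContDiffAt ℝ 2 w (normalGraph e p f y))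
    (h : ∀ᶠ z in 𝓝 y, w (normalGraph e p f z) = inner ℝ e (z - p)) (c : EuclideanSpace ℝ (Fin n)) :
    ∀ᶠ z in 𝓝 y, fderiv ℝ w (normalGraph e p f z) c + (fderiv ℝ f z c - inner ℝ e c) *
      fderiv ℝ w (normalGraph e p f z) e = inner ℝ e c := by
  have hX : ContinuousAt (normalGraph e p f) y :=
    (hasFDerivAt_normalGraph (hf.differentiableAt (by norm_num))).continuousAt
  filter_upwards [h.eventually_nhds, hf.eventually (by simp),
    hX.eventually (hw.eventually (by simp))] with z h1 h2 h3
  have h4 := (h3.differentiableAt (by norm_num)).hasFDerivAt.comp z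
    (hasFDerivAt_normalGraph (e := e) (p := p) (h2.differentiableAt (by norm_num)))
  have h5 : (w ∘ normalGraph e p f) =ᶠ[𝓝 z] fun y => inner ℝ e (y - p) := h1
  have h6 := h4.fderiv.symm.trans (h5.fderiv_eq.trans (hasFDerivAt_inner_sub e p z).fderiv)
  have h7 := congrArg (fun T => T c) h6
  simp only [ContinuousLinearMap.comp_apply, _root_.add_apply, _root_.sub_apply,
    ContinuousLinearMap.smulRight_apply, ContinuousLinearMap.id_apply, map_add, map_smul,
    smul_eq_mul, innerSL_apply_apply] at h7
  rw [fderiv_apply_eq_inner f]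
  exact h7

/-- The derivative of the first order relation. The factor `-w_e` in front of `D²f` is why `-D²f`
plays the role of the Hessian throughout. -/
lemma fderiv_fderiv_normalGraph_relation (hf : ContDiffAt ℝ 2 f y)
    (hw : ContDiffAt ℝ 2 w (normalGraph e p f y))
    (h : ∀ᶠ z in 𝓝 y, w (normalGraph e p f z) = inner ℝ e (z - p))
    (c d : EuclideanSpace ℝ (Fin n)) :
    fderiv ℝ (fderiv ℝ w) (normalGraph e p f y) (d + (inner ℝ (Du f y) d - inner ℝ e d : ℝ) • e)
      (c + (inner ℝ (Du f y) c - inner ℝ e c : ℝ) • e) =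
        -(fderiv ℝ w (normalGraph e p f y) e * fderiv ℝ (fderiv ℝ f) y d c) := by
  have h1 := fderiv_normalGraph_relation hf hw h c
  have hX := hasFDerivAt_normalGraph (e := e) (p := p) (hf.differentiableAt (by norm_num))
  have hW : HasFDerivAt (fun z => fderiv ℝ w (normalGraph e p f z)) _ y :=
    (differentiableAt_fderiv hw).hasFDerivAt.comp y hX
  have hWc := hW.clm_apply (hasFDerivAt_const c y)
  have hWe := hW.clm_apply (hasFDerivAt_const e y)
  have hfc := (differentiableAt_fderiv hf).hasFDerivAt.clm_apply (hasFDerivAt_const c y)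
  have h2 := hWc.add ((hfc.sub_const (inner ℝ e c)).mul hWe)
  have h3 : HasFDerivAt (fun _ => (inner ℝ e c : ℝ)) _ y := h2.congr_of_eventuallyEq
    (h1.mono fun z hz => hz.symm)
  have h4 := h3.unique (hasFDerivAt_const _ y)
  have h5 := congrArg (fun T => T d) h4
  simp [fderiv_apply_eq_inner f] at h5
  simp only [map_add, map_smul, _root_.add_apply, _root_.smul_apply, smul_eq_mul]
  linarith

/-- The graph of `w` in the vertical direction and that of `f` in the direction `e` have congruent
metrics and second fundamental forms. -/
lemma exists_congr_of_normalGraph (he : ‖e‖ = 1) (hf : ContDiffAt ℝ 2 f y)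
    (hw : ContDiffAt ℝ 2 w (normalGraph e p f y))
    (h : ∀ᶠ z in 𝓝 y, w (normalGraph e p f z) = inner ℝ e (z - p)) :
    ∃ (T S : Matrix (Fin n) (Fin n) ℝ) (c : ℝ), S * T = 1 ∧ c * fderiv ℝ f y e = 1 ∧
      invMetric (Du w (normalGraph e p f y)) = T * invMetric (Du f y) * Tᵀ ∧
      Tᵀ * D2u w (normalGraph e p f y) * T = c • -D2u f y := by
  set T : Matrix (Fin n) (Fin n) ℝ := 1 + vecMulVec e.ofLp (Du f y - e).ofLp with hT
  set x := normalGraph e p f y with hx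
  have hTc : ∀ c : EuclideanSpace ℝ (Fin n), T *ᵥ c.ofLp =
      (c + (inner ℝ (Du f y) c - inner ℝ e c : ℝ) • e).ofLp := by
    intro c
    rw [hT, add_mulVec, one_mulVec, vecMulVec_mulVec, ← inner_eq_dotProduct, inner_sub_left]
    ext i
    simp [mul_comm]
  have h1 : ∀ c, fderiv ℝ w x c + (fderiv ℝ f y c - inner ℝ e c) * fderiv ℝ w x e = inner ℝ e c :=
    fun c => (fderiv_normalGraph_relation hf hw h c).self_of_nhds
  have hTa : Tᵀ *ᵥ (Du w x).ofLp = e.ofLp := by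
    have key : ∀ c : EuclideanSpace ℝ (Fin n),
        c.ofLp ⬝ᵥ Tᵀ *ᵥ (Du w x).ofLp = c.ofLp ⬝ᵥ e.ofLp := by
      intro c
      rw [dotProduct_mulVec, vecMul_transpose, hTc, ← inner_eq_dotProduct, ← inner_eq_dotProduct,
        real_inner_comm, ← fderiv_apply_eq_inner, map_add, map_smul, smul_eq_mul,
        ← fderiv_apply_eq_inner, real_inner_comm e c]
      exact h1 c
    ext i
    simpa using key (EuclideanSpace.single i 1)
  obtain ⟨hG, S, hS⟩ := invMetric_eq_of_jacobian he hT hTa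
  refine ⟨T, S, fderiv ℝ w x e, hS, ?_, hG, ?_⟩
  · have := h1 e
    rw [real_inner_self_eq_norm_sq, he] at this
    linarith
  · refine ext_of_dotProduct_mulVec fun c d => ?_
    rw [← mulVec_mulVec, ← mulVec_mulVec, dotProduct_mulVec, vecMul_transpose, hTc, hTc,
      dotProduct_D2u_mulVec hw, fderiv_fderiv_normalGraph_relation hf hw h, smul_mulVec,
      neg_mulVec, dotProduct_smul, dotProduct_neg, dotProduct_D2u_mulVec hf, smul_eq_mul, mul_neg]

end Transfer

end GraphCurvature

/-! ### Monotonicity in the normal direction, reflection, defining functions. -/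

namespace GraphCurvature

open Matrix Filter Topology Metric

variable {n : ℕ}

section Monotonicity

variable {e p : EuclideanSpace ℝ (Fin n)} {r : ℝ}

lemma add_smul_mem_ball_of_le {x : EuclideanSpace ℝ (Fin n)} {s τ : ℝ} (hx : x ∈ ball p r)
    (hxs : x + s • e ∈ ball p r) (hτ0 : 0 ≤ τ) (hτs : τ ≤ s) : x + τ • e ∈ ball p r := by
  rcases hτ0.eq_or_lt with rfl | hpos
  · simpa using hx
  · have h1 := (convex_ball p r).add_smul_mem hx hxs (t := τ / s)
      ⟨div_nonneg hτ0 (by linarith), div_le_one_of_le₀ hτs (by linarith)⟩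
    rwa [smul_smul, div_mul_cancel₀ _ (hpos.trans_le hτs).ne'] at h1

lemma lt_add_smul_of_fderiv_pos {ρ : EuclideanSpace ℝ (Fin n) → ℝ}
    (hd : ∀ x ∈ ball p r, DifferentiableAt ℝ ρ x) (hpos : ∀ x ∈ ball p r, 0 < fderiv ℝ ρ x e)
    {x : EuclideanSpace ℝ (Fin n)} {s : ℝ} (hs : 0 < s) (hx : x ∈ ball p r)
    (hxs : x + s • e ∈ ball p r) : ρ x < ρ (x + s • e) := by
  have hmem : ∀ τ ∈ Set.Icc 0 s, x + τ • e ∈ ball p r := fun τ hτ =>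
    add_smul_mem_ball_of_le hx hxs hτ.1 hτ.2
  have hder : ∀ τ ∈ Set.Icc 0 s, HasDerivAt (fun τ : ℝ => ρ (x + τ • e))
      (fderiv ℝ ρ (x + τ • e) e) τ := fun τ hτ => hasDerivAt_line (hd _ (hmem τ hτ))
  obtain ⟨c, hc, hcs⟩ := exists_hasDerivAt_eq_slope _ _ hs
    (fun τ hτ => (hder τ hτ).continuousAt.continuousWithinAt)
    (fun τ hτ => hder τ (Set.Ioo_subset_Icc_self hτ))
  have h1 := hpos _ (hmem c (Set.Ioo_subset_Icc_self hc))
  rw [hcs, div_pos_iff_of_pos_right (by linarith)] at h1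
  simpa using h1

lemma sub_smul_mem_ball (he : ‖e‖ = 1) {y : EuclideanSpace ℝ (Fin n)} (hy : y ∈ ball p r) :
    y - (inner ℝ e (y - p) : ℝ) • e ∈ ball p r := by
  rw [mem_ball, dist_eq_norm] at hy ⊢
  refine lt_of_le_of_lt ?_ hy
  rw [sub_right_comm]
  refine le_of_sq_le_sq ?_ (norm_nonneg _)
  rw [norm_sub_sq_real, inner_smul_right, real_inner_comm, norm_smul, he, mul_one,
    Real.norm_eq_abs, sq_abs]
  nlinarith [sq_nonneg (inner ℝ e (y - p) : ℝ)]

/-- A function with nonvanishing derivative along `e` in a half ball, which is larger than on the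
flat part of the boundary, is increasing along `e`. -/
lemma fderiv_pos_of_ne_zero {f : EuclideanSpace ℝ (Fin n) → ℝ} (he : ‖e‖ = 1)
    (hf : ContDiffOn ℝ 2 f (ball p r))
    (hne : ∀ y ∈ ball p r, 0 < inner ℝ e (y - p) → fderiv ℝ f y e ≠ 0)
    (hlt : ∀ y ∈ ball p r, 0 < inner ℝ e (y - p) → f (y - (inner ℝ e (y - p) : ℝ) • e) < f y) :
    ∀ y ∈ ball p r, 0 < inner ℝ e (y - p) → 0 < fderiv ℝ f y e := by
  intro y hy hty
  set t : ℝ := inner ℝ e (y - p) with ht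
  set y₀ := y - t • e with hy₀
  have hy₀r : y₀ ∈ ball p r := sub_smul_mem_ball he hy
  have hyy : y₀ + t • e = y := sub_add_cancel _ _
  have hmem : ∀ τ ∈ Set.Icc 0 t, y₀ + τ • e ∈ ball p r := fun τ hτ =>
    add_smul_mem_ball_of_le hy₀r (by rwa [hyy]) hτ.1 hτ.2
  have hti : ∀ τ : ℝ, inner ℝ e (y₀ + τ • e - p) = τ := by
    intro τ
    have h1 := inner_add_smul_sub (p := p) he y₀ t
    rw [inner_add_smul_sub he]
    rw [hyy, ← ht] at h1
    linarith
  have hder : ∀ τ ∈ Set.Icc 0 t, HasDerivAt (fun τ : ℝ => f (y₀ + τ • e))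
      (fderiv ℝ f (y₀ + τ • e) e) τ := fun τ hτ => hasDerivAt_line
    ((hf.contDiffAt (isOpen_ball.mem_nhds (hmem τ hτ))).differentiableAt (by norm_num))
  -- The mean value theorem gives a point below `y` with positive derivative; a nonpositive value at
  -- `y` would then force a zero in between.
  obtain ⟨c, hc, hcs⟩ := exists_hasDerivAt_eq_slope _ _ hty
    (fun τ hτ => (hder τ hτ).continuousAt.continuousWithinAt)
    (fun τ hτ => hder τ (Set.Ioo_subset_Icc_self hτ))
  have hcpos : 0 < fderiv ℝ f (y₀ + c • e) e := by
    rw [hcs, hyy, zero_smul, add_zero]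
    exact div_pos (sub_pos.2 (hlt y hy hty)) (by linarith)
  by_contra! hneg
  have hcont : ContinuousOn (fun τ : ℝ => fderiv ℝ f (y₀ + τ • e) e) (Set.Icc c t) := by
    have h1 := (hf.continuousOn_fderiv_of_isOpen isOpen_ball (by norm_num)).clm_apply
      (continuousOn_const (c := e))
    refine h1.comp (f := fun τ : ℝ => y₀ + τ • e) (by fun_prop) fun τ hτ => ?_
    exact hmem τ ⟨hc.1.le.trans hτ.1, hτ.2⟩
  obtain ⟨τ, hτ, hτ0⟩ := intermediate_value_Icc' hc.2.le hcont
    (show (0 : ℝ) ∈ Set.Icc _ _ from ⟨by rw [hyy]; exact hneg, hcpos.le⟩)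
  refine hne _ (hmem τ ⟨hc.1.le.trans hτ.1, hτ.2⟩) ?_ hτ0
  rw [hti]
  exact hc.1.trans_le hτ.1

end Monotonicity

section Neg

lemma curvForm_neg_neg (q : EuclideanSpace ℝ (Fin n)) (A : Matrix (Fin n) (Fin n) ℝ) :
    curvForm (-q) (-A) = curvForm q A := by
  simp [curvForm, invMetric_neg]

/-- Reflection in the horizontal hyperplane. -/
lemma isC2HypersurfaceWithBoundary_neg {w : EuclideanSpace ℝ (Fin n) → ℝ}
    {S T : Set (EuclideanSpace ℝ (Fin n))}
    (h : IsC2HypersurfaceWithBoundary (graphOver w S) (graphOver w T)) :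
    IsC2HypersurfaceWithBoundary (graphOver (fun x => -w x) S) (graphOver (fun x => -w x) T) := by
  set R : (EuclideanSpace ℝ (Fin n) × ℝ) ≃L[ℝ] (EuclideanSpace ℝ (Fin n) × ℝ) :=
    (ContinuousLinearEquiv.refl ℝ _).prodCongr (ContinuousLinearEquiv.neg ℝ) with hR
  have hRR : ∀ X, R (R X) = X := fun X => by simp [hR]
  have hgr : ∀ (U : Set (EuclideanSpace ℝ (Fin n))) X,
      X ∈ graphOver (fun x => -w x) U ↔ R X ∈ graphOver w U := by
    intro U X
    constructor
    · rintro ⟨x, hx, rfl⟩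
      exact ⟨x, hx, by simp [hR]⟩
    · rintro ⟨x, hx, hxX⟩
      refine ⟨x, hx, ?_⟩
      rw [← hRR X, ← hxX]
      simp [hR]
  have hd : ∀ (F : EuclideanSpace ℝ (Fin n) × ℝ → ℝ) P,
      fderiv ℝ (fun X => F (R X)) P = (fderiv ℝ F (R P)).comp
        (R : (EuclideanSpace ℝ (Fin n) × ℝ) →L[ℝ] (EuclideanSpace ℝ (Fin n) × ℝ)) := by
    intro F P
    exact R.comp_right_fderiv
  have hinj : ∀ L L' : (EuclideanSpace ℝ (Fin n) × ℝ) →L[ℝ] ℝ,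
      L.comp (R : (EuclideanSpace ℝ (Fin n) × ℝ) →L[ℝ] (EuclideanSpace ℝ (Fin n) × ℝ)) =
        L'.comp (R : (EuclideanSpace ℝ (Fin n) × ℝ) →L[ℝ] (EuclideanSpace ℝ (Fin n) × ℝ)) →
        L = L' := by
    intro L L' hL
    refine ContinuousLinearMap.ext fun X => ?_
    have := congrArg (fun T => T (R X)) hL
    simpa [hRR] using this
  refine ⟨fun X hX => (hgr _ _).2 (h.1 ((hgr _ _).1 hX)), fun P hP => ?_, fun P hP => ?_⟩
  · obtain ⟨N, F, hN, hPN, hF, hF0, hMN⟩ :=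
      h.2.1 (R P) ⟨(hgr _ _).1 hP.1, fun h => hP.2 ((hgr _ _).2 h)⟩
    refine ⟨R ⁻¹' N, fun X => F (R X), hN.preimage R.continuous, hPN,
      hF.comp R.contDiff.contDiffOn (Set.mapsTo_preimage _ _), ?_, ?_⟩
    · rw [hd]
      intro h0
      exact hF0 (hinj _ 0 (by rw [h0, ContinuousLinearMap.zero_comp]))
    · ext X
      rw [Set.mem_inter_iff, hgr]
      exact Set.ext_iff.1 hMN (R X)
  · obtain ⟨N, F, G, hN, hPN, hF, hG, hlin, hMN, hΓN⟩ := h.2.2 (R P) ((hgr _ _).1 hP)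
    refine ⟨R ⁻¹' N, fun X => F (R X), fun X => G (R X), hN.preimage R.continuous, hPN,
      hF.comp R.contDiff.contDiffOn (Set.mapsTo_preimage _ _),
      hG.comp R.contDiff.contDiffOn (Set.mapsTo_preimage _ _), ?_, ?_, ?_⟩
    · rw [LinearIndependent.pair_iff] at hlin ⊢
      intro s t hst
      refine hlin s t (hinj _ 0 ?_)
      rw [hd, hd] at hst
      rw [ContinuousLinearMap.zero_comp, ← hst, ContinuousLinearMap.add_comp,
        ContinuousLinearMap.smul_comp, ContinuousLinearMap.smul_comp]
    · ext X
      rw [Set.mem_inter_iff, hgr]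
      exact Set.ext_iff.1 hMN (R X)
    · ext X
      rw [Set.mem_inter_iff, hgr]
      exact Set.ext_iff.1 hΓN (R X)

end Neg

section Boundary

variable {Ω : Set (EuclideanSpace ℝ (Fin n))} {p : EuclideanSpace ℝ (Fin n)} {r : ℝ}

/-- Near a `C¹` boundary point, a defining function increasing in the normal direction. -/
lemma exists_increasing_defining_function (hr : 0 < r) (h : HasC1BoundaryAt Ω p) :
    ∃ (e : EuclideanSpace ℝ (Fin n)) (ρ : EuclideanSpace ℝ (Fin n) → ℝ) (κ r₀ : ℝ),
      ‖e‖ = 1 ∧ 0 < r₀ ∧ r₀ ≤ r ∧ κ ≠ 0 ∧ Du ρ p = κ • e ∧ ρ p = 0 ∧ ContDiffOn ℝ 1 ρ (ball p r₀) ∧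
      (∀ x ∈ ball p r₀, x ∈ Ω ↔ ρ x < 0) ∧
      ∀ x ∈ ball p r₀, ∀ s : ℝ, 0 < s → x + s • e ∈ ball p r₀ → ρ x < ρ (x + s • e) := by
  obtain ⟨N, ρ, hN, hpN, hρ, hρp, hρ0, hΩN⟩ := h
  rw [← norm_ne_zero_iff, norm_fderiv_eq] at hρ0
  set e : EuclideanSpace ℝ (Fin n) := ‖Du ρ p‖⁻¹ • Du ρ p with he
  have hκ : 0 < ‖Du ρ p‖ := lt_of_le_of_ne (norm_nonneg _) hρ0.symm
  have he1 : ‖e‖ = 1 := by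
    rw [he, norm_smul, norm_inv, norm_norm, inv_mul_cancel₀ hρ0]
  have hDe : Du ρ p = ‖Du ρ p‖ • e := by rw [he, smul_inv_smul₀ hρ0]
  have hpos : 0 < fderiv ℝ ρ p e := by
    rw [fderiv_apply_eq_inner, he, inner_smul_right, real_inner_self_eq_norm_sq]
    positivity
  have hcont : ContinuousAt (fun x => fderiv ℝ ρ x e) p :=
    ((hρ.continuousOn_fderiv_of_isOpen hN le_rfl).continuousAt (hN.mem_nhds hpN)).clm_apply
      continuousAt_const
  obtain ⟨r₁, hr₁, hb⟩ := Metric.eventually_nhds_iff_ball.1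
    ((hN.eventually_mem hpN).and (hcont.eventually (lt_mem_nhds hpos)))
  have hsub : ball p (min r₁ r) ⊆ ball p r₁ := ball_subset_ball (min_le_left _ _)
  clear_value e
  refine ⟨e, ρ, ‖Du ρ p‖, min r₁ r, he1, lt_min hr₁ hr, min_le_right _ _, hρ0, hDe, hρp,
    hρ.mono fun x hx => (hb x (hsub hx)).1, fun x hx => ?_, fun x hx s hs hxs => ?_⟩
  · have hxN := (hb x (hsub hx)).1
    have := Set.ext_iff.1 hΩN x
    simpa [hxN] using this
  · have hd : ∀ y ∈ ball p (min r₁ r), DifferentiableAt ℝ ρ y := fun y hy => by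
      have hyN : N ∈ 𝓝 y := hN.mem_nhds (hb y (hsub hy)).1
      exact (hρ.contDiffAt hyN).differentiableAt one_ne_zero
    exact lt_add_smul_of_fderiv_pos (e := e) (s := s) hd (fun y hy => (hb y (hsub hy)).2) hs hx hxs

end Boundary

end GraphCurvature

/-! ### Assembly of the contradiction. -/

namespace GraphCurvature

open Matrix Filter Topology Metric

variable {n : ℕ} {e p : EuclideanSpace ℝ (Fin n)} {r : ℝ}

lemma curvForm_eq_zero_of_scalarCurv {q : EuclideanSpace ℝ (Fin n)} {A : Matrix (Fin n) (Fin n) ℝ}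
    (h : scalarCurv q A = 0) : curvForm q A = 0 := by
  rw [scalarCurv_eq] at h
  exact (mul_eq_zero.1 h).resolve_left (inv_ne_zero (one_add_normSq_pos q).ne')

lemma trace_nonneg_of_meanCurv {q : EuclideanSpace ℝ (Fin n)} {A : Matrix (Fin n) (Fin n) ℝ}
    (h : 0 ≤ meanCurv q A) : 0 ≤ (invMetric q * A).trace := by
  rw [meanCurv_eq] at h
  exact nonneg_of_mul_nonneg_right h (inv_pos.2 (Real.sqrt_pos.2 (one_add_normSq_pos q)))

lemma newton_posDef_of_ellipticityMatrix {q : EuclideanSpace ℝ (Fin n)}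
    {A : Matrix (Fin n) (Fin n) ℝ} (h : (ellipticityMatrix q A).PosDef) : (newton q A).PosDef := by
  have hs : 0 < Real.sqrt (1 + ‖q‖ ^ 2) := Real.sqrt_pos.2 (one_add_normSq_pos q)
  have := h.smul hs
  rwa [ellipticityMatrix_eq, smul_smul, mul_inv_cancel₀ hs.ne', one_smul] at this

lemma eventually_normalGraph_eq {f w : EuclideanSpace ℝ (Fin n) → ℝ}
    (h : ∀ y ∈ ball p r, 0 < inner ℝ e (y - p) →
      w (normalGraph e p f y) = inner ℝ e (y - p))
    {y : EuclideanSpace ℝ (Fin n)} (hy : y ∈ ball p r) (hty : 0 < inner ℝ e (y - p)) :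
    ∀ᶠ z in 𝓝 y, w (normalGraph e p f z) = inner ℝ e (z - p) := by
  have hc : Continuous fun y => (inner ℝ e (y - p) : ℝ) := by fun_prop
  filter_upwards [isOpen_ball.eventually_mem hy, hc.continuousAt.eventually (lt_mem_nhds hty)]
    with z h1 h2
  exact h z h1 h2

/-- The contradiction, in terms of the two graphs over the hyperplane tangent to the boundary. -/
lemma not_both_normalGraph (hr : 0 < r) (he : ‖e‖ = 1)
    {f g u v ρ : EuclideanSpace ℝ (Fin n) → ℝ} {Su Sv U : Set (EuclideanSpace ℝ (Fin n))}
    (hρ : ∀ x ∈ U, ∀ s : ℝ, 0 < s → x + s • e ∈ U → ρ x < ρ (x + s • e))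
    (hSu : IsOpen Su) (hSv : IsOpen Sv) (hu : ContDiffOn ℝ 2 u Su) (hv : ContDiffOn ℝ 2 v Sv)
    (hf : ContDiffOn ℝ 2 f (ball p r)) (hg : ContDiffOn ℝ 2 g (ball p r))
    (hfp : Du f p = 0) (hgp : Du g p = 0)
    (hfU : ∀ y ∈ ball p r, normalGraph e p f y ∈ U) (hgU : ∀ y ∈ ball p r, normalGraph e p g y ∈ U)
    (hfS : ∀ y ∈ ball p r, 0 < inner ℝ e (y - p) → normalGraph e p f y ∈ Su)
    (hgS : ∀ y ∈ ball p r, 0 < inner ℝ e (y - p) → normalGraph e p g y ∈ Sv)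
    (hfu : ∀ y ∈ ball p r, 0 < inner ℝ e (y - p) → u (normalGraph e p f y) = inner ℝ e (y - p))
    (hgv : ∀ y ∈ ball p r, 0 < inner ℝ e (y - p) → v (normalGraph e p g y) = inner ℝ e (y - p))
    (hρf : ∀ y ∈ ball p r, 0 < inner ℝ e (y - p) → 0 < ρ (normalGraph e p f y))
    (hρg : ∀ y ∈ ball p r, 0 < inner ℝ e (y - p) → ρ (normalGraph e p g y) < 0)
    (hρf0 : ∀ y ∈ ball p r, inner ℝ e (y - p) = 0 → ρ (normalGraph e p f y) = 0)
    (hρg0 : ∀ y ∈ ball p r, inner ℝ e (y - p) = 0 → ρ (normalGraph e p g y) = 0)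
    (hQu : ∀ x ∈ Su, curvForm (Du u x) (D2u u x) = 0)
    (hQv : ∀ x ∈ Sv, curvForm (Du v x) (D2u v x) = 0)
    (hHu : ∀ x ∈ Su, 0 ≤ (invMetric (Du u x) * D2u u x).trace)
    (hEu : ∀ x ∈ Su, (newton (Du u x) (D2u u x)).PosDef) : False := by
  have hff : ∀ y ∈ ball p r, 0 < inner ℝ e (y - p) →
      ∃ (T S : Matrix (Fin n) (Fin n) ℝ) (c : ℝ), S * T = 1 ∧ c * fderiv ℝ f y e = 1 ∧
        invMetric (Du u (normalGraph e p f y)) = T * invMetric (Du f y) * Tᵀ ∧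
        Tᵀ * D2u u (normalGraph e p f y) * T = c • -D2u f y := fun y hy hty =>
    exists_congr_of_normalGraph he (hf.contDiffAt (isOpen_ball.mem_nhds hy))
      (hu.contDiffAt (hSu.mem_nhds (hfS y hy hty))) (eventually_normalGraph_eq hfu hy hty)
  have hgg : ∀ y ∈ ball p r, 0 < inner ℝ e (y - p) →
      ∃ (T S : Matrix (Fin n) (Fin n) ℝ) (c : ℝ), S * T = 1 ∧ c * fderiv ℝ g y e = 1 ∧
        invMetric (Du v (normalGraph e p g y)) = T * invMetric (Du g y) * Tᵀ ∧
        Tᵀ * D2u v (normalGraph e p g y) * T = c • -D2u g y := fun y hy hty =>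
    exists_congr_of_normalGraph he (hg.contDiffAt (isOpen_ball.mem_nhds hy))
      (hv.contDiffAt (hSv.mem_nhds (hgS y hy hty))) (eventually_normalGraph_eq hgv hy hty)
  have hshift : ∀ y (a b : ℝ), y + (a - inner ℝ e (y - p)) • e + (b - a) • e =
      y + (b - inner ℝ e (y - p)) • e := by
    intro y a b
    rw [add_assoc, ← add_smul]
    congr 2
    ring
  have hs : ∀ y ∈ ball p r, 0 < inner ℝ e (y - p) → 0 < fderiv ℝ f y e := by
    refine fderiv_pos_of_ne_zero he hf (fun y hy hty h0 => ?_) fun y hy hty => ?_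
    · obtain ⟨T, S, c, -, hc, -⟩ := hff y hy hty
      rw [h0, mul_zero] at hc
      exact zero_ne_one hc
    -- The surface points over `y` and over its projection `y₀` differ by a multiple of `e`. Along
    -- `e` the function `ρ` increases, and it is `0` over `y₀` and positive over `y`.
    · by_contra! hle
      set t : ℝ := inner ℝ e (y - p) with ht
      set y₀ := y - t • e with hy₀
      have hy₀r : y₀ ∈ ball p r := sub_smul_mem_ball he hy
      have ht0 : inner ℝ e (y₀ - p) = (0 : ℝ) := by
        have := inner_add_smul_sub (p := p) he y (-t)
        rw [neg_smul, ← sub_eq_add_neg, ← ht, add_neg_cancel] at this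
        exact this
      have h1 := hρf y hy hty
      have h2 := hρf0 y₀ hy₀r ht0
      have h3 : normalGraph e p f y₀ = normalGraph e p f y + (f y₀ - f y) • e := by
        simp only [normalGraph, ht0, ← ht]
        clear_value y₀
        linear_combination (norm := module) hy₀
      rcases hle.eq_or_lt with h4 | h4
      · rw [h3, h4, sub_self, zero_smul, add_zero] at h2
        linarith
      · have := hρ _ (hfU y hy) _ (sub_pos.2 h4) (by rw [← h3]; exact hfU _ hy₀r)
        rw [← h3] at this
        linarith
  refine not_touching hr he hf hg hfp hgp (fun y hy hty => ?_) (fun y hy hty => ?_)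
    (fun y hy hty => ?_) (fun y hy hty => ?_) hs (fun y hy hty => ?_) fun y hy hty => ?_
  · obtain ⟨T, S, c, -, hc, hG, hA⟩ := hff y hy hty
    have h1 := curvForm_of_congr hG hA
    rw [hQu _ (hfS y hy hty)] at h1
    exact (mul_eq_zero.1 h1.symm).resolve_left (pow_ne_zero _ (left_ne_zero_of_mul_eq_one hc))
  · obtain ⟨T, S, c, -, hc, hG, hA⟩ := hgg y hy hty
    have h1 := curvForm_of_congr hG hA
    rw [hQv _ (hgS y hy hty)] at h1
    exact (mul_eq_zero.1 h1.symm).resolve_left (pow_ne_zero _ (left_ne_zero_of_mul_eq_one hc))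
  · obtain ⟨T, S, c, hST, hc, hG, hA⟩ := hff y hy hty
    have hcpos : 0 < c := pos_of_mul_pos_left (by rw [hc]; exact one_pos) (hs y hy hty).le
    exact posDef_newton_of_congr hG hA hcpos hST (hEu _ (hfS y hy hty))
  · obtain ⟨T, S, c, hST, hc, hG, hA⟩ := hff y hy hty
    have hcpos : 0 < c := pos_of_mul_pos_left (by rw [hc]; exact one_pos) (hs y hy hty).le
    have h1 := hHu _ (hfS y hy hty)
    rw [trace_invMetric_mul_of_congr hG hA] at h1
    exact nonneg_of_mul_nonneg_right h1 hcpos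
  -- The points of the two surfaces over `y` also lie on one line along `e`, so `f` and `g` are
  -- ordered as the values of `ρ` there: equal on `t = 0`, and in the next goal positive against
  -- negative.
  · have h1 := hρf0 y hy hty
    have h2 := hρg0 y hy hty
    have h3 := hshift y (f y) (g y)
    have h4 := hshift y (g y) (f y)
    rcases lt_trichotomy (f y) (g y) with h | h | h
    · have := hρ _ (hfU y hy) _ (sub_pos.2 h) (by
        unfold normalGraph; rw [h3]; exact hgU y hy)
      unfold normalGraph at *
      rw [h3] at this
      linarith
    · exact h
    · have := hρ _ (hgU y hy) _ (sub_pos.2 h) (by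
        unfold normalGraph; rw [h4]; exact hfU y hy)
      unfold normalGraph at *
      rw [h4] at this
      linarith
  · by_contra! hle
    have h1 := hρf y hy hty
    have h2 := hρg y hy hty
    have h3 := hshift y (f y) (g y)
    rcases hle.eq_or_lt with h | h
    · unfold normalGraph at *
      rw [h] at h1
      linarith
    · have := hρ _ (hfU y hy) _ (sub_pos.2 h) (by
        unfold normalGraph; rw [h3]; exact hgU y hy)
      unfold normalGraph at *
      rw [h3] at this
      linarith

end GraphCurvature

open GraphCurvature Metric Filter Topology in
theorem mainTheorem8 (n : ℕ) (Ω : Set (EuclideanSpace ℝ (Fin n))) (hΩ : IsOpen Ω)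
    (p : EuclideanSpace ℝ (Fin n)) (hp : p ∈ frontier Ω)
    (r : ℝ) (hr : 0 < r)
    (hC1 : ∀ q ∈ frontier Ω ∩ Metric.ball p r, GraphCurvature.HasC1BoundaryAt Ω q)
    (u v : EuclideanSpace ℝ (Fin n) → ℝ)
    -- regularity of `u` and `v`
    (hu2 : ContDiffOn ℝ 2 u (Metric.ball p r \ closure (Ω ∩ Metric.ball p r)))
    (hu0 : ContinuousOn u (Metric.ball p r \ (Ω ∩ Metric.ball p r)))
    (hv2 : ContDiffOn ℝ 2 v (Ω ∩ Metric.ball p r))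
    (hv0 : ContinuousOn v (closure (Ω ∩ Metric.ball p r)))
    -- signs
    (hu_nonneg : ∀ x ∈ Metric.ball p r \ (Ω ∩ Metric.ball p r), 0 ≤ u x)
    (hv_nonpos : ∀ x ∈ closure (Ω ∩ Metric.ball p r), v x ≤ 0)
    -- the graphs are `C²` hypersurfaces up to the boundary
    (hu_graph : GraphCurvature.IsC2HypersurfaceWithBoundary
      (GraphCurvature.graphOver u (Metric.ball p r \ (Ω ∩ Metric.ball p r)))
      (GraphCurvature.graphOver u (frontier Ω ∩ Metric.ball p r)))
    (hv_graph : GraphCurvature.IsC2HypersurfaceWithBoundary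
      (GraphCurvature.graphOver v (closure (Ω ∩ Metric.ball p r) ∩ Metric.ball p r))
      (GraphCurvature.graphOver v (frontier Ω ∩ Metric.ball p r)))
    -- curvature conditions
    (hu_R : ∀ x ∈ Metric.ball p r \ closure (Ω ∩ Metric.ball p r),
      GraphCurvature.scalarCurv (GraphCurvature.Du u x) (GraphCurvature.D2u u x) = 0)
    (hv_R : ∀ x ∈ Ω ∩ Metric.ball p r,
      GraphCurvature.scalarCurv (GraphCurvature.Du v x) (GraphCurvature.D2u v x) = 0)
    (hu_H : ∀ x ∈ Metric.ball p r \ closure (Ω ∩ Metric.ball p r),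
      0 ≤ GraphCurvature.meanCurv (GraphCurvature.Du u x) (GraphCurvature.D2u u x))
    (hv_H : ∀ x ∈ Ω ∩ Metric.ball p r,
      0 ≤ GraphCurvature.meanCurv (GraphCurvature.Du v x) (GraphCurvature.D2u v x))
    (hu_elliptic : ∀ x ∈ Metric.ball p r \ closure (Ω ∩ Metric.ball p r),
      (GraphCurvature.ellipticityMatrix
        (GraphCurvature.Du u x) (GraphCurvature.D2u u x)).PosDef)
    -- boundary values
    (hu_bdry : ∀ x ∈ frontier Ω ∩ Metric.ball p r, u x = 0)
    (hv_bdry : ∀ x ∈ frontier Ω ∩ Metric.ball p r, v x = 0) :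
    ¬ (Filter.Tendsto (fun x => ‖GraphCurvature.Du u x‖)
          (nhdsWithin p (Metric.ball p r \ closure (Ω ∩ Metric.ball p r))) Filter.atTop ∧
        Filter.Tendsto (fun x => ‖GraphCurvature.Du v x‖)
          (nhdsWithin p (Ω ∩ Metric.ball p r)) Filter.atTop) := by
  rintro ⟨hDu, hDv⟩
  set B := ball p r with hB
  have hpB : p ∈ B := mem_ball_self hr
  have hBo : IsOpen B := isOpen_ball
  obtain ⟨e, ρ, κ, r₀, he, hr₀, hr₀r, hκ, hρe, hρp, hρ, hΩρ, hmono⟩ :=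
    exists_increasing_defining_function hr (hC1 p ⟨hp, hpB⟩)
  have hsub : ball p r₀ ⊆ B := ball_subset_ball hr₀r
  have hpr₀ : p ∈ ball p r₀ := mem_ball_self hr₀
  have hρc : ∀ x ∈ ball p r₀, ContinuousAt ρ x := fun x hx =>
    hρ.continuousOn.continuousAt (isOpen_ball.mem_nhds hx)
  have hout : ∀ x ∈ ball p r₀, 0 < ρ x → x ∉ closure Ω := by
    intro x hx hpos hcl
    have h1 : ∀ᶠ z in 𝓝 x, z ∉ Ω := by
      filter_upwards [isOpen_ball.eventually_mem hx, (hρc x hx).eventually (lt_mem_nhds hpos)]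
        with z hz1 hz2 hz3
      exact lt_asymm hz2 ((hΩρ z hz1).1 hz3)
    exact (mem_closure_iff_frequently.1 hcl) h1
  have hbd : ∀ x ∈ ball p r₀, ρ x = 0 → x ∈ frontier Ω := by
    intro x hx h0
    rw [hΩ.frontier_eq]
    refine ⟨?_, fun h => by have := (hΩρ x hx).1 h; linarith⟩
    have h1 : Tendsto (fun s : ℝ => x + s • e) (𝓝[<] 0) (𝓝 x) :=
      (tendsto_add_smul x e).mono_left nhdsWithin_le_nhds
    refine mem_closure_of_tendsto h1 ?_
    filter_upwards [h1.eventually (isOpen_ball.eventually_mem hx), self_mem_nhdsWithin]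
      with s hs1 hs2
    -- Points of the zero set of `ρ` are limits of `x + s e` with `s < 0`, where `ρ` is negative by
    -- monotonicity.
    rw [hΩρ _ hs1, ← h0]
    have h3 := hmono _ hs1 (-s) (neg_pos.2 hs2)
    rw [add_assoc, ← add_smul, add_neg_cancel, zero_smul, add_zero] at h3
    exact h3 hx
  have hfr : ∀ x ∈ ball p r₀, x ∈ frontier Ω → ρ x = 0 := by
    intro x hx hxf
    rw [hΩ.frontier_eq] at hxf
    rcases lt_trichotomy (ρ x) 0 with h | h | h
    · exact absurd ((hΩρ x hx).2 h) hxf.2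
    · exact h
    · exact absurd hxf.1 (hout x hx h)
  have hpΩ : p ∉ Ω := fun h => by have := (hΩρ p hpr₀).1 h; linarith
  have hpcl : p ∈ closure (Ω ∩ B) := by
    rw [mem_closure_iff_nhds]
    intro t ht
    obtain ⟨x, hx⟩ := mem_closure_iff_nhds.1 (frontier_subset_closure hp) _
      (inter_mem ht (hBo.mem_nhds hpB))
    exact ⟨x, hx.1.1, hx.2, hx.1.2⟩
  have hpT : p ∈ frontier Ω ∩ B := ⟨hp, hpB⟩
  have hTnear : ∀ᶠ x in 𝓝 p, ρ x = 0 → x ∈ frontier Ω ∩ B := by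
    filter_upwards [isOpen_ball.eventually_mem hpr₀] with x hx h0
    exact ⟨hbd x hx h0, hsub hx⟩
  have hρ1 : ContDiffAt ℝ 1 ρ p := hρ.contDiffAt (isOpen_ball.mem_nhds hpr₀)
  have hSu : IsOpen (B \ closure (Ω ∩ B)) := hBo.sdiff isClosed_closure
  have hSv : IsOpen (Ω ∩ B) := hΩ.inter hBo
  have hneu : (𝓝[B \ closure (Ω ∩ B)] p).NeBot := by
    rw [← mem_closure_iff_nhdsWithin_neBot]
    have h1 : Tendsto (fun s : ℝ => p + s • e) (𝓝[>] 0) (𝓝 p) :=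
      (tendsto_add_smul p e).mono_left nhdsWithin_le_nhds
    refine mem_closure_of_tendsto h1 ?_
    filter_upwards [h1.eventually (isOpen_ball.eventually_mem hpr₀), self_mem_nhdsWithin]
      with s hs1 hs2
    refine ⟨hsub hs1, fun hcl => hout _ hs1 ?_ (closure_mono Set.inter_subset_left hcl)⟩
    rw [← hρp]
    exact hmono p hpr₀ s hs2 hs1
  have hnev : (𝓝[Ω ∩ B] p).NeBot := mem_closure_iff_nhdsWithin_neBot.1 hpcl
  have two0 : (2 : WithTop ℕ∞) ≠ 0 := by norm_num
  obtain ⟨f, hf, hfp, hDf, hfev⟩ := exists_normalGraph (S₀ := B \ closure (Ω ∩ B)) he hu_graph hSu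
    (Set.sdiff_subset_sdiff_right subset_closure) (hu2.differentiableOn two0) hneu hpT hu_nonneg
    hu_bdry (hu0 p ⟨hpB, fun h => hpΩ h.1⟩) hDu hρ1 hρp hκ hρe hTnear
  obtain ⟨g, hg, hgp, hDg, hgev⟩ := exists_normalGraph (S₀ := Ω ∩ B) (w := fun x => -v x) he
    (isC2HypersurfaceWithBoundary_neg hv_graph) hSv
    (fun x hx => ⟨subset_closure hx, hx.2⟩) (hv2.neg.differentiableOn two0) hnev hpT
    (fun x hx => neg_nonneg.2 (hv_nonpos x hx.1)) (fun x hx => by simp [hv_bdry x hx])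
    ((hv0 p hpcl).neg.mono Set.inter_subset_left)
    (by simpa only [Du_neg, norm_neg] using hDv) hρ1 hρp hκ hρe hTnear
  have hXf : ∀ᶠ y in 𝓝 p, normalGraph e p f y ∈ ball p r₀ :=
    (hasFDerivAt_normalGraph (hf.differentiableAt two0)).continuousAt.eventually
      (isOpen_ball.eventually_mem (by rwa [normalGraph_self hfp]))
  have hXg : ∀ᶠ y in 𝓝 p, normalGraph e p g y ∈ ball p r₀ :=
    (hasFDerivAt_normalGraph (hg.differentiableAt two0)).continuousAt.eventually
      (isOpen_ball.eventually_mem (by rwa [normalGraph_self hgp]))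
  obtain ⟨R, hR, hb⟩ := Metric.eventually_nhds_iff_ball.1
    (((hf.eventually (by simp)).and (hg.eventually (by simp))).and
      ((hXf.and hXg).and (hfev.and hgev)))
  have hρf : ∀ y ∈ ball p R, 0 < inner ℝ e (y - p) → 0 < ρ (normalGraph e p f y) := by
    intro y hy hty
    obtain ⟨-, ⟨hX, -⟩, hy', -⟩ := hb y hy
    obtain ⟨hS, hw⟩ := hy'.1 hty.le
    rcases lt_trichotomy (ρ (normalGraph e p f y)) 0 with h | h | h
    · exact absurd ⟨(hΩρ _ hX).2 h, hS.1⟩ hS.2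
    -- On `∂Ω` the function `u` vanishes, whereas at this point it equals the height `t > 0`.
    · have := hu_bdry _ ⟨hbd _ hX h, hS.1⟩
      linarith
    · exact h
  have hρg : ∀ y ∈ ball p R, 0 < inner ℝ e (y - p) → ρ (normalGraph e p g y) < 0 := by
    intro y hy hty
    obtain ⟨-, ⟨-, hX⟩, -, hy'⟩ := hb y hy
    obtain ⟨hS, hw⟩ := hy'.1 hty.le
    rcases lt_trichotomy (ρ (normalGraph e p g y)) 0 with h | h | h
    · exact h
    · have := hv_bdry _ ⟨hbd _ hX h, hS.2⟩
      linarith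
    · exact absurd (closure_mono Set.inter_subset_left hS.1) (hout _ hX h)
  refine not_both_normalGraph (U := ball p r₀) (ρ := ρ) (u := u) (v := fun x => -v x) hR he hmono
    hSu hSv hu2 hv2.neg (fun y hy => (hb y hy).1.1.contDiffWithinAt)
    (fun y hy => (hb y hy).1.2.contDiffWithinAt) hDf hDg
    (fun y hy => (hb y hy).2.1.1) (fun y hy => (hb y hy).2.1.2) (fun y hy hty => ?_)
    (fun y hy hty => ?_) (fun y hy hty => ((hb y hy).2.2.1.1 hty.le).2)
    (fun y hy hty => ((hb y hy).2.2.2.1 hty.le).2) hρf hρg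
    (fun y hy hty => hfr _ (hb y hy).2.1.1 ((hb y hy).2.2.1.2 hty).1)
    (fun y hy hty => hfr _ (hb y hy).2.1.2 ((hb y hy).2.2.2.2 hty).1)
    (fun x hx => curvForm_eq_zero_of_scalarCurv (hu_R x hx)) (fun x hx => ?_)
    (fun x hx => trace_nonneg_of_meanCurv (hu_H x hx))
    fun x hx => newton_posDef_of_ellipticityMatrix (hu_elliptic x hx)
  · have hX := (hb y hy).2.1.1
    exact ⟨hsub hX, fun h => hout _ hX (hρf y hy hty) (closure_mono Set.inter_subset_left h)⟩
  · have hX := (hb y hy).2.1.2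
    exact ⟨(hΩρ _ hX).2 (hρg y hy hty), hsub hX⟩
  -- The curvature form is even in the gradient and in the Hessian, so the reflected graph still has
  -- zero scalar curvature.
  · rw [Du_neg, D2u_neg, curvForm_neg_neg]
    exact curvForm_eq_zero_of_scalarCurv (hv_R x hx)
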